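/- **Setting.** Let $q,t\in\mathbb C^\times$ with $|q|<1$, $t^k\neq1$ for all $k\ge1$ and $q^nt\ne1$ for all $n\ge0$; fix values of $\log q$, $\log t$ and a branch of $\log x$ on $\mathbb C^\times$ with $\log(qx)=\log x+\log q$. Let $N\ge0$, $Q:=t^N$, $(z;q)_\infty=\prod_{k\ge0}(1-q^kz)$, $\Delta_{q,t}(x)=\prod_{i\ne j}\frac{(x_i/x_j;q)_\infty}{(tx_i/x_j;q)_\infty}$. Let $w$ be a weight function and $M^\pm(z)=\sum_{k=0}^{d_\pm}M^\pm_kz^k$ two non-zero polynomials with $\frac{w(z)}{w(q^{-1}z)}=\frac{M^+(z)}{M^-(z)}$ on $\mathbb C^\times$ (off a discrete set). Put $$\Phi(x)=\Delta_{q,t}(x)\prod_{i=1}^Nx_i^{\frac{\log t}{\log q}(N-1)}w(x_i),\qquad \mathsf Z^w(\mathbf p)=\frac{\oint_{\mathcal C}\prod_i dx_i\,\Phi(x)\exp\Big(\sum_{k\ge1}\frac{1-t^k}{1-q^k}\frac{p_k}{k}\sum_ix_i^k\Big)}{\oint_{\mathcal C}\prod_idx_i\,\Phi(x)}\in\mathbb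 C[[p_1,p_2,\dots]].$$ *Contour and $m_0$.* Let $m_0=0$, or $m_0=-1$ if $M^+(0)=M^-(0)\neq0$. The contour is $\mathcal C=\mathcal C_1\times\dots\times\mathcal C_N$, where each $\mathcal C_i=\sum_{a}\mathcal C_{i,a}$ is a finite or infinite sum of cycles (finite sums of closed $C^1$ curves in $\mathbb C^\times$) that avoid the poles of the integrand: $x^{\frac{\log t}{\log q}(N-1)}w(x)$ is analytic on each $\mathcal C_i$, and $tq^nx\ne y$ for $x\in\mathcal C_i$, $y\in\mathcal C_j$, $i\ne j$, $n\ge0$. It satisfies the $q$-shift condition: for each $i$ there is a permutation $\sigma$ of the components such that $\mathcal C_{i,\sigma(a)}$ and $\mathcal C_{i,a}$ have the same winding number about $0$ and, whenever $p$ and $p/q$ are both non-removable singularities of $\Phi$ as a function of $x_i$ (with $x_j\in\mathcal C_j$ fixed for $j\ne i$), the winding number of $\mathcal C_{i,\sigma(a)}$ about $p$ equals that of $\mathcal C_{i,a}$ about $p/q$. (For a single cycle in each variable: $p$ and $p/q$ are enclosed equally often.) If there are infinitely many components, the sums over the components of the integrals of $f\,\Phi$ and of $x_i^{m_0}f\prod_{j\ne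 i}\frac{t^{-1}x_i-x_j}{x_i-x_j}\,\Phi$ are assumed to converge absolutely for all polynomials $f$ and all $i$. *Operators.* Let $h_n(a_k)$ be the coefficient of $z^n$ in $\exp(\sum_{k\ge1}z^ka_k/k)$ (zero for $n<0$), $p_k^\perp=k\frac{1-q^k}{1-t^k}\frac{\partial}{\partial p_k}$, and $$x^\pm(z)=\sum_{n\in\mathbb Z}x^\pm_nz^{-n}=\exp\Big(\sum_{k\ge1}(1-t^{\mp k})z^k\frac{p_k}k\Big)\exp\Big(-\sum_{k\ge1}(1-q^{\pm k})z^{-k}\frac{\partial}{\partial p_k}\Big)$$ the quantum toroidal $\mathfrak{gl}_1$ currents in the horizontal Fock representation. The $q,t$-Virasoro current is $$\hat{\mathsf U}^w(z)=M^-(z)\Big\{1-Q^{-1}e^{\sum_{k}(1-q^k)z^{-k}\partial_{p_k}}\Big\}+qt^{-1}M^+(z)\,e^{\sum_k(1-t^{-k})(t/q)^kz^kp_k/k}\Big\{1-Q\,e^{-\sum_k(1-q^k)(t/q)^{-k}z^{-k}\partial_{p_k}}\Big\}.$$ **Statement.** (1) For every $m\in\mathbb Z$ the coefficient of $z^m$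 in $\big\{\exp\big(-\sum_k(1-t^{-k})(t/q)^kz^k\frac{p_k}{k}\big)-1\big\}\hat{\mathsf U}^w(z)$ is the operator $$\begin{aligned}\mathsf R_m=&\sum_{l=0}^{d_-}M^-_l\Big\{(t/q)^{m-l}h_{m-l}\big(-(1-t^{-k})p_k\big)-\delta_{l,m}-Q^{-1}\big(q^{l-m}x^-_{l-m}-h_{l-m}((1-t^k)p_k^\perp)\big)\Big\}\\ &+qt^{-1}\sum_{l=0}^{d_+}M^+_l\Big\{\delta_{l,m}-(t/q)^{m-l}h_{m-l}\big((1-t^{-k})p_k\big)+Q(t/q)^{m-l}\big(x^+_{l-m}-h_{l-m}(-(1-t^k)p_k^\perp)\big)\Big\}.\end{aligned}$$ (2) $\mathsf R_m\cdot\mathsf Z^w(\mathbf p)=0$ for every integer $m\le1-m_0$. (3) If $d_+\le d_-$, then $\mathsf R_{d_-}=\hat{\mathsf A}^w$, where $$\begin{aligned}\hat{\mathsf A}^w=&\sum_{l=0}^{d_-}M^-_{d_--l}\Big\{Q^{-1}(\delta_{l,0}-q^{-l}x^-_{-l})+(t/q)^lh_l\big(-(1-t^{-k})p_k\big)-\delta_{l,0}\Big\}\\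 &-qt^{-1}\sum_{l=0}^{d_+}M^+_{d_+-l}\Big\{Q(t/q)^{d_--d_++l}\big(\delta_{d_+,d_-+l}-x^+_{d_+-d_--l}\big)+h_{d_--d_++l}\big((1-t^{-k})(t/q)^kp_k\big)-\delta_{d_+,d_-+l}\Big\}.\end{aligned}$$ If moreover $d_-\le1-m_0$, then $\hat{\mathsf A}^w\cdot\mathsf Z^w(\mathbf p)=0$. -/

import Mathlib

open scoped Topology BigOperators

noncomputable section

namespace QTMatrixModel

/-! ### Formal power series in the power sums and operators on them -/

/-- The completed ring of symmetric functions `ℂ[[p₁, p₂, …]]`; the variable `X k` is `p_k`. -/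
abbrev Lam : Type := MvPowerSeries ℕ+ ℂ

/-- Linear operators on `ℂ[[p₁, p₂, …]]`. -/
abbrev Op : Type := Module.End ℂ Lam

/-- Multiplication by the power sum `p_k`. -/
def pMul (k : ℕ+) : Op := LinearMap.mulLeft ℂ (MvPowerSeries.X k : Lam)

/-- The derivation `∂/∂p_k`. -/
def pDer (k : ℕ+) : Op := (MvPowerSeries.pderiv ℂ k : Derivation ℂ Lam Lam).toLinearMap

/-- The adjoint of `p_k` for the Macdonald inner product,
`p_k^⊥ = k (1 - q^k) / (1 - t^k) ∂/∂p_k`. -/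
def pPerp (q t : ℂ) (k : ℕ+) : Op :=
  ((k : ℂ) * ((1 - q ^ (k : ℕ)) / (1 - t ^ (k : ℕ)))) • pDer k

/-- The weight of a monomial, where `p_k` has weight `k`. -/
def wt (μ : ℕ+ →₀ ℕ) : ℕ := μ.sum fun k e => (k : ℕ) * e

/-- The power series `∑_{k ≥ 1} (a_k / k) z^k` in `z` with operator coefficients. -/
def genSeries (a : ℕ+ → Op) : PowerSeries Op :=
  PowerSeries.mk fun k : ℕ => if hk : 0 < k then ((k : ℂ)⁻¹) • a ⟨k, hk⟩ else 0

/-- The homogeneous symmetric function `h_n` regarded as a function of the power sums, evaluated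
at a sequence of (commuting) operators `a_k`: the coefficient of `z^n` in
`exp (∑_{k ≥ 1} z^k a_k / k)`, and zero for `n < 0`. The terms of the exponential series of order
`j > n` do not contribute to the coefficient of `z^n`. -/
def hMode (a : ℕ+ → Op) (n : ℤ) : Op :=
  if n < 0 then 0
  else ∑ j ∈ Finset.range (n.toNat + 1),
    ((Nat.factorial j : ℂ)⁻¹) • PowerSeries.coeff n.toNat (genSeries a ^ j)

/-- The sum `∑_{a ≥ 0} T_a` of a sequence of operators such that `T_a f` only has monomials of
weight `≥ a`: the terms with `a > wt μ` do not contribute to the coefficient of `p^μ`. -/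
def gradedSum (T : ℕ → Op) : Op :=
  LinearMap.pi fun μ : ℕ+ →₀ ℕ =>
    ∑ a ∈ Finset.range (wt μ + 1), (MvPowerSeries.coeff μ : Lam →ₗ[ℂ] ℂ) ∘ₗ T a

theorem wt_add (μ ν : ℕ+ →₀ ℕ) : wt (μ + ν) = wt μ + wt ν := by
  unfold wt
  exact Finsupp.sum_add_index' (fun _ => by simp) (fun _ _ _ => by ring)

theorem coeff_X_mul_eq_zero (k : ℕ+) (f : MvPowerSeries ℕ+ ℂ) (d : ℕ)
    (hf : ∀ μ : ℕ+ →₀ ℕ, wt μ < d → MvPowerSeries.coeff μ f = 0) (ν : ℕ+ →₀ ℕ)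
    (hν : wt ν < k + d) : MvPowerSeries.coeff ν (MvPowerSeries.X k * f) = 0 := by
  rw [MvPowerSeries.X_def, MvPowerSeries.coeff_monomial_mul]
  split_ifs with hle
  · rw [hf, mul_zero]
    obtain ⟨ρ, rfl⟩ := exists_add_of_le hle
    rw [wt_add] at hν
    have h1 : wt (Finsupp.single k 1) = k := by simp [wt]
    rw [add_tsub_cancel_left]
    omega
  · rfl

/-- The coefficients of `h_n` in multiplication operators raise the weight by at least `n`, so that
the truncations in `gradedSum` below lose nothing. -/
theorem coeff_hMode_eq_zero (c : ℕ+ → ℂ) (n : ℕ) (f : Lam) (μ : ℕ+ →₀ ℕ) (h : wt μ < n) :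
    MvPowerSeries.coeff μ (hMode (fun k => c k • pMul k) (n : ℤ) f) = 0 := by
  have key : ∀ j n : ℕ, ∀ f : Lam, ∀ d : ℕ,
      (∀ μ : ℕ+ →₀ ℕ, wt μ < d → MvPowerSeries.coeff μ f = 0) →
      ∀ μ : ℕ+ →₀ ℕ, wt μ < n + d → MvPowerSeries.coeff μ
        (PowerSeries.coeff n (genSeries (fun k => c k • pMul k) ^ j) f) = 0 := by
    intro j
    induction j with
    | zero =>
      intro n f d hf μ hμ
      rw [pow_zero, PowerSeries.coeff_one]
      split_ifs with hn
      · subst hn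
        simpa using hf μ (by simpa using hμ)
      · simp
    | succ j ih =>
      intro n f d hf μ hμ
      rw [pow_succ, PowerSeries.coeff_mul, LinearMap.sum_apply, map_sum]
      refine Finset.sum_eq_zero fun x hx => ?_
      have hx' : x.1 + x.2 = n := by simpa using hx
      rw [Module.End.mul_apply]
      refine ih x.1 _ (x.2 + d) ?_ μ (by omega)
      intro ν hν
      rw [genSeries, PowerSeries.coeff_mk]
      split_ifs with hk
      · simp only [LinearMap.smul_apply, pMul, LinearMap.mulLeft_apply, map_smul]
        have : MvPowerSeries.coeff ν ((MvPowerSeries.X (⟨x.2, hk⟩ : ℕ+) : Lam) * f) = 0 :=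
          coeff_X_mul_eq_zero ⟨x.2, hk⟩ f d hf ν (by simpa [add_comm] using hν)
        simp [this]
      · simp
  unfold hMode
  rw [if_neg (by omega), LinearMap.sum_apply, map_sum]
  refine Finset.sum_eq_zero fun j _ => ?_
  rw [LinearMap.smul_apply, map_smul, Int.toNat_natCast,
    key j n f 0 (by intro ν hν; omega) μ (by omega), smul_zero]

/-- The operator that multiplies by the coefficient of `z^{-n}` in the normally ordered vertex
operator `exp (∑_{k ≥ 1} α_k z^k p_k / k) exp (∑_{k ≥ 1} β_k z^{-k} ∂/∂p_k)`. -/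
def vertexMode (α β : ℕ+ → ℂ) (n : ℤ) : Op :=
  gradedSum fun a => hMode (fun k => α k • pMul k) (a : ℤ) *
    hMode (fun k => β k • ((k : ℂ) • pDer k)) ((a : ℤ) + n)

/-- The mode `x⁺_n` of the quantum toroidal `gl₁` current
`x⁺(z) = ∑_n x⁺_n z^{-n} = exp (∑ (1 - t^{-k}) z^k p_k / k) exp (-∑ (1 - q^k) z^{-k} ∂/∂p_k)`. -/
def xPlus (q t : ℂ) (n : ℤ) : Op :=
  vertexMode (fun k => 1 - t ^ (-(k : ℤ))) (fun k => -(1 - q ^ (k : ℤ))) n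

/-- The mode `x⁻_n` of the quantum toroidal `gl₁` current
`x⁻(z) = ∑_n x⁻_n z^{-n} = exp (∑ (1 - t^k) z^k p_k / k) exp (-∑ (1 - q^{-k}) z^{-k} ∂/∂p_k)`. -/
def xMinus (q t : ℂ) (n : ℤ) : Op :=
  vertexMode (fun k => 1 - t ^ (k : ℤ)) (fun k => -(1 - q ^ (-(k : ℤ)))) n

/-- The Kronecker delta, as a complex number. -/
def kd (a b : ℤ) : ℂ := if a = b then 1 else 0

/-- The mode `Û_n` of the `q,t`-Virasoro current `Û(z) = ∑_n Û_n z^{-n}`,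
`Û(z) = M⁻(z) {1 - Q⁻¹ exp (∑ (1 - q^k) z^{-k} ∂/∂p_k)}
  + (q/t) M⁺(z) exp (∑ (1 - t^{-k}) (t/q)^k z^k p_k / k)
    {1 - Q exp (-∑ (1 - q^k) (t/q)^{-k} z^{-k} ∂/∂p_k)}`,
where `M^±(z) = ∑_{l ≤ d_±} M^±_l z^l`. -/
def virasoroMode (q t Q : ℂ) (Mp Mm : Polynomial ℂ) (dp dm : ℕ) (n : ℤ) : Op :=
  (∑ l ∈ Finset.range (dm + 1), Mm.coeff l •
      (kd (l + n) 0 • (1 : Op)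
        - Q⁻¹ • hMode (fun k => (1 - q ^ (k : ℤ)) • ((k : ℂ) • pDer k)) (l + n)))
  + (q * t⁻¹) • ∑ l ∈ Finset.range (dp + 1), Mp.coeff l •
      (hMode (fun k => ((1 - t ^ (-(k : ℤ))) * (t / q) ^ (k : ℤ)) • pMul k) (-(l + n))
        - Q • vertexMode (fun k => (1 - t ^ (-(k : ℤ))) * (t / q) ^ (k : ℤ))
            (fun k => -((1 - q ^ (k : ℤ)) * (t / q) ^ (-(k : ℤ)))) (l + n))

/-- The coefficient of `z^m` in
`{exp (-∑ (1 - t^{-k}) (t/q)^k z^k p_k / k) - 1} Û(z)`. -/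
def resummedMode (q t Q : ℂ) (Mp Mm : Polynomial ℂ) (dp dm : ℕ) (m : ℤ) : Op :=
  gradedSum fun j =>
    (hMode (fun k => (-((1 - t ^ (-(k : ℤ))) * (t / q) ^ (k : ℤ))) • pMul k) (j : ℤ)
        - kd j 0 • (1 : Op))
      * virasoroMode q t Q Mp Mm dp dm ((j : ℤ) - m)

/-- The operator of the resummed constraint equation of index `m`. -/
def constraintOp (q t Q : ℂ) (Mp Mm : Polynomial ℂ) (dp dm : ℕ) (m : ℤ) : Op :=
  (∑ l ∈ Finset.range (dm + 1), Mm.coeff l •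
      ((t / q) ^ (m - l) • hMode (fun k => (-(1 - t ^ (-(k : ℤ)))) • pMul k) (m - l)
        - kd l m • (1 : Op)
        - Q⁻¹ • (q ^ ((l : ℤ) - m) • xMinus q t (l - m)
            - hMode (fun k => (1 - t ^ (k : ℤ)) • pPerp q t k) (l - m))))
  + (q * t⁻¹) • ∑ l ∈ Finset.range (dp + 1), Mp.coeff l •
      (kd l m • (1 : Op)
        - (t / q) ^ (m - l) • hMode (fun k => (1 - t ^ (-(k : ℤ))) • pMul k) (m - l)
        + (Q * (t / q) ^ (m - l)) • (xPlus q t (l - m)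
            - hMode (fun k => (-(1 - t ^ (k : ℤ))) • pPerp q t k) (l - m)))

/-- The recursion operator `Â^w`. -/
def recursionOp (q t Q : ℂ) (Mp Mm : Polynomial ℂ) (dp dm : ℕ) : Op :=
  (∑ l ∈ Finset.range (dm + 1), Mm.coeff (dm - l) •
      (Q⁻¹ • (kd l 0 • (1 : Op) - q ^ (-(l : ℤ)) • xMinus q t (-l))
        + (t / q) ^ (l : ℤ) • hMode (fun k => (-(1 - t ^ (-(k : ℤ)))) • pMul k) l
        - kd l 0 • (1 : Op)))
  - (q * t⁻¹) • ∑ l ∈ Finset.range (dp + 1), Mp.coeff (dp - l) •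
      ((Q * (t / q) ^ ((dm : ℤ) - dp + l)) •
          (kd dp (dm + l) • (1 : Op) - xPlus q t ((dp : ℤ) - dm - l))
        + hMode (fun k => ((1 - t ^ (-(k : ℤ))) * (t / q) ^ (k : ℤ)) • pMul k) ((dm : ℤ) - dp + l)
        - kd dp (dm + l) • (1 : Op))

/-! ### Contours -/

/-- A cycle in the complex plane: a finite formal sum of closed `C¹` curves, each parametrized by
`[0, 1]`. -/
structure Cycle where
  card : ℕ
  path : Fin card → ℝ → ℂ
  contDiff : ∀ a, ContDiff ℝ 1 (path a)
  closed : ∀ a, path a 0 = path a 1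

/-- The set of points on the curves of a cycle. -/
def Cycle.trace (c : Cycle) : Set ℂ := {x | ∃ a, ∃ u ∈ Set.Icc (0 : ℝ) 1, c.path a u = x}

/-- The winding number of a cycle about a point off its trace. -/
def Cycle.wind (c : Cycle) (p : ℂ) : ℂ :=
  (2 * Real.pi * Complex.I)⁻¹ * ∑ a, ∫ u in (0 : ℝ)..1, deriv (c.path a) u / (c.path a u - p)

/-- The integral `∫_{c₁ × ⋯ × c_N} ∏ dx_i F(x)` over a product of cycles. -/
def productIntegral {N : ℕ} (c : Fin N → Cycle) (F : (Fin N → ℂ) → ℂ) : ℂ :=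
  ∑ a : ((i : Fin N) → Fin (c i).card), ∫ u in Set.Icc (0 : Fin N → ℝ) 1,
    (∏ i, deriv ((c i).path (a i)) (u i)) * F fun i => (c i).path (a i) (u i)

/-- A contour `𝒞 = 𝒞₁ × ⋯ × 𝒞_N`, where `𝒞_i = ∑_{a ∈ ι} C i a` is a possibly infinite sum of
cycles; a single closed curve in each variable is the case of a one-element `ι`. -/
abbrev Contour (N : ℕ) (ι : Type) : Type := Fin N → ι → Cycle

/-- The set of points on the contour of the variable `x_i`. -/
def Contour.trace {N : ℕ} {ι : Type} (C : Contour N ι) (i : Fin N) : Set ℂ :=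
  ⋃ a, (C i a).trace

/-- The integral of `F` over the product of the components with multi-index `a`. -/
def Contour.part {N : ℕ} {ι : Type} (C : Contour N ι) (F : (Fin N → ℂ) → ℂ) (a : Fin N → ι) : ℂ :=
  productIntegral (fun i => C i (a i)) F

/-- The integral `∮_𝒞 ∏ dx_i F(x)`. -/
def Contour.integral {N : ℕ} {ι : Type} (C : Contour N ι) (F : (Fin N → ℂ) → ℂ) : ℂ :=
  ∑' a : Fin N → ι, C.part F a

/-- `p` is a (non-removable) singularity of `f`. -/
def IsSing (f : ℂ → ℂ) (p : ℂ) : Prop :=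
  ¬ ∃ g : ℂ → ℂ, AnalyticAt ℂ g p ∧ f =ᶠ[𝓝[≠] p] g

/-! ### The matrix model -/

/-- The `q`-Pochhammer symbol `(z; q)_∞ = ∏_{k ≥ 0} (1 - q^k z)`. -/
def qPoch (z q : ℂ) : ℂ := ∏' k : ℕ, (1 - q ^ k * z)

/-- `Δ_{q,t}(x) = ∏_{i ≠ j} (x_i / x_j; q)_∞ / (t x_i / x_j; q)_∞`. -/
def vandermonde (q t : ℂ) {N : ℕ} (x : Fin N → ℂ) : ℂ :=
  ∏ i, ∏ j ∈ Finset.univ.erase i, qPoch (x i / x j) q / qPoch (t * (x i / x j)) q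

/-- `lg` is a branch of the logarithm on `ℂ \ {0}` for which `lg (q x) = lg x + lq`, where `lq` is
the chosen value of `log q` (for `0 < q < 1` the principal branch is one). No continuity is
required: a branch cut counts as a singularity wherever the integrand jumps across it. -/
structure IsLogBranch (q lq : ℂ) (lg : ℂ → ℂ) : Prop where
  exp_lg : ∀ x, x ≠ 0 → Complex.exp (lg x) = x
  lg_mul : ∀ x, x ≠ 0 → lg (q * x) = lg x + lq

/-- `x^{(log t / log q) (N - 1)} w(x)`. -/
def oneBody (N : ℕ) (lq lt : ℂ) (lg w : ℂ → ℂ) (x : ℂ) : ℂ :=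
  Complex.exp (lt / lq * ((N : ℂ) - 1) * lg x) * w x

/-- The integrand `Δ_{q,t}(x) ∏_i x_i^{(log t / log q) (N - 1)} w(x_i)`. -/
def integrand (q t lq lt : ℂ) (lg w : ℂ → ℂ) {N : ℕ} (x : Fin N → ℂ) : ℂ :=
  vandermonde q t x * ∏ i, oneBody N lq lt lg w (x i)

/-- The kernel `exp (∑_{k ≥ 1} (1 - t^k) / (1 - q^k) (p_k / k) ∑_i x_i^k)`: its coefficient at
`∏ p_k^{μ_k}` is the product of `c_k^{μ_k} / μ_k!`, where `c_k` is the coefficient of `p_k` in the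
exponent. -/
def kernel (q t : ℂ) {N : ℕ} (x : Fin N → ℂ) : Lam := fun μ =>
  μ.prod fun k e =>
    ((1 - t ^ (k : ℕ)) / (1 - q ^ (k : ℕ)) / (k : ℂ) * ∑ i, x i ^ (k : ℕ)) ^ e
      / (Nat.factorial e : ℂ)

/-- The generating function `Z^w(p)`: the normalized expectation value of the kernel, taken
coefficientwise. -/
def genFun (q t lq lt : ℂ) (lg w : ℂ → ℂ) {N : ℕ} {ι : Type} (C : Contour N ι) : Lam := fun μ =>
  C.integral (fun x => MvPowerSeries.coeff μ (kernel q t x) * integrand q t lq lt lg w x)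
    / C.integral (integrand q t lq lt lg w)

/-- The rational function `∏_{j ≠ i} (t⁻¹ x_i - x_j) / (x_i - x_j)`. -/
def wardFactor (t : ℂ) {N : ℕ} (i : Fin N) (x : Fin N → ℂ) : ℂ :=
  ∏ j ∈ Finset.univ.erase i, (t⁻¹ * x i - x j) / (x i - x j)

/-- The contours the model is considered on.
* `ne_zero`, `analytic`, `avoids`: the contour avoids `0` and the poles of the integrand.
* `dilation`: if two neighbours `p` and `p / q` in a string of `q`-shifted points are both
  singularities of the integrand in one variable (the other variables being held on the contour),
  then the contour encloses one exactly as it encloses the other. For a contour with several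
  components this says that the dilation by `q` permutes the components up to homology in the
  complement of those points and of `0`; for a contour with a single component, it says that
  its winding numbers about `p` and `p / q` are equal.
* `summable`, `summable_ward`: the integrals over the (possibly infinitely many) components
  converge; for finitely many components these conditions are void. -/
structure IsAdmissible (q t lq lt : ℂ) (lg w : ℂ → ℂ) (m₀ : ℤ) {N : ℕ} {ι : Type}
    (C : Contour N ι) : Prop where
  ne_zero : ∀ i, ∀ x ∈ C.trace i, x ≠ 0
  analytic : ∀ i, ∀ x ∈ C.trace i, AnalyticAt ℂ (oneBody N lq lt lg w) x
  avoids : ∀ i j, i ≠ j → ∀ x ∈ C.trace i, ∀ y ∈ C.trace j, ∀ n : ℕ, t * q ^ n * x ≠ y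
  dilation : ∀ i, ∃ σ : Equiv.Perm ι, ∀ a,
    (C i (σ a)).wind 0 = (C i a).wind 0 ∧
    ∀ x : Fin N → ℂ, (∀ j, j ≠ i → x j ∈ C.trace j) → ∀ p : ℂ,
      IsSing (fun y => integrand q t lq lt lg w (Function.update x i y)) p →
      IsSing (fun y => integrand q t lq lt lg w (Function.update x i y)) (p / q) →
      (C i (σ a)).wind p = (C i a).wind (p / q)
  summable : ∀ f : MvPolynomial (Fin N) ℂ,
    Summable (C.part fun x => MvPolynomial.eval x f * integrand q t lq lt lg w x)
  summable_ward : ∀ (i : Fin N) (f : MvPolynomial (Fin N) ℂ),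
    Summable (C.part fun x => x i ^ m₀ * MvPolynomial.eval x f * wardFactor t i x
      * integrand q t lq lt lg w x)

end QTMatrixModel

end

/-! Write Φ for the integrand and K for the kernel, and fix all variables but `x_i`. The
q-difference equation of `w`, the power `x^{(log t / log q)(N-1)}` and the relation `(z;q)_∞ =
(1-z)(qz;q)_∞` show that dilating `x_i` by `q` turns `x_i^n M⁻(x_i) K ∏_{j≠i} (t⁻¹x_i-x_j)/(x_i-x_j)
Φ` into `(q x_i)^n M⁺(q x_i) K' ∏_{j≠i} (t x_i-x_j)/(x_i-x_j) Φ`, where K' has `q x_i` in place of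
`x_i` while Φ stands at the undilated point (`eventually_wardTerm_dilate`). The poles at `x_i = x_j`
are cancelled by zeros of the Vandermonde factor. So a singularity `p ≠ 0` of the first function is
a singularity of Φ at `p` and, by the dilation relation, also at `p/q`. The q-shift condition then
provides the equality of winding numbers needed by the homology form of Cauchy's theorem to replace
`𝒞_{i,σ(a)}` by the dilation of `𝒞_{i,a}` (`integral_wardTerm`). Fubini, absolute convergence and
reindexing by σ give one Ward identity per variable (`IsAdmissible.summable_wardRight`).

Summed over `i`, these identities say that the mode `Û_n` annihilates the generating function.
Indeed K is the exponential of a linear form in the `p_k`, so every `∂/∂p_k` acts on it by a scalar,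
and the exponentials of derivations become `∏ (1-τ y_i/z)/(1-y_i/z)` with `(τ, y) = (t, x)` or
`(t⁻¹, q x)`. Partial fractions turn `1 - τ^{-N} ∏ (1-τ y_i/z)/(1-y_i/z)` into a sum of simple poles
whose weights are the Ward factors (`sum_wardFactor_mul_pow`), and the exponential of
multiplications, evaluated at the pole `z = q x_i`, moves `x_i` to `q x_i` in K. This works for `n ≥
0`; for `n = -1` each of the two polynomials leaves one extra term, and these cancel if `M⁺(0) =
M⁻(0)` (`coeff_virasoroMode_kernel_eq`). Operators may be moved under the integral because every
coefficient of `Û_n f` involves only finitely many coefficients of `f` (`IsFinitary`).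

Hence `Û_n` annihilates the generating function for `n ≥ m₀`. Since `exp(-γ(z)) - 1`, with `γ(z) = ∑
(1-t^{-k})(t/q)^k z^k p_k/k`, has no constant term in `z`, the coefficient of `z^m` in its product
with the current involves only `Û_{j-m}` with `j ≥ 1`, so `m ≤ 1 - m₀` suffices. The closed form of
the constraints is algebra: `exp(-γ)` cancels the factor `exp γ` in the part with `M⁺`, completes
the derivations in the part with `M⁻` to the current `x⁻`, and what remains are rescalings of `z`
(`resummedMode_eq_constraintOp`). -/

open scoped Topology BigOperators

noncomputable section

namespace QTMatrixModel
section

/-! ### Exponential generating series -/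

section ExpSeries

variable {R : Type*} [Ring R] [Algebra ℂ R]

/-- The power series `∑_{k ≥ 1} (b_k / k) z^k`. -/
def logSeries (b : ℕ+ → R) : PowerSeries R :=
  PowerSeries.mk fun k : ℕ => if hk : 0 < k then ((k : ℂ)⁻¹) • b ⟨k, hk⟩ else 0

/-- The power series `exp (∑_{k ≥ 1} (b_k / k) z^k)`. -/
def expSeries (b : ℕ+ → R) : PowerSeries R :=
  PowerSeries.mk fun n => ∑ j ∈ Finset.range (n + 1),
    ((Nat.factorial j : ℂ)⁻¹) • PowerSeries.coeff n (logSeries b ^ j)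

/-- The coefficient of `z^n` in `exp (∑_{k ≥ 1} (b_k / k) z^k)`, for an integer `n`. -/
def hCoeff (b : ℕ+ → R) (n : ℤ) : R :=
  if n < 0 then 0 else PowerSeries.coeff n.toNat (expSeries b)

theorem coeff_complex_smul (r : ℂ) (F : PowerSeries R) (n : ℕ) :
    PowerSeries.coeff n (r • F) = r • PowerSeries.coeff n F :=
  (PowerSeries.coeff n).map_smul_of_tower r F

theorem hCoeff_of_neg (b : ℕ+ → R) {n : ℤ} (hn : n < 0) : hCoeff b n = 0 := if_pos hn

theorem hCoeff_natCast (b : ℕ+ → R) (n : ℕ) :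
    hCoeff b n = PowerSeries.coeff n (expSeries b) := by
  simp [hCoeff]

/-- `hMode` is the case `R = Op`. The general ring allows the same coefficients to be taken in `Lam`
(multiplications) and in ℂ (eigenvalues). -/
theorem hMode_eq_hCoeff (a : ℕ+ → Op) (n : ℤ) : hMode a n = hCoeff a n := by
  simp only [hMode, hCoeff, expSeries, PowerSeries.coeff_mk]
  rfl

theorem coeff_logSeries_pow_smul (r : ℂ) (b : ℕ+ → R) (j : ℕ) : ∀ n : ℕ,
    PowerSeries.coeff n (logSeries (fun k => r ^ (k : ℕ) • b k) ^ j)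
      = r ^ n • PowerSeries.coeff n (logSeries b ^ j) := by
  induction j with
  | zero =>
    intro n
    simp only [pow_zero, PowerSeries.coeff_one]
    split_ifs with h <;> simp [h]
  | succ j ih =>
    intro n
    rw [pow_succ, pow_succ, PowerSeries.coeff_mul, PowerSeries.coeff_mul, Finset.smul_sum]
    refine Finset.sum_congr rfl fun x hx => ?_
    rw [ih, ← Finset.HasAntidiagonal.mem_antidiagonal.1 hx, pow_add, mul_smul, smul_mul_assoc]
    congr 1
    rw [← mul_smul_comm]
    congr 1
    simp only [logSeries, PowerSeries.coeff_mk]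
    split_ifs
    · exact smul_comm _ _ _
    · rw [smul_zero]

/-- The substitution `z ↦ r z`. -/
theorem hCoeff_pow_smul (r : ℂ) (b : ℕ+ → R) (n : ℤ) :
    hCoeff (fun k => r ^ (k : ℕ) • b k) n = r ^ n • hCoeff b n := by
  rcases lt_or_ge n 0 with hn | hn
  · rw [hCoeff_of_neg _ hn, hCoeff_of_neg _ hn, smul_zero]
  · lift n to ℕ using hn
    simp only [hCoeff_natCast, expSeries, PowerSeries.coeff_mk, coeff_logSeries_pow_smul,
      zpow_natCast, Finset.smul_sum]
    exact Finset.sum_congr rfl fun j _ => smul_comm _ _ _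

theorem map_logSeries {S : Type*} [Ring S] [Algebra ℂ S] (φ : R →ₐ[ℂ] S) (b : ℕ+ → R) :
    PowerSeries.map (φ : R →+* S) (logSeries b) = logSeries fun k => φ (b k) := by
  ext n
  simp only [logSeries, PowerSeries.coeff_map, PowerSeries.coeff_mk]
  split_ifs <;> simp

theorem hCoeff_map {S : Type*} [Ring S] [Algebra ℂ S] (φ : R →ₐ[ℂ] S) (b : ℕ+ → R) (n : ℤ) :
    hCoeff (fun k => φ (b k)) n = φ (hCoeff b n) := by
  unfold hCoeff
  split_ifs
  · simp
  · simp only [expSeries, PowerSeries.coeff_mk, map_sum, map_smul, ← map_logSeries, ← map_pow,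
      PowerSeries.coeff_map]
    rfl

/-- The exponent has no constant term, so its `j`-th power starts in degree `j`; the exponential may
therefore be truncated at any order beyond the degree considered. -/
theorem coeff_logSeries_pow_of_lt (b : ℕ+ → R) {n j : ℕ} (h : n < j) :
    PowerSeries.coeff n (logSeries b ^ j) = 0 := by
  induction j generalizing n with
  | zero => omega
  | succ j ih =>
    rw [pow_succ, PowerSeries.coeff_mul]
    refine Finset.sum_eq_zero fun x hx => ?_
    have := Finset.HasAntidiagonal.mem_antidiagonal.1 hx
    rcases Nat.eq_zero_or_pos x.2 with h0 | h0
    · rw [h0]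
      simp [logSeries]
    · rw [ih (by omega), zero_mul]

theorem coeff_expSeries (b : ℕ+ → R) {n J : ℕ} (h : n < J) :
    PowerSeries.coeff n (expSeries b) = ∑ j ∈ Finset.range J,
      ((Nat.factorial j : ℂ)⁻¹) • PowerSeries.coeff n (logSeries b ^ j) := by
  rw [expSeries, PowerSeries.coeff_mk]
  refine Finset.sum_subset (Finset.range_mono h) fun j _ hj => ?_
  rw [coeff_logSeries_pow_of_lt b (by simpa using hj), smul_zero]

theorem coeff_zero_expSeries (b : ℕ+ → R) : PowerSeries.coeff 0 (expSeries b) = 1 := by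
  simp [coeff_expSeries b zero_lt_one]

theorem hCoeff_zero (b : ℕ+ → R) : hCoeff b 0 = 1 := by
  rw [← Nat.cast_zero, hCoeff_natCast, coeff_zero_expSeries]

end ExpSeries

/-! ### Exponentials over a commutative ring: functional equations from differential equations -/

section CommExpSeries

variable {R : Type*} [CommRing R] [Algebra ℂ R]

/-- Derivations act on `exp B` by the chain rule. -/
theorem derivation_sum_pow (D : Derivation ℂ (PowerSeries R) (PowerSeries R))
    (B : PowerSeries R) (J : ℕ) :
    D (∑ j ∈ Finset.range (J + 1), ((Nat.factorial j : ℂ)⁻¹) • B ^ j)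
      = (∑ j ∈ Finset.range J, ((Nat.factorial j : ℂ)⁻¹) • B ^ j) * D B := by
  -- The term of order zero is killed, and `(j+1)/(j+1)! = 1/j!` shifts the others down by one; this
  -- is why `J + 1` terms become `J`.
  rw [map_sum, Finset.sum_range_succ', Finset.sum_mul, pow_zero, D.map_smul,
    D.map_one_eq_zero, smul_zero, add_zero]
  refine Finset.sum_congr rfl fun j _ => ?_
  rw [D.map_smul, Derivation.leibniz_pow, Nat.add_sub_cancel, smul_mul_assoc, smul_eq_mul,
    ← Nat.cast_smul_eq_nsmul ℂ, smul_smul, Nat.factorial_succ]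
  congr 1
  have := Nat.cast_ne_zero (R := ℂ).2 (Nat.factorial_ne_zero j)
  push_cast
  field_simp

theorem coeff_expSeries_eq (b : ℕ+ → R) {n J : ℕ} (h : n < J) :
    PowerSeries.coeff n (expSeries b) = PowerSeries.coeff n
      (∑ j ∈ Finset.range J, ((Nat.factorial j : ℂ)⁻¹) • logSeries b ^ j) := by
  rw [coeff_expSeries b h, map_sum]
  rfl

/-- In degree `n` the derivative sees the coefficient of degree `n + 1`, for which `n + 2` terms of
the exponential suffice; differentiation leaves `n + 1` of them, still exact up to degree `n`. -/
theorem derivative_expSeries (b : ℕ+ → R) :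
    PowerSeries.derivative R (expSeries b)
      = expSeries b * PowerSeries.derivative R (logSeries b) := by
  ext n
  have key := congrArg (PowerSeries.coeff n) (derivation_sum_pow
    ((PowerSeries.derivative R).restrictScalars ℂ) (logSeries b) (n + 1))
  simp only [Derivation.restrictScalars_apply] at key
  rw [PowerSeries.coeff_derivative, coeff_expSeries_eq b (Nat.lt_succ_self (n + 1)),
    ← PowerSeries.coeff_derivative, key, PowerSeries.coeff_mul, PowerSeries.coeff_mul]
  refine Finset.sum_congr rfl fun x hx => ?_
  have := Finset.HasAntidiagonal.mem_antidiagonal.1 hx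
  rw [coeff_expSeries_eq b (show x.1 < n + 1 by omega)]

/-- The recursion for the coefficients can be solved because `n + 1` is invertible in a ℂ-algebra.
The identities for exponentials below follow from this uniqueness. -/
theorem eq_of_derivative_eq_mul {F G D : PowerSeries R}
    (hF : PowerSeries.derivative R F = F * D) (hG : PowerSeries.derivative R G = G * D)
    (h0 : PowerSeries.coeff 0 F = PowerSeries.coeff 0 G) : F = G := by
  ext n
  induction n using Nat.strong_induction_on with
  | _ n ih =>
    cases n with
    | zero => exact h0
    | succ n =>
      have h1 := congrArg (PowerSeries.coeff n) hF
      have h2 := congrArg (PowerSeries.coeff n) hG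
      rw [PowerSeries.coeff_derivative, PowerSeries.coeff_mul] at h1 h2
      have h3 : PowerSeries.coeff (n + 1) F * ((n : R) + 1)
          = PowerSeries.coeff (n + 1) G * ((n : R) + 1) := by
        rw [h1, h2]
        refine Finset.sum_congr rfl fun x hx => ?_
        have := Finset.HasAntidiagonal.mem_antidiagonal.1 hx
        rw [ih x.1 (by omega)]
      have hu : IsUnit ((n : R) + 1) := by
        have : ((n : R) + 1) = algebraMap ℂ R ((n : ℂ) + 1) := by simp
        rw [this]
        exact (IsUnit.mk0 _ (Nat.cast_add_one_ne_zero n)).map _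
      exact hu.mul_right_cancel h3

theorem logSeries_add (b c : ℕ+ → R) : logSeries (b + c) = logSeries b + logSeries c := by
  ext n
  simp only [logSeries, map_add, PowerSeries.coeff_mk]
  split_ifs
  · exact smul_add _ _ _
  · rw [add_zero]

theorem expSeries_add (b c : ℕ+ → R) : expSeries (b + c) = expSeries b * expSeries c := by
  refine eq_of_derivative_eq_mul (derivative_expSeries _) ?_ ?_
  · rw [Derivation.leibniz, derivative_expSeries, derivative_expSeries, logSeries_add, map_add,
      smul_eq_mul, smul_eq_mul]
    ring
  · simp [PowerSeries.coeff_mul, coeff_zero_expSeries]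

theorem expSeries_zero : expSeries (0 : ℕ+ → R) = 1 := by
  refine eq_of_derivative_eq_mul (derivative_expSeries _) ?_ ?_
  · have : logSeries (0 : ℕ+ → R) = 0 := by
      ext n
      simp only [logSeries, PowerSeries.coeff_mk, map_zero]
      split_ifs
      · exact smul_zero _
      · rfl
    rw [this, Derivation.map_one_eq_zero, map_zero, mul_zero]
  · simp [coeff_zero_expSeries]

theorem expSeries_sum {ι : Type*} (s : Finset ι) (b : ι → ℕ+ → R) :
    expSeries (∑ i ∈ s, b i) = ∏ i ∈ s, expSeries (b i) := by
  classical
  induction s using Finset.induction_on with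
  | empty => simpa using expSeries_zero
  | insert i s hi ih => rw [Finset.sum_insert hi, Finset.prod_insert hi, expSeries_add, ih]

/-- The exponent is `-log (1 - y z)`. The geometric series satisfies the same differential equation,
each of the `n + 1` products in degree `n` being `y^(n+1)`. -/
theorem expSeries_pow (y : R) :
    expSeries (fun k : ℕ+ => y ^ (k : ℕ)) = PowerSeries.mk fun n => y ^ n := by
  refine eq_of_derivative_eq_mul (derivative_expSeries _) ?_ ?_
  · ext n
    rw [PowerSeries.coeff_derivative, PowerSeries.coeff_mul]
    have : ∀ x ∈ Finset.HasAntidiagonal.antidiagonal n, PowerSeries.coeff x.1 (PowerSeries.mk fun n => y ^ n)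
        * PowerSeries.coeff x.2 (PowerSeries.derivative R
          (logSeries fun k : ℕ+ => y ^ (k : ℕ))) = y ^ (n + 1) := by
      intro x hx
      have hc : (((x.2 + 1 : ℕ) : ℂ)⁻¹) • ((x.2 : R) + 1) = 1 := by
        have : ((x.2 : R) + 1) = algebraMap ℂ R ((x.2 + 1 : ℕ) : ℂ) := by simp
        rw [this, Algebra.smul_def, ← map_mul, inv_mul_cancel₀ (Nat.cast_ne_zero.2 x.2.succ_ne_zero), map_one]
      simp only [PowerSeries.coeff_mk, PowerSeries.coeff_derivative, logSeries,
        Nat.succ_pos, dif_pos, PNat.mk_coe]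
      rw [smul_mul_assoc, ← mul_smul_comm, hc, mul_one, ← pow_add,
        ← Finset.HasAntidiagonal.mem_antidiagonal.1 hx, add_assoc]
    rw [Finset.sum_congr rfl this]
    simp [mul_comm]
  · simp [coeff_zero_expSeries]

theorem one_sub_mul_expSeries_pow (y : R) :
    (1 - PowerSeries.C y * PowerSeries.X) * expSeries (fun k : ℕ+ => y ^ (k : ℕ)) = 1 := by
  rw [expSeries_pow]
  ext n
  rw [sub_mul, one_mul, mul_assoc, map_sub, PowerSeries.coeff_C_mul]
  cases n with
  | zero => simp
  | succ n => simp [pow_succ']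

theorem sum_hCoeff_neg_mul (b : ℕ+ → R) (s : ℕ) :
    ∑ x ∈ Finset.HasAntidiagonal.antidiagonal s, hCoeff (-b) (x.1 : ℤ) * hCoeff b (x.2 : ℤ)
      = if s = 0 then 1 else 0 := by
  simp only [hCoeff_natCast]
  rw [← PowerSeries.coeff_mul, ← expSeries_add, neg_add_cancel, expSeries_zero,
    PowerSeries.coeff_one]

end CommExpSeries

end

section

/-! ### Operators of multiplication and normally ordered products -/

theorem op_neg_smul (c : ℂ) (T : Op) : (-c) • T = -(c • T) := neg_smul c T

theorem op_add_smul_eq_sub (c : ℂ) (A B B' : Op) (h : B + B' = 0) : A + c • B = A - c • B' := by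
  rw [eq_neg_of_add_eq_zero_left h]
  module

/-- `h_n` evaluated at `a_k = c_k p_k`. -/
def hp (c : ℕ+ → ℂ) (n : ℤ) : Lam := hCoeff (fun k => c k • (MvPowerSeries.X k : Lam)) n

/-- Multiplication operators form the image of the commutative ring `Lam`, so the identities for
exponentials over commutative rings apply to them. -/
theorem hMode_pMul (c : ℕ+ → ℂ) (n : ℤ) :
    hMode (fun k => c k • pMul k) n = Algebra.lmul ℂ Lam (hp c n) := by
  rw [hMode_eq_hCoeff, hp, ← hCoeff_map]
  congr 1
  funext k
  rw [map_smul]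
  rfl

theorem hMode_pMul_apply (c : ℕ+ → ℂ) (n : ℤ) (f : Lam) :
    hMode (fun k => c k • pMul k) n f = hp c n * f := by
  rw [hMode_pMul]
  rfl

theorem hp_zero (c : ℕ+ → ℂ) : hp c 0 = 1 := hCoeff_zero _

theorem hp_of_neg (c : ℕ+ → ℂ) {n : ℤ} (hn : n < 0) : hp c n = 0 := hCoeff_of_neg _ hn

theorem coeff_hp_mul_eq_zero (c : ℕ+ → ℂ) {n : ℤ} (f : Lam) (μ : ℕ+ →₀ ℕ) (h : (wt μ : ℤ) < n) :
    MvPowerSeries.coeff μ (hp c n * f) = 0 := by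
  lift n to ℕ using by omega
  rw [← hMode_pMul_apply]
  exact coeff_hMode_eq_zero c n f μ (by omega)

theorem sum_hp_neg_mul (c : ℕ+ → ℂ) (s : ℕ) :
    ∑ x ∈ Finset.HasAntidiagonal.antidiagonal s, hp (fun k => -c k) (x.1 : ℤ) * hp c (x.2 : ℤ)
      = if s = 0 then 1 else 0 := by
  rw [← sum_hCoeff_neg_mul (fun k => c k • (MvPowerSeries.X k : Lam))]
  refine Finset.sum_congr rfl fun x _ => ?_
  unfold hp
  congr 2
  funext k
  exact neg_smul _ _

theorem coeff_gradedSum (T : ℕ → Op) (f : Lam) (μ : ℕ+ →₀ ℕ) :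
    MvPowerSeries.coeff μ (gradedSum T f)
      = ∑ a ∈ Finset.range (wt μ + 1), MvPowerSeries.coeff μ (T a f) := by
  change gradedSum T f μ = _
  unfold gradedSum
  exact LinearMap.sum_apply _ _ _

theorem coeff_vertexMode (α β : ℕ+ → ℂ) (n : ℤ) (f : Lam) (μ : ℕ+ →₀ ℕ) :
    MvPowerSeries.coeff μ (vertexMode α β n f)
      = ∑ a ∈ Finset.range (wt μ + 1), MvPowerSeries.coeff μ
          (hp α a * hMode (fun k => β k • ((k : ℂ) • pDer k)) (a + n) f) := by
  simp only [vertexMode, coeff_gradedSum, Module.End.mul_apply, hMode_pMul_apply]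

theorem coeff_vertexMode_of_lt (α β : ℕ+ → ℂ) (n : ℤ) (f : Lam) (μ : ℕ+ →₀ ℕ) {W : ℕ}
    (hW : wt μ < W) : MvPowerSeries.coeff μ (vertexMode α β n f)
      = ∑ a ∈ Finset.range W, MvPowerSeries.coeff μ
          (hp α a * hMode (fun k => β k • ((k : ℂ) • pDer k)) (a + n) f) := by
  rw [coeff_vertexMode]
  refine Finset.sum_subset (Finset.range_mono hW) fun a _ ha => ?_
  exact coeff_hp_mul_eq_zero _ _ _ (by simp at ha; omega)

theorem hp_scale (r : ℂ) (α : ℕ+ → ℂ) (a : ℤ) :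
    hp (fun k => α k * r ^ (k : ℤ)) a = r ^ a • hp α a := by
  rw [hp, hp, ← hCoeff_pow_smul]
  congr 1
  funext k
  rw [smul_smul, mul_comm, zpow_natCast]

theorem hMode_pDer_scale (r : ℂ) (β : ℕ+ → ℂ) (n : ℤ) :
    hMode (fun k => (β k * r ^ (-(k : ℤ))) • ((k : ℂ) • pDer k)) n
      = r ^ (-n) • hMode (fun k => β k • ((k : ℂ) • pDer k)) n := by
  rw [hMode_eq_hCoeff, hMode_eq_hCoeff, zpow_neg, ← inv_zpow, ← hCoeff_pow_smul]
  congr 1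
  funext k
  rw [smul_smul (r⁻¹ ^ (k : ℕ)), mul_comm, zpow_neg, zpow_natCast, inv_pow]

/-- The substitution `z ↦ r z`: the multiplications contribute `r^a`, the derivations `r^{-(a+n)}`.
-/
theorem vertexMode_scale (r : ℂ) (hr : r ≠ 0) (α β : ℕ+ → ℂ) (n : ℤ) :
    vertexMode (fun k => α k * r ^ (k : ℤ)) (fun k => β k * r ^ (-(k : ℤ))) n
      = r ^ (-n) • vertexMode α β n := by
  ext f μ
  rw [LinearMap.smul_apply, map_smul, coeff_vertexMode, coeff_vertexMode, Finset.smul_sum]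
  refine Finset.sum_congr rfl fun a _ => ?_
  rw [hp_scale, hMode_pDer_scale, LinearMap.smul_apply, smul_mul_assoc, mul_smul_comm, smul_smul, map_smul]
  congr 1
  rw [← zpow_add₀ hr]
  congr 1
  ring

/-- The coefficient extraction `∑_j (h_j(-γ) - δ_{j,0}) T_{j - m}`. -/
def resum (γ : ℕ+ → ℂ) (m : ℤ) (T : ℤ → Op) : Op :=
  gradedSum fun j => (hMode (fun k => (-γ k) • pMul k) (j : ℤ) - kd j 0 • (1 : Op))
    * T ((j : ℤ) - m)

theorem coeff_resum (γ : ℕ+ → ℂ) (m : ℤ) (T : ℤ → Op) (f : Lam) (μ : ℕ+ →₀ ℕ) :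
    MvPowerSeries.coeff μ (resum γ m T f)
      = ∑ j ∈ Finset.range (wt μ + 1),
          MvPowerSeries.coeff μ (hp (fun k => -γ k) j * T (j - m) f)
        - MvPowerSeries.coeff μ (T (-m) f) := by
  simp only [resum, coeff_gradedSum, Module.End.mul_apply, LinearMap.sub_apply, hMode_pMul_apply,
    map_sub, Finset.sum_sub_distrib, LinearMap.smul_apply, Module.End.one_apply, map_smul]
  congr 1
  rw [Finset.sum_eq_single 0]
  · simp [kd]
  · intro j _ hj
    simp [kd, hj]
  · simp

theorem resum_add (γ : ℕ+ → ℂ) (m : ℤ) (S T : ℤ → Op) :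
    resum γ m (fun n => S n + T n) = resum γ m S + resum γ m T := by
  ext f μ
  simp only [coeff_resum, LinearMap.add_apply, map_add, mul_add, Finset.sum_add_distrib]
  ring

theorem resum_smul (γ : ℕ+ → ℂ) (m : ℤ) (c : ℂ) (T : ℤ → Op) :
    resum γ m (fun n => c • T n) = c • resum γ m T := by
  ext f μ
  simp only [coeff_resum, LinearMap.smul_apply, map_smul, mul_smul_comm, ← Finset.smul_sum,
    smul_sub]

theorem resum_sub (γ : ℕ+ → ℂ) (m : ℤ) (S T : ℤ → Op) :
    resum γ m (fun n => S n - T n) = resum γ m S - resum γ m T := by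
  ext f μ
  simp only [coeff_resum, LinearMap.sub_apply, map_sub, mul_sub, Finset.sum_sub_distrib]
  ring

theorem resum_sum {κ : Type*} (s : Finset κ) (γ : ℕ+ → ℂ) (m : ℤ) (T : κ → ℤ → Op) :
    resum γ m (fun n => ∑ l ∈ s, T l n) = ∑ l ∈ s, resum γ m (T l) := by
  classical
  induction s using Finset.induction_on with
  | empty =>
    ext f μ
    simp [coeff_resum]
  | insert l s hl ih => simp only [Finset.sum_insert hl, resum_add, ih]

/-- This and the next three evaluations of `resum` treat the four kinds of terms in the current:
`1`, `exp β`, `exp γ exp β` and `exp γ`, where `γ` stands for multiplications and `β` for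
derivations. For the constant term only `j = m - l` contributes. -/
theorem resum_one (γ : ℕ+ → ℂ) (m l : ℤ) :
    resum γ m (fun n => kd (l + n) 0 • (1 : Op))
      = hMode (fun k => (-γ k) • pMul k) (m - l) - kd l m • (1 : Op) := by
  ext f μ
  rw [coeff_resum, LinearMap.sub_apply, hMode_pMul_apply, map_sub]
  congr 1
  · simp only [LinearMap.smul_apply, Module.End.one_apply, mul_smul_comm, map_smul]
    rcases lt_or_ge (m - l) 0 with h | h
    · rw [hp_of_neg _ h, zero_mul, map_zero]
      refine Finset.sum_eq_zero fun j _ => ?_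
      rw [kd, if_neg (by omega), zero_smul]
    · obtain ⟨s, hs⟩ := Int.eq_ofNat_of_zero_le h
      rw [hs]
      by_cases hw : s < wt μ + 1
      · rw [Finset.sum_eq_single s]
        · rw [kd, if_pos (by omega), one_smul]
        · intro j _ hj
          rw [kd, if_neg (by omega), zero_smul]
        · intro hn
          simp at hn
          omega
      · rw [coeff_hp_mul_eq_zero _ _ _ (by omega)]
        refine Finset.sum_eq_zero fun j hj => ?_
        simp at hj
        rw [kd, if_neg (by omega), zero_smul]
  · simp only [LinearMap.smul_apply, Module.End.one_apply, map_smul]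
    congr 1
    simp only [kd]
    congr 1
    simp only [eq_iff_iff]
    omega

/-- `exp(-γ) exp β` is already normally ordered, hence a vertex operator. -/
theorem resum_hMode_pDer (γ β : ℕ+ → ℂ) (m l : ℤ) :
    resum γ m (fun n => hMode (fun k => β k • ((k : ℂ) • pDer k)) (l + n))
      = vertexMode (fun k => -γ k) β (l - m)
        - hMode (fun k => β k • ((k : ℂ) • pDer k)) (l - m) := by
  ext f μ
  rw [coeff_resum, LinearMap.sub_apply, map_sub, coeff_vertexMode]
  congr 1
  refine Finset.sum_congr rfl fun j _ => ?_
  rw [show l + ((j : ℤ) - m) = j + (l - m) by ring]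

/-- If the terms with `j + a` large vanish, a square sum is a sum over antidiagonals. -/
theorem sum_range_range_eq_sum_antidiagonal {M : Type*} [AddCommMonoid M] (W : ℕ)
    (F : ℕ → ℕ → M) (hF : ∀ j a, W ≤ j + a → F j a = 0) :
    ∑ j ∈ Finset.range W, ∑ a ∈ Finset.range W, F j a
      = ∑ s ∈ Finset.range W, ∑ x ∈ Finset.HasAntidiagonal.antidiagonal s, F x.1 x.2 := by
  have h1 : ∀ j ∈ Finset.range W, ∑ a ∈ Finset.range W, F j a
      = ∑ a ∈ Finset.range (W - j), F j a := by
    intro j _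
    symm
    refine Finset.sum_subset (Finset.range_mono (by omega)) fun a _ ha => hF _ _ ?_
    simp at ha
    omega
  rw [Finset.sum_congr rfl h1, ← Finset.sum_range_diag_flip]
  refine Finset.sum_congr rfl fun s _ => ?_
  rw [Finset.Nat.sum_antidiagonal_eq_sum_range_succ_mk]

/-- The identity `exp(-γ) exp γ = 1` in the truncated form used below. As `g` depends only on `j +
a`, it factors out of each antidiagonal; terms with `j + a > wt μ` vanish since the two factors
raise the weight by at least `j + a`. -/
theorem sum_coeff_hp_neg_mul (γ : ℕ+ → ℂ) (μ : ℕ+ →₀ ℕ) (g : ℕ → Lam) :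
    ∑ j ∈ Finset.range (wt μ + 1), ∑ a ∈ Finset.range (wt μ + 1),
      MvPowerSeries.coeff μ (hp (fun k => -γ k) j * (hp γ a * g (j + a)))
      = MvPowerSeries.coeff μ (g 0) := by
  have hz : ∀ j a : ℕ, wt μ + 1 ≤ j + a →
      MvPowerSeries.coeff μ (hp (fun k => -γ k) j * (hp γ a * g (j + a))) = 0 := by
    intro j a hja
    rw [MvPowerSeries.coeff_mul]
    refine Finset.sum_eq_zero fun x hx => ?_
    have hx' : wt x.1 + wt x.2 = wt μ := by
      rw [← wt_add, Finset.HasAntidiagonal.mem_antidiagonal.1 hx]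
    by_cases h : wt x.1 < j
    · rw [← mul_one (hp (fun k => -γ k) j), coeff_hp_mul_eq_zero _ _ _ (by omega), zero_mul]
    · rw [coeff_hp_mul_eq_zero γ _ _ (by omega), mul_zero]
  rw [sum_range_range_eq_sum_antidiagonal _ _ hz, Finset.sum_eq_single 0]
  · simp [hp_zero]
  · intro s _ hs
    rw [← map_sum]
    have : ∀ x ∈ Finset.HasAntidiagonal.antidiagonal s,
        hp (fun k => -γ k) (x.1 : ℤ) * (hp γ (x.2 : ℤ) * g (x.1 + x.2))
          = (hp (fun k => -γ k) (x.1 : ℤ) * hp γ (x.2 : ℤ)) * g s := by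
      intro x hx
      rw [Finset.HasAntidiagonal.mem_antidiagonal.1 hx, mul_assoc]
    rw [Finset.sum_congr rfl this, ← Finset.sum_mul, sum_hp_neg_mul, if_neg hs, zero_mul, map_zero]
  · simp

/-- `exp(-γ) · exp γ exp β = exp β`. -/
theorem resum_vertexMode (γ β : ℕ+ → ℂ) (m l : ℤ) :
    resum γ m (fun n => vertexMode γ β (l + n))
      = hMode (fun k => β k • ((k : ℂ) • pDer k)) (l - m) - vertexMode γ β (l - m) := by
  ext f μ
  rw [coeff_resum, LinearMap.sub_apply, map_sub]
  congr 1
  have key := sum_coeff_hp_neg_mul γ μ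
    fun s => hMode (fun k => β k • ((k : ℂ) • pDer k)) ((s : ℤ) + (l - m)) f
  rw [Nat.cast_zero, zero_add] at key
  rw [← key]
  · refine Finset.sum_congr rfl fun j _ => ?_
    rw [MvPowerSeries.coeff_mul]
    simp only [MvPowerSeries.coeff_mul (φ := hp (fun k => -γ k) (j : ℤ))]
    rw [Finset.sum_comm]
    refine Finset.sum_congr rfl fun x hx => ?_
    have hx' : wt x.1 + wt x.2 = wt μ := by
      rw [← wt_add, Finset.HasAntidiagonal.mem_antidiagonal.1 hx]
    -- The cutoff of the vertex operator depends on the part `x.2` of `μ`; it is raised to the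
    -- common value `wt μ + 1` so that the sum over `a` no longer depends on the splitting.
    rw [coeff_vertexMode_of_lt _ _ _ _ _ (show wt x.2 < wt μ + 1 by omega), Finset.mul_sum]
    refine Finset.sum_congr rfl fun a _ => ?_
    congr 5
    push_cast
    ring

/-- `exp(-γ) exp γ = 1`, where the Kronecker delta in `g` selects the degree `j + a = m - l`. -/
theorem resum_hMode_pMul (γ : ℕ+ → ℂ) (m l : ℤ) :
    resum γ m (fun n => hMode (fun k => γ k • pMul k) (-(l + n)))
      = kd l m • (1 : Op) - hMode (fun k => γ k • pMul k) (m - l) := by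
  ext f μ
  rw [coeff_resum, LinearMap.sub_apply, map_sub]
  congr 1
  · simp only [hMode_pMul_apply, LinearMap.smul_apply, Module.End.one_apply, map_smul]
    have key := sum_coeff_hp_neg_mul γ μ fun s => kd (s + l) m • f
    rw [Nat.cast_zero, zero_add, map_smul] at key
    rw [← key]
    refine Finset.sum_congr rfl fun j hj => ?_
    simp only [mul_smul_comm, map_smul]
    rcases lt_or_ge (m - l - j) 0 with h | h
    · rw [hp_of_neg _ (show -(l + ((j : ℤ) - m)) < 0 by omega)]
      simp only [zero_mul, mul_zero, map_zero]
      symm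
      refine Finset.sum_eq_zero fun a _ => ?_
      rw [kd, if_neg (by push_cast; omega), zero_smul]
    · obtain ⟨s, hs⟩ := Int.eq_ofNat_of_zero_le h
      rw [show -(l + ((j : ℤ) - m)) = s by omega]
      by_cases hw : s < wt μ + 1
      · rw [Finset.sum_eq_single s]
        · rw [kd, if_pos (by push_cast; omega), one_smul]
        · intro a _ ha
          rw [kd, if_neg (by push_cast; omega), zero_smul]
        · intro hn
          simp at hn
          omega
      · rw [← mul_assoc, mul_comm (hp _ _), mul_assoc, coeff_hp_mul_eq_zero _ _ _ (by omega)]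
        symm
        refine Finset.sum_eq_zero fun a ha => ?_
        simp at ha
        rw [kd, if_neg (by push_cast; omega), zero_smul]
  · rw [show -(l + -m) = m - l by ring]

/-! ### Identification of the resummed modes with `constraintOp` and `recursionOp` -/

theorem resummedMode_eq_resum (q t Q : ℂ) (Mp Mm : Polynomial ℂ) (dp dm : ℕ) (m : ℤ) :
    resummedMode q t Q Mp Mm dp dm m
      = resum (fun k => (1 - t ^ (-(k : ℤ))) * (t / q) ^ (k : ℤ)) m
          (virasoroMode q t Q Mp Mm dp dm) := rfl

theorem hMode_pMul_scale (r : ℂ) (c : ℕ+ → ℂ) (n : ℤ) :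
    hMode (fun k => (c k * r ^ (k : ℤ)) • pMul k) n = r ^ n • hMode (fun k => c k • pMul k) n := by
  rw [hMode_eq_hCoeff, hMode_eq_hCoeff, ← hCoeff_pow_smul]
  congr 1
  funext k
  rw [smul_smul, mul_comm, zpow_natCast]

theorem smul_pPerp {q t : ℂ} (ht : ∀ k : ℕ, 1 ≤ k → t ^ k ≠ 1) (k : ℕ+) :
    (1 - t ^ (k : ℤ)) • pPerp q t k = (1 - q ^ (k : ℤ)) • ((k : ℂ) • pDer k) := by
  have : 1 - t ^ (k : ℕ) ≠ 0 := sub_ne_zero.2 (ht k k.pos).symm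
  rw [pPerp, smul_smul, smul_smul, zpow_natCast, zpow_natCast]
  congr 1
  field_simp

theorem resummedMode_eq_constraintOp {q t : ℂ} (Q : ℂ) (hq : q ≠ 0) (ht0 : t ≠ 0)
    (ht : ∀ k : ℕ, 1 ≤ k → t ^ k ≠ 1) (Mp Mm : Polynomial ℂ) (dp dm : ℕ) (m : ℤ) :
    resummedMode q t Q Mp Mm dp dm m = constraintOp q t Q Mp Mm dp dm m := by
  have htq : t / q ≠ 0 := div_ne_zero ht0 hq
  rw [resummedMode_eq_resum]
  unfold virasoroMode constraintOp
  simp only [resum_add, resum_smul, resum_sub, resum_sum, resum_one, resum_hMode_pDer,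
    resum_vertexMode, resum_hMode_pMul]
  congr 1
  · refine Finset.sum_congr rfl fun l _ => ?_
    congr 2
    · congr 1
      rw [← hMode_pMul_scale]
      simp only [neg_mul]
    · congr 2
      -- Here `r = q⁻¹`: `-(1 - t^{-k})(t/q)^k = (1 - t^k) q^{-k}` and `1 - q^k = -(1 - q^{-k})
      -- q^k`.
      · rw [xMinus, show q ^ ((l : ℤ) - m) = q⁻¹ ^ (-((l : ℤ) - m)) by rw [inv_zpow', neg_neg],
          ← vertexMode_scale _ (inv_ne_zero hq)]
        congr 1
        · funext k
          simp only [zpow_natCast, zpow_neg, div_pow, inv_pow]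
          have := pow_ne_zero k ht0
          field_simp
          ring
        · funext k
          simp only [zpow_natCast, zpow_neg, inv_pow]
          have := pow_ne_zero k hq
          field_simp
          ring
      · simp only [smul_pPerp ht]
  · congr 1
    refine Finset.sum_congr rfl fun l _ => ?_
    congr 1
    -- In the part with `M⁺` the current is `x⁺` at argument `(t/q) z`.
    have h2 := vertexMode_scale (t / q) htq (fun k : ℕ+ => 1 - t ^ (-(k : ℤ)))
      (fun k : ℕ+ => -(1 - q ^ (k : ℤ))) (l - m)
    have h3 := hMode_pDer_scale (t / q) (fun k : ℕ+ => -(1 - q ^ (k : ℤ))) (l - m)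
    simp only [neg_mul] at h2 h3
    rw [show -((l : ℤ) - m) = m - l by ring] at h2 h3
    have h4 : ∀ k : ℕ+, (-(1 - t ^ (k : ℤ))) • pPerp q t k
        = (-(1 - q ^ (k : ℤ))) • ((k : ℂ) • pDer k) := by
      intro k
      rw [op_neg_smul, smul_pPerp ht, op_neg_smul]
    simp only [h4]
    rw [hMode_pMul_scale, h2, h3, xPlus]
    module

/-- Both sums are reversed. At `m = dm`, with `dp ≤ dm`, no `h_n` of the derivations with `n > 0`
occurs, so these reduce to Kronecker deltas. -/
theorem constraintOp_eq_recursionOp (q t Q : ℂ) (Mp Mm : Polynomial ℂ) {dp dm : ℕ}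
    (h : dp ≤ dm) : constraintOp q t Q Mp Mm dp dm dm = recursionOp q t Q Mp Mm dp dm := by
  unfold constraintOp recursionOp
  rw [← op_add_smul_eq_sub]
  · congr 1
    rw [← Finset.sum_flip]
    refine Finset.sum_congr rfl fun l hl => ?_
    have hl' : l ≤ dm := by simpa [Nat.lt_succ_iff] using hl
    have h1 : (dm : ℤ) - ((dm - l : ℕ) : ℤ) = l := by omega
    have h2 : ((dm - l : ℕ) : ℤ) - dm = -l := by omega
    have h3 : kd ((dm - l : ℕ) : ℤ) dm = kd l 0 := by
      simp only [kd]
      congr 1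
      simp only [eq_iff_iff]
      omega
    have h4 : hMode (fun k => (1 - t ^ (k : ℤ)) • pPerp q t k) (-(l : ℤ)) = kd l 0 • 1 := by
      rw [hMode_eq_hCoeff]
      rcases Nat.eq_zero_or_pos l with rfl | hpos
      · simp [hCoeff_zero, kd]
      · rw [hCoeff_of_neg _ (by omega), kd, if_neg (by omega), zero_smul]
    rw [h1, h2, h3, h4]
    congr 1
    module
  · rw [← Finset.sum_flip, ← Finset.sum_add_distrib]
    refine Finset.sum_eq_zero fun l hl => ?_
    have hl' : l ≤ dp := by simpa [Nat.lt_succ_iff] using hl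
    have h1 : (dm : ℤ) - ((dp - l : ℕ) : ℤ) = dm - dp + l := by omega
    have h2 : ((dp - l : ℕ) : ℤ) - dm = dp - dm - l := by omega
    have h3 : kd ((dp - l : ℕ) : ℤ) dm = kd dp (dm + l) := by
      simp only [kd]
      congr 1
      simp only [eq_iff_iff]
      omega
    -- The index is nonpositive because `dp ≤ dm`.
    have h4 : hMode (fun k => (-(1 - t ^ (k : ℤ))) • pPerp q t k) ((dp : ℤ) - dm - l)
        = kd dp (dm + l) • 1 := by
      rw [hMode_eq_hCoeff]
      by_cases h0 : (dp : ℤ) - dm - l = 0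
      · rw [h0, hCoeff_zero, kd, if_pos (by omega), one_smul]
      · rw [hCoeff_of_neg _ (by omega), kd, if_neg (by omega), zero_smul]
    rw [h1, h2, h3, h4, hMode_pMul_scale]
    module

end

section

/-! ### Joint eigenvectors of the derivations -/

/-- A polynomial in the `a k` acts on a joint eigenvector through its value at the eigenvalues;
commutativity of the `a k` plays no role. -/
theorem hMode_apply_of_eigen {a : ℕ+ → Op} {b : ℕ+ → ℂ} {v : Lam} (h : ∀ k, a k v = b k • v)
    (n : ℤ) : hMode a n v = hCoeff b n • v := by
  have key : ∀ j m : ℕ, PowerSeries.coeff m (logSeries a ^ j) v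
      = PowerSeries.coeff m (logSeries b ^ j) • v := by
    intro j
    induction j with
    | zero =>
      intro m
      simp only [pow_zero, PowerSeries.coeff_one]
      split_ifs
      · rw [one_smul, Module.End.one_apply]
      · rw [zero_smul, LinearMap.zero_apply]
    | succ j ih =>
      intro m
      rw [pow_succ, pow_succ, PowerSeries.coeff_mul, PowerSeries.coeff_mul, LinearMap.sum_apply,
        Finset.sum_smul]
      refine Finset.sum_congr rfl fun x _ => ?_
      have : PowerSeries.coeff x.2 (logSeries a) v = PowerSeries.coeff x.2 (logSeries b) • v := by
        simp only [logSeries, PowerSeries.coeff_mk]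
        split_ifs
        · rw [LinearMap.smul_apply, smul_eq_mul, mul_smul]
          exact congrArg _ (h _)
        · rw [zero_smul, LinearMap.zero_apply]
      rw [Module.End.mul_apply, this, map_smul, ih, smul_smul, mul_comm]
  rw [hMode_eq_hCoeff]
  unfold hCoeff
  split_ifs
  · rw [zero_smul, LinearMap.zero_apply]
  · simp only [expSeries, PowerSeries.coeff_mk, LinearMap.sum_apply, LinearMap.smul_apply, key,
      Finset.sum_smul, smul_assoc]

/-- The power series `exp (∑_k c_k p_k)`. -/
def expKer (c : ℕ+ → ℂ) : Lam := fun μ => μ.prod fun k e => c k ^ e / (Nat.factorial e : ℂ)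

theorem coeff_expKer (c : ℕ+ → ℂ) (μ : ℕ+ →₀ ℕ) : MvPowerSeries.coeff μ (expKer c)
    = μ.prod fun k e => c k ^ e / (Nat.factorial e : ℂ) := rfl

theorem pDer_apply (k : ℕ+) (f : Lam) : pDer k f = MvPowerSeries.pderiv ℂ k f := rfl

theorem coeff_pDer (k : ℕ+) (f : Lam) (μ : ℕ+ →₀ ℕ) :
    MvPowerSeries.coeff μ (pDer k f)
      = MvPowerSeries.coeff (μ + Finsupp.single k 1) f * (μ k + 1) :=
  MvPowerSeries.coeff_pderiv f μ

theorem pDer_expKer (c : ℕ+ → ℂ) (k : ℕ+) : pDer k (expKer c) = c k • expKer c := by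
  classical
  ext μ
  rw [coeff_pDer, map_smul, coeff_expKer, coeff_expKer, smul_eq_mul]
  -- A finite set containing the supports of both exponents, so that the two products differ only in
  -- the factor at `k`.
  set s := insert k μ.support with hs
  have h1 : μ.support ⊆ s := Finset.subset_insert _ _
  have h2 : (μ + Finsupp.single k 1).support ⊆ s := by
    intro j hj
    rw [hs, Finset.mem_insert, Finsupp.mem_support_iff]
    by_contra! hcon
    rw [Finsupp.mem_support_iff, Finsupp.add_apply, hcon.2, Finsupp.single_apply,
      if_neg (Ne.symm hcon.1)] at hj
    exact hj rfl
  have hk : k ∈ s := Finset.mem_insert_self _ _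
  rw [Finsupp.prod_of_support_subset _ h1 _ (by simp),
    Finsupp.prod_of_support_subset _ h2 _ (by simp), ← Finset.mul_prod_erase _ _ hk,
    ← Finset.mul_prod_erase s _ hk]
  have h3 : ∀ j ∈ s.erase k, c j ^ (μ + Finsupp.single k 1 : ℕ+ →₀ ℕ) j
      / (Nat.factorial ((μ + Finsupp.single k 1 : ℕ+ →₀ ℕ) j) : ℂ)
      = c j ^ μ j / (Nat.factorial (μ j) : ℂ) := by
    intro j hj
    rw [Finsupp.add_apply, Finsupp.single_apply, if_neg (Finset.ne_of_mem_erase hj).symm, add_zero]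
  rw [Finset.prod_congr rfl h3, Finsupp.add_apply, Finsupp.single_eq_same, Nat.factorial_succ,
    pow_succ]
  have := Nat.cast_ne_zero (R := ℂ).2 (Nat.factorial_ne_zero (μ k))
  have h4 : (μ k : ℂ) + 1 ≠ 0 := Nat.cast_add_one_ne_zero _
  push_cast
  field_simp

theorem wt_single (k : ℕ+) : wt (Finsupp.single k 1) = k := by simp [wt]

theorem wt_zero : wt 0 = 0 := by simp [wt]

/-- Induction on the weight: a nonzero exponent is `ν + single k 1`, and `∂/∂p_k` expresses its
coefficient through that of `ν`. -/
theorem eq_expKer {c : ℕ+ → ℂ} {f : Lam} (h : ∀ k, pDer k f = c k • f)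
    (h0 : MvPowerSeries.coeff 0 f = 1) : f = expKer c := by
  ext μ
  induction hw : wt μ using Nat.strong_induction_on generalizing μ with
  | _ w ih =>
    by_cases hμ : μ = 0
    · rw [hμ, h0, coeff_expKer, Finsupp.prod_zero_index]
    · obtain ⟨k, hk⟩ := Finsupp.ne_iff.1 hμ
      have hle : Finsupp.single k 1 ≤ μ :=
        Finsupp.single_le_iff.2 (Nat.one_le_iff_ne_zero.2 hk)
      obtain ⟨ν, rfl⟩ := exists_add_of_le hle
      rw [add_comm] at hw ⊢
      rw [wt_add, wt_single] at hw
      have hν := ih (wt ν) (by have := k.pos; omega) ν rfl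
      have h1 := coeff_pDer k f ν
      have h2 := coeff_pDer k (expKer c) ν
      rw [h, map_smul] at h1
      rw [pDer_expKer, map_smul, ← hν, h1] at h2
      exact mul_right_cancel₀ (Nat.cast_add_one_ne_zero _) h2

/-- The coefficientwise extension of a derivation to power series. -/
def mapDerivation (D : Derivation ℂ Lam Lam) : Derivation ℂ (PowerSeries Lam) (PowerSeries Lam) :=
  Derivation.mk'
    { toFun := fun F => PowerSeries.mk fun n => D (PowerSeries.coeff n F)
      map_add' := fun F G => by
        ext1 n
        simp
      map_smul' := fun r F => by
        ext1 n
        rw [RingHom.id_apply, coeff_complex_smul, PowerSeries.coeff_mk, PowerSeries.coeff_mk,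
          coeff_complex_smul, D.map_smul] }
    fun F G => by
      ext1 n
      simp only [LinearMap.coe_mk, AddHom.coe_mk, PowerSeries.coeff_mk, PowerSeries.coeff_mul,
        map_sum, Derivation.leibniz, smul_eq_mul, map_add, Finset.sum_add_distrib]
      congr 1
      conv_lhs => rw [← Finset.HasAntidiagonal.map_swap_antidiagonal, Finset.sum_map]
      rfl

theorem coeff_mapDerivation (D : Derivation ℂ Lam Lam) (F : PowerSeries Lam) (n : ℕ) :
    PowerSeries.coeff n (mapDerivation D F) = D (PowerSeries.coeff n F) := by
  change PowerSeries.coeff n (PowerSeries.mk fun n => D (PowerSeries.coeff n F)) = _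
  rw [PowerSeries.coeff_mk]

/-- `∂/∂p_k` multiplies `exp (∑ γ_k p_k z^k / k)` by `(γ_k / k) z^k`; compare coefficients of `z^n`.
-/
theorem pDer_hp (γ : ℕ+ → ℂ) (k : ℕ+) (n : ℤ) :
    pDer k (hp γ n) = (γ k / k) • hp γ (n - (k : ℕ)) := by
  rcases lt_or_ge n 0 with hn | hn
  · rw [hp_of_neg _ hn, hp_of_neg _ (by omega), map_zero, smul_zero]
  lift n to ℕ using hn
  set b : ℕ+ → Lam := fun k => γ k • (MvPowerSeries.X k : Lam)
  have hlog : mapDerivation (MvPowerSeries.pderiv ℂ k) (logSeries b)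
      = (γ k / k) • PowerSeries.X ^ (k : ℕ) := by
    ext1 m
    rw [coeff_mapDerivation, logSeries, PowerSeries.coeff_mk]
    rw [coeff_complex_smul, PowerSeries.coeff_X_pow]
    have hb : ∀ j : ℕ+, j ≠ k → MvPowerSeries.pderiv ℂ k (b j) = 0 := by
      intro j hj
      rw [Derivation.map_smul, MvPowerSeries.pderiv_X_of_ne hj, smul_zero]
    split_ifs with hm hmk hmk
    · subst hmk
      rw [Derivation.map_smul, show b ⟨k, hm⟩ = γ k • (MvPowerSeries.X k : Lam) from rfl,
        Derivation.map_smul, MvPowerSeries.pderiv_X_self, smul_smul]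
      congr 1
      ring
    · have : (⟨m, hm⟩ : ℕ+) ≠ k := fun h => hmk (by rw [← h]; rfl)
      rw [Derivation.map_smul, smul_zero]
      exact (congrArg _ (hb _ this)).trans (smul_zero _)
    · exact absurd (hmk ▸ k.pos) hm
    · rw [map_zero, smul_zero]
  have key := congrArg (PowerSeries.coeff n) (derivation_sum_pow
    (mapDerivation (MvPowerSeries.pderiv ℂ k)) (logSeries b) n)
  rw [coeff_mapDerivation, ← coeff_expSeries_eq b n.lt_succ_self, hlog, mul_smul_comm] at key
  rw [pDer_apply, hp, hCoeff_natCast, key]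
  rw [coeff_complex_smul]
  congr 1
  rw [PowerSeries.coeff_mul_X_pow']
  split_ifs with hkn
  · rw [hp, ← Nat.cast_sub hkn, hCoeff_natCast, coeff_expSeries_eq b]
    have := k.pos
    omega
  · rw [hp_of_neg _ (by omega)]

theorem sum_coeff_hp_mul_of_lt (γ : ℕ+ → ℂ) (f : Lam) (μ : ℕ+ →₀ ℕ) {W : ℕ} (hW : wt μ < W) :
    ∑ a ∈ Finset.range W, MvPowerSeries.coeff μ (hp γ a * f)
      = ∑ a ∈ Finset.range (wt μ + 1), MvPowerSeries.coeff μ (hp γ a * f) := by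
  symm
  refine Finset.sum_subset (Finset.range_mono hW) fun a _ ha => ?_
  exact coeff_hp_mul_eq_zero _ _ _ (by simp at ha; omega)

/-- The generating function of the `h_n` is an exponential. -/
theorem sum_coeff_hp_mul_expKer (γ c : ℕ+ → ℂ) (μ : ℕ+ →₀ ℕ) :
    ∑ a ∈ Finset.range (wt μ + 1), MvPowerSeries.coeff μ (hp γ a * expKer c)
      = MvPowerSeries.coeff μ (expKer fun k => c k + γ k / k) := by
  -- The infinite sum `∑_a h_a · expKer c`, taken coefficientwise. It is identified with the
  -- exponential by its eigenvalue equations.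
  let f : Lam := fun μ =>
    ∑ a ∈ Finset.range (wt μ + 1), MvPowerSeries.coeff μ (hp γ a * expKer c)
  have hf : ∀ μ, MvPowerSeries.coeff μ f
      = ∑ a ∈ Finset.range (wt μ + 1), MvPowerSeries.coeff μ (hp γ a * expKer c) := fun _ => rfl
  rw [← hf, eq_expKer (f := f) (c := fun k => c k + γ k / k)]
  · intro k
    ext ν
    rw [coeff_pDer, hf, Finset.sum_mul, map_smul, smul_eq_mul, add_mul, wt_add, wt_single]
    have h1 : ∀ a : ℕ, MvPowerSeries.coeff (ν + Finsupp.single k 1) (hp γ a * expKer c) * (ν k + 1)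
        = c k * MvPowerSeries.coeff ν (hp γ a * expKer c)
          + γ k / k * MvPowerSeries.coeff ν (hp γ ((a : ℤ) - (k : ℕ)) * expKer c) := by
      intro a
      rw [← coeff_pDer, pDer_apply, Derivation.leibniz, ← pDer_apply, ← pDer_apply, pDer_hp,
        pDer_expKer, map_add, smul_eq_mul, smul_eq_mul, mul_smul_comm, map_smul, mul_smul_comm,
        map_smul, mul_comm (expKer c), smul_eq_mul, smul_eq_mul]
    rw [Finset.sum_congr rfl fun a _ => h1 a, Finset.sum_add_distrib, ← Finset.mul_sum,
      ← Finset.mul_sum, sum_coeff_hp_mul_of_lt _ _ _ (by omega), ← hf]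
    congr 2
    -- The cutoff grew by `k` with the weight, while the index of `h` dropped by `k`: the first `k`
    -- terms have negative index and vanish, the others give `f` again.
    rw [show wt ν + k + 1 = k + (wt ν + 1) by ring, Finset.sum_range_add, hf]
    rw [Finset.sum_eq_zero, zero_add]
    · refine Finset.sum_congr rfl fun a _ => ?_
      congr 3
      push_cast
      ring
    · intro a ha
      rw [hp_of_neg _ (by simp at ha; omega), zero_mul, map_zero]
  · rw [hf]
    simp only [wt_zero, zero_add, Finset.sum_range_one, Nat.cast_zero, hp_zero, one_mul]
    rw [coeff_expKer, Finsupp.prod_zero_index]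

end

section

/-! ### Partial fractions -/

section PartialFractions

open Polynomial

variable {N : ℕ} {τ : ℂ} {x : Fin N → ℂ}

/-- Interpolation: both sides have degree at most `N` and agree at the `N + 1` distinct points `0,
x_1, …, x_N`, indexed by `Option (Fin N)`. At `x_i` only the `i`-th summand survives, and its Ward
factor clears the denominators. -/
theorem prod_X_sub_eq (hx : Function.Injective x) (hx0 : ∀ i, x i ≠ 0) :
    (∏ i, (X - C (x i)) - ∏ i, (C τ⁻¹ * X - C (x i)) : ℂ[X])
      = C (1 - τ⁻¹) * (X * ∑ i, C (wardFactor τ i x) * ∏ j ∈ Finset.univ.erase i, (X - C (x j))) := by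
  have hinj : Set.InjOn (fun o : Option (Fin N) => o.elim 0 x)
      (Finset.univ : Finset (Option (Fin N))) := by
    rintro (_ | i) _ (_ | j) _ hij
    · rfl
    · exact absurd hij.symm (hx0 j)
    · exact absurd hij (hx0 i)
    · exact congrArg some (hx hij)
  have hcard : (Finset.univ : Finset (Option (Fin N))).card = N + 1 := by simp
  have hd1 : ∀ i, (X - C (x i) : ℂ[X]).natDegree ≤ 1 := fun i => natDegree_X_sub_C_le _
  have hd2 : ∀ i, (C τ⁻¹ * X - C (x i) : ℂ[X]).natDegree ≤ 1 := fun i =>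
    (natDegree_sub_le _ _).trans (max_le (natDegree_C_mul_le _ _ |>.trans natDegree_X_le) (by simp))
  have hdp : ∀ (s : Finset (Fin N)) (f : Fin N → ℂ[X]), (∀ i, (f i).natDegree ≤ 1) →
      (∏ i ∈ s, f i).natDegree ≤ s.card := by
    intro s f hf
    refine (natDegree_prod_le _ _).trans ((Finset.sum_le_sum fun i _ => hf i).trans ?_)
    simp
  refine eq_of_degrees_lt_of_eval_index_eq Finset.univ hinj ?_ ?_ ?_
  · rw [hcard]
    refine lt_of_le_of_lt degree_le_natDegree (Nat.cast_lt.2 (Nat.lt_succ_of_le ?_))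
    refine (natDegree_sub_le _ _).trans (max_le ?_ ?_)
    · simpa only [Finset.card_univ, Fintype.card_fin] using hdp Finset.univ _ hd1
    · simpa only [Finset.card_univ, Fintype.card_fin] using hdp Finset.univ _ hd2
  · rw [hcard]
    refine lt_of_le_of_lt degree_le_natDegree (Nat.cast_lt.2 (Nat.lt_succ_of_le ?_))
    refine (natDegree_C_mul_le _ _).trans ?_
    rw [Finset.mul_sum]
    refine natDegree_sum_le_of_forall_le _ _ fun i _ => ?_
    refine natDegree_mul_le.trans ?_
    have h1 := (natDegree_C_mul_le (wardFactor τ i x)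
      (∏ j ∈ Finset.univ.erase i, (X - C (x j)))).trans (hdp _ _ hd1)
    rw [Finset.card_erase_of_mem (Finset.mem_univ i), Finset.card_univ, Fintype.card_fin] at h1
    have := i.pos
    rw [natDegree_X]
    omega
  · rintro (_ | i) _
    · simp [eval_prod]
    · simp only [Option.elim, eval_sub, eval_mul, eval_C, eval_X, eval_prod, eval_finsetSum]
      rw [Finset.prod_eq_zero (Finset.mem_univ i) (sub_self _), zero_sub,
        Finset.sum_eq_single i, wardFactor, Finset.prod_div_distrib, div_mul_cancel₀,
        ← Finset.mul_prod_erase _ _ (Finset.mem_univ i)]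
      · ring
      · exact Finset.prod_ne_zero_iff.2 fun j hj =>
          sub_ne_zero.2 fun h => Finset.ne_of_mem_erase hj (hx h).symm
      · intro j _ hji
        rw [Finset.prod_eq_zero (Finset.mem_erase.2 ⟨hji.symm, Finset.mem_univ i⟩) (sub_self _),
          mul_zero]
      · simp

/-- The derivative at `0` of the interpolation identity, divided by `(1 - τ⁻¹) ∏ (-x_j)`. -/
theorem sum_wardFactor_div (hτ1 : τ ≠ 1) (hx : Function.Injective x)
    (hx0 : ∀ i, x i ≠ 0) : ∑ i, wardFactor τ i x * (x i)⁻¹ = ∑ i, (x i)⁻¹ := by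
  have h := congrArg (fun p : ℂ[X] => (derivative p).eval 0) (prod_X_sub_eq (τ := τ) hx hx0)
  have he : ∀ i, ∏ j ∈ Finset.univ.erase i, (-x j) = (∏ j, (-x j)) * (-(x i)⁻¹) := by
    intro i
    rw [← Finset.mul_prod_erase _ _ (Finset.mem_univ i)]
    field_simp [hx0 i]
  simp only [derivative_sub, derivative_prod_finset, derivative_mul, derivative_C, derivative_X, zero_mul,
    zero_add, mul_one, one_mul, eval_sub, eval_add, eval_mul, eval_C, eval_X, eval_finsetSum,
    eval_prod, sub_zero, mul_zero, add_zero, zero_sub, he] at h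
  have hne : (1 - τ⁻¹) * ∏ j, (-x j) ≠ 0 := by
    refine mul_ne_zero (sub_ne_zero.2 fun h => hτ1 ?_)
      (Finset.prod_ne_zero_iff.2 fun j _ => neg_ne_zero.2 (hx0 j))
    rw [← inv_inv τ, ← h, inv_one]
  refine mul_left_cancel₀ hne ?_
  have e1 : ∀ c : ℂ, ∑ i, (∏ j, (-x j)) * -(x i)⁻¹ * c
      = -((∏ j, (-x j)) * (∑ i, (x i)⁻¹) * c) := by
    intro c
    rw [Finset.mul_sum, Finset.sum_mul, ← Finset.sum_neg_distrib]
    exact Finset.sum_congr rfl fun i _ => by ring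
  have e2 : ∑ i, wardFactor τ i x * ((∏ j, (-x j)) * -(x i)⁻¹)
      = -((∏ j, (-x j)) * ∑ i, wardFactor τ i x * (x i)⁻¹) := by
    rw [Finset.mul_sum, ← Finset.sum_neg_distrib]
    exact Finset.sum_congr rfl fun i _ => by ring
  have e3 := e1 1
  simp only [mul_one] at e3
  rw [e3, e1, e2] at h
  linear_combination h

/-- The interpolation identity at `u⁻¹`, multiplied by `u^N`, for all `u ≠ 0`. The factors `τ⁻¹ u⁻¹
- x_i` produce the power `τ^{-N}`. -/
theorem prod_one_sub_mul_X_eq (hτ : τ ≠ 0) (hx : Function.Injective x) (hx0 : ∀ i, x i ≠ 0) :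
    (∏ i, (1 - C (x i) * X) - C (τ ^ N)⁻¹ * ∏ i, (1 - C (τ * x i) * X) : ℂ[X])
      = C (1 - τ⁻¹) * ∑ i, C (wardFactor τ i x) * ∏ j ∈ Finset.univ.erase i, (1 - C (x j) * X) := by
  refine eq_of_infinite_eval_eq _ _ (Set.Infinite.mono (s := {0}ᶜ) ?_ (Set.finite_singleton _).infinite_compl)
  intro u hu
  have hu : u ≠ 0 := hu
  have h := congrArg (fun p : ℂ[X] => u ^ N * p.eval u⁻¹) (prod_X_sub_eq (τ := τ) hx hx0)
  simp only [eval_sub, eval_mul, eval_C, eval_X, eval_prod, eval_finsetSum] at h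
  have e0 : ∀ f : Fin N → ℂ, u ^ N * ∏ i, f i = ∏ i, (u * f i) := by
    intro f
    rw [Finset.prod_mul_distrib, Finset.prod_const, Finset.card_univ, Fintype.card_fin]
  have e1 : ∀ i : Fin N, ∏ j ∈ Finset.univ.erase i, (u * (u⁻¹ - x j))
      = u ^ (N - 1) * ∏ j ∈ Finset.univ.erase i, (u⁻¹ - x j) := by
    intro i
    rw [Finset.prod_mul_distrib, Finset.prod_const, Finset.card_erase_of_mem (Finset.mem_univ i),
      Finset.card_univ, Fintype.card_fin]
  have e2 : ∀ i : Fin N, u * (u⁻¹ - x i) = 1 - x i * u := by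
    intro i
    field_simp
  have e3 : ∀ i : Fin N, u * (τ⁻¹ * u⁻¹ - x i) = τ⁻¹ * (1 - τ * x i * u) := by
    intro i
    field_simp
  simp only [Set.mem_ofPred_eq, eval_sub, eval_mul, eval_C, eval_X, eval_prod, eval_finsetSum,
    eval_one]
  rw [mul_sub, e0, e0] at h
  simp only [e2, e3] at h
  rw [Finset.prod_mul_distrib (f := fun _ => τ⁻¹), Finset.prod_const, Finset.card_univ,
    Fintype.card_fin, inv_pow] at h
  rw [h]
  rw [← mul_assoc, mul_comm (u ^ N), mul_assoc]
  congr 1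
  rw [← mul_assoc, Finset.mul_sum]
  refine Finset.sum_congr rfl fun i _ => ?_
  simp only [← e2]
  rw [e1]
  have hN : u ^ N * u⁻¹ = u ^ (N - 1) := by
    have := i.pos
    obtain ⟨n, rfl⟩ := Nat.exists_eq_succ_of_ne_zero this.ne'
    rw [pow_succ, mul_assoc, mul_inv_cancel₀ hu, mul_one]
    rfl
  rw [hN]
  ring

/-- Divide the reversed identity by `∏ (1 - x_i z)` and compare coefficients of `z^s`. Below, `L y`
is `1 - y z`, `E y` its inverse, and `H = ∏ (1 - τ x_i z)/(1 - x_i z)`. -/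
theorem sum_wardFactor_mul_pow (hτ : τ ≠ 0) (hx : Function.Injective x) (hx0 : ∀ i, x i ≠ 0)
    (s : ℕ) : (1 - τ⁻¹) * ∑ i, wardFactor τ i x * x i ^ s
      = (if s = 0 then 1 else 0)
        - (τ ^ N)⁻¹ * hCoeff (fun k : ℕ+ => (1 - τ ^ (k : ℕ)) * ∑ i, x i ^ (k : ℕ)) s := by
  set E : ℂ → PowerSeries ℂ := fun y => expSeries fun k : ℕ+ => y ^ (k : ℕ) with hE
  set L : ℂ → PowerSeries ℂ := fun y => 1 - PowerSeries.C y * PowerSeries.X with hL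
  have hLE : ∀ y, L y * E y = 1 := one_sub_mul_expSeries_pow
  set H : PowerSeries ℂ := expSeries fun k : ℕ+ => (1 - τ ^ (k : ℕ)) * ∑ i, x i ^ (k : ℕ) with hH
  have hH1 : H * ∏ i, E (τ * x i) = ∏ i, E (x i) := by
    rw [hE, ← expSeries_sum, ← expSeries_sum, hH, ← expSeries_add]
    congr 1
    funext k
    simp only [Pi.add_apply, Finset.sum_apply, mul_pow, ← Finset.mul_sum]
    ring
  have hH2 : H = (∏ i, E (x i)) * ∏ i, L (τ * x i) := by
    rw [← hH1, mul_assoc, ← Finset.prod_mul_distrib]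
    simp only [mul_comm (E _), hLE, Finset.prod_const_one, mul_one]
  have h : ∏ i, L (x i) - PowerSeries.C (τ ^ N)⁻¹ * ∏ i, L (τ * x i) = PowerSeries.C (1 - τ⁻¹)
      * ∑ i, PowerSeries.C (wardFactor τ i x) * ∏ j ∈ Finset.univ.erase i, L (x j) := by
    simpa only [map_sub, map_mul, map_prod, map_sum, map_one, hL,
      Polynomial.coeToPowerSeries.ringHom_apply, Polynomial.coe_C, Polynomial.coe_X] using
      congrArg Polynomial.coeToPowerSeries.ringHom (prod_one_sub_mul_X_eq hτ hx hx0)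
  have h1 : ∀ i, (∏ j ∈ Finset.univ.erase i, L (x j)) * ∏ j, E (x j) = E (x i) := by
    intro i
    rw [← Finset.mul_prod_erase _ _ (Finset.mem_univ i), mul_left_comm, ← Finset.prod_mul_distrib]
    simp only [hLE, Finset.prod_const_one, mul_one]
  have h2 : (∏ j, L (x j)) * ∏ j, E (x j) = 1 := by
    rw [← Finset.prod_mul_distrib]
    simp only [hLE, Finset.prod_const_one]
  have h3 : 1 - PowerSeries.C (τ ^ N)⁻¹ * H
      = PowerSeries.C (1 - τ⁻¹) * ∑ i, PowerSeries.C (wardFactor τ i x) * E (x i) := by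
    have := congrArg (· * ∏ j, E (x j)) h
    simp only [sub_mul, h2, mul_assoc, Finset.sum_mul, h1] at this
    rw [hH2, mul_comm (∏ i, E (x i)), this]
  have h4 := congrArg (PowerSeries.coeff s) h3
  rw [map_sub, PowerSeries.coeff_C_mul, PowerSeries.coeff_C_mul, map_sum,
    PowerSeries.coeff_one] at h4
  rw [hCoeff_natCast, h4]
  congr 1
  refine Finset.sum_congr rfl fun i _ => ?_
  rw [PowerSeries.coeff_C_mul, show E (x i) = _ from expSeries_pow (x i), PowerSeries.coeff_mk]

end PartialFractions

end

section

/-! ### The Virasoro modes on the kernel -/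

/-- The coefficient of `z^{-s}` in `1 - τ^{-N} ∏_i (1 - τ x_i / z) / (1 - x_i / z)`. -/
def shiftCoeff (τ : ℂ) {N : ℕ} (x : Fin N → ℂ) (s : ℤ) : ℂ :=
  kd s 0 - (τ ^ N)⁻¹ * hCoeff (fun k : ℕ+ => (1 - τ ^ (k : ℕ)) * ∑ i, x i ^ (k : ℕ)) s

section

variable {N : ℕ} {τ : ℂ} {x : Fin N → ℂ}

/-- At `s = -1` both sides are zero: the sum with Ward factors does not vanish there, and the
subtracted sum is its value. This correction lets the formula reach the mode `n = -1`. -/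
theorem shiftCoeff_eq (hτ : τ ≠ 0) (hτ1 : τ ≠ 1) (hx : Function.Injective x)
    (hx0 : ∀ i, x i ≠ 0) {s : ℤ} (hs : -1 ≤ s) :
    shiftCoeff τ x s = (1 - τ⁻¹)
      * (∑ i, wardFactor τ i x * x i ^ s - if s = -1 then ∑ i, (x i)⁻¹ else 0) := by
  rcases eq_or_lt_of_le hs with rfl | hs
  · rw [if_pos rfl, shiftCoeff, kd, if_neg (by norm_num), hCoeff_of_neg _ (by norm_num)]
    simp [sum_wardFactor_div hτ1 hx hx0]
  · lift s to ℕ using by omega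
    rw [if_neg (by omega), sub_zero]
    simp only [zpow_natCast]
    rw [sum_wardFactor_mul_pow hτ hx hx0, shiftCoeff, kd]
    simp only [Nat.cast_eq_zero]

/-- A coefficient of a product of `M(z)`, `∑ G_a z^a` and a sum of simple poles is obtained by
evaluating at the poles. For `n = -1` only `l = a = 0` meets the index `-1`, which leaves the last
term. -/
theorem sum_coeff_mul_shiftCoeff (hτ : τ ≠ 0) (hτ1 : τ ≠ 1) (hx : Function.Injective x)
    (hx0 : ∀ i, x i ≠ 0) (M : Polynomial ℂ) {d : ℕ} (hd : M.natDegree ≤ d) {n : ℤ} (hn : -1 ≤ n)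
    (W : ℕ) (G : ℕ → ℂ) :
    ∑ l ∈ Finset.range (d + 1), M.coeff l
        * ∑ a ∈ Finset.range (W + 1), G a * shiftCoeff τ x (l + n + a)
      = (1 - τ⁻¹) * (∑ i, wardFactor τ i x * x i ^ n * M.eval (x i)
            * ∑ a ∈ Finset.range (W + 1), G a * x i ^ a
          - if n = -1 then M.eval 0 * G 0 * ∑ i, (x i)⁻¹ else 0) := by
  have h1 : ∀ l a : ℕ, shiftCoeff τ x (l + n + a) = (1 - τ⁻¹)
      * (∑ i, wardFactor τ i x * x i ^ n * x i ^ l * x i ^ a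
        - if (l : ℤ) + n + a = -1 then ∑ i, (x i)⁻¹ else 0) := by
    intro l a
    rw [shiftCoeff_eq hτ hτ1 hx hx0 (by omega)]
    congr 2
    refine Finset.sum_congr rfl fun i _ => ?_
    rw [zpow_add₀ (hx0 i), zpow_add₀ (hx0 i), zpow_natCast, zpow_natCast]
    ring
  simp only [h1, mul_sub, Finset.sum_sub_distrib]
  congr 1
  · have h2 : ∀ i, (1 - τ⁻¹) * (wardFactor τ i x * x i ^ n * M.eval (x i)
          * ∑ a ∈ Finset.range (W + 1), G a * x i ^ a)
        = ∑ l ∈ Finset.range (d + 1), ∑ a ∈ Finset.range (W + 1), M.coeff l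
          * (G a * ((1 - τ⁻¹) * (wardFactor τ i x * x i ^ n * x i ^ l * x i ^ a))) := by
      intro i
      rw [Polynomial.eval_eq_sum_range' (Nat.lt_succ_of_le hd), mul_assoc (_ * _),
        Finset.sum_mul_sum, Finset.mul_sum, Finset.mul_sum]
      refine Finset.sum_congr rfl fun l _ => ?_
      rw [Finset.mul_sum, Finset.mul_sum]
      exact Finset.sum_congr rfl fun a _ => by ring
    rw [Finset.mul_sum, Finset.sum_congr rfl fun i _ => h2 i, Finset.sum_comm]
    refine Finset.sum_congr rfl fun l _ => ?_
    rw [Finset.sum_comm, Finset.mul_sum]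
    refine Finset.sum_congr rfl fun a _ => ?_
    rw [Finset.mul_sum, Finset.mul_sum, Finset.mul_sum]
  · split_ifs with hn1
    · rw [Finset.sum_eq_single 0]
      · rw [Finset.sum_eq_single 0]
        · rw [if_pos (by simp [hn1]), Polynomial.coeff_zero_eq_eval_zero]
          ring
        · intro a _ ha
          rw [if_neg (by push_cast; omega)]
          simp
        · simp
      · intro l _ hl
        rw [Finset.sum_eq_zero, mul_zero]
        intro a _
        rw [if_neg (by omega)]
        simp
      · simp
    · rw [mul_zero]
      refine Finset.sum_eq_zero fun l _ => ?_
      rw [Finset.sum_eq_zero, mul_zero]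
      intro a _
      rw [if_neg (by omega)]
      simp

theorem wardFactor_mul {q : ℂ} (hq : q ≠ 0) (i : Fin N) :
    wardFactor τ i (fun j => q * x j) = wardFactor τ i x := by
  refine Finset.prod_congr rfl fun j _ => ?_
  rw [← mul_sub, show τ⁻¹ * (q * x i) - q * x j = q * (τ⁻¹ * x i - x j) by ring,
    mul_div_mul_left _ _ hq]

end

section

variable {q t : ℂ} {N : ℕ}

/-- The coefficients of the kernel as an exponential. -/
def kerCoeff (q t : ℂ) {N : ℕ} (x : Fin N → ℂ) (k : ℕ+) : ℂ :=
  (1 - t ^ (k : ℕ)) / (1 - q ^ (k : ℕ)) / (k : ℂ) * ∑ i, x i ^ (k : ℕ)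

theorem kernel_eq (x : Fin N → ℂ) : kernel q t x = expKer (kerCoeff q t x) := rfl

theorem one_sub_pow_ne_zero (hq : ‖q‖ < 1) (k : ℕ+) : 1 - q ^ (k : ℕ) ≠ 0 := by
  refine sub_ne_zero.2 fun h => ?_
  have := pow_lt_one₀ (norm_nonneg q) hq k.ne_zero
  rw [← norm_pow, ← h, norm_one] at this
  exact lt_irrefl _ this

/-- The kernel is a joint eigenvector of the derivations. The two exponentials of derivations have
the eigenvalues described by `shiftCoeff` for `t` at the points `x_i` and for `t⁻¹` at the points `q
x_i`. The one-term sum over `a` gives both parts the shape of `sum_coeff_mul_shiftCoeff`. -/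
theorem coeff_virasoroMode_kernel (hq : ‖q‖ < 1) (hq0 : q ≠ 0) (ht0 : t ≠ 0)
    (Mp Mm : Polynomial ℂ) (dp dm : ℕ) (n : ℤ) (x : Fin N → ℂ) (μ : ℕ+ →₀ ℕ) :
    MvPowerSeries.coeff μ (virasoroMode q t (t ^ N) Mp Mm dp dm n (kernel q t x))
      = ∑ l ∈ Finset.range (dm + 1), Mm.coeff l * ∑ a ∈ Finset.range (0 + 1),
          MvPowerSeries.coeff μ (kernel q t x) * shiftCoeff t x (l + n + a)
        + q * t⁻¹ * ∑ l ∈ Finset.range (dp + 1), Mp.coeff l * ∑ a ∈ Finset.range (wt μ + 1),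
          MvPowerSeries.coeff μ (hp (fun k => (1 - t ^ (-(k : ℤ))) * (t / q) ^ (k : ℤ)) a
            * kernel q t x) * shiftCoeff t⁻¹ (fun i => q * x i) (l + n + a) := by
  have hk : ∀ k : ℕ+, (k : ℂ) ≠ 0 := fun k => Nat.cast_ne_zero.2 k.ne_zero
  have hd : ∀ k : ℕ+, pDer k (kernel q t x) = kerCoeff q t x k • kernel q t x := fun k => by
    rw [kernel_eq, pDer_expKer]
  have h1 : ∀ s : ℤ, hMode (fun k => (1 - q ^ (k : ℤ)) • ((k : ℂ) • pDer k)) s (kernel q t x)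
      = hCoeff (fun k : ℕ+ => (1 - t ^ (k : ℕ)) * ∑ i, x i ^ (k : ℕ)) s • kernel q t x := by
    intro s
    refine hMode_apply_of_eigen (fun k => ?_) s
    rw [LinearMap.smul_apply, LinearMap.smul_apply, hd, smul_smul, smul_smul, zpow_natCast]
    congr 1
    have := one_sub_pow_ne_zero hq k
    have := hk k
    rw [kerCoeff]
    field_simp
  have h2 : ∀ s : ℤ, hMode (fun k => (-((1 - q ^ (k : ℤ)) * (t / q) ^ (-(k : ℤ))))
        • ((k : ℂ) • pDer k)) s (kernel q t x)
      = hCoeff (fun k : ℕ+ => (1 - t⁻¹ ^ (k : ℕ)) * ∑ i, (q * x i) ^ (k : ℕ)) s • kernel q t x := by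
    intro s
    refine hMode_apply_of_eigen (fun k => ?_) s
    rw [LinearMap.smul_apply, LinearMap.smul_apply, hd, smul_smul, smul_smul, zpow_natCast,
      zpow_neg, zpow_natCast]
    congr 1
    have := one_sub_pow_ne_zero hq k
    have := hk k
    have := pow_ne_zero k ht0
    have := pow_ne_zero k hq0
    simp only [mul_pow, ← Finset.mul_sum, kerCoeff, inv_pow, div_pow]
    field_simp
    ring
  rw [virasoroMode, LinearMap.add_apply, map_add]
  congr 1
  · rw [LinearMap.sum_apply, map_sum]
    refine Finset.sum_congr rfl fun l _ => ?_
    rw [LinearMap.smul_apply, LinearMap.sub_apply, LinearMap.smul_apply, LinearMap.smul_apply, h1,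
      Module.End.one_apply, map_smul, map_sub, map_smul, map_smul, map_smul]
    simp only [smul_eq_mul, zero_add, Finset.sum_range_one, Nat.cast_zero, add_zero, shiftCoeff]
    ring
  · rw [LinearMap.smul_apply, map_smul, smul_eq_mul, LinearMap.sum_apply, map_sum]
    congr 1
    refine Finset.sum_congr rfl fun l _ => ?_
    rw [LinearMap.smul_apply, LinearMap.sub_apply, LinearMap.smul_apply, hMode_pMul_apply,
      map_smul, map_sub, map_smul, coeff_vertexMode, smul_eq_mul]
    congr 1
    simp only [h2, mul_smul_comm, map_smul, smul_eq_mul, shiftCoeff, mul_sub,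
      Finset.sum_sub_distrib]
    congr 1
    -- The pure multiplication term is matched with the Kronecker delta in `shiftCoeff`, which
    -- selects `a = -(l + n)`.
    · rcases lt_or_ge (-((l : ℤ) + n)) 0 with h | h
      · rw [hp_of_neg _ h, zero_mul, map_zero]
        symm
        refine Finset.sum_eq_zero fun a _ => ?_
        rw [kd, if_neg (by omega), mul_zero]
      · obtain ⟨s, hs⟩ := Int.eq_ofNat_of_zero_le h
        rw [hs]
        by_cases hw : s < wt μ + 1
        · rw [Finset.sum_eq_single s]
          · rw [kd, if_pos (by omega), mul_one]
          · intro a _ ha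
            rw [kd, if_neg (by omega), mul_zero]
          · intro hn
            simp at hn
            omega
        · rw [coeff_hp_mul_eq_zero _ _ _ (by omega)]
          symm
          refine Finset.sum_eq_zero fun a ha => ?_
          simp at ha
          rw [kd, if_neg (by omega), mul_zero]
    · rw [Finset.mul_sum]
      refine Finset.sum_congr rfl fun a _ => ?_
      rw [inv_pow, inv_inv, add_comm (a : ℤ)]
      ring

/-- The action of the Virasoro modes on the kernel in terms of Ward identities. -/
theorem coeff_virasoroMode_kernel_eq (hq : ‖q‖ < 1) (hq0 : q ≠ 0) (ht0 : t ≠ 0) (ht1 : t ≠ 1)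
    {Mp Mm : Polynomial ℂ} {dp dm : ℕ} (hdp : Mp.natDegree ≤ dp) (hdm : Mm.natDegree ≤ dm)
    {n : ℤ} (hn : 0 ≤ n ∨ (n = -1 ∧ Mp.eval 0 = Mm.eval 0)) {x : Fin N → ℂ}
    (hx : Function.Injective x) (hx0 : ∀ i, x i ≠ 0) (μ : ℕ+ →₀ ℕ) :
    MvPowerSeries.coeff μ (virasoroMode q t (t ^ N) Mp Mm dp dm n (kernel q t x))
      = (1 - t⁻¹) * ∑ i, (x i ^ n * Mm.eval (x i) * MvPowerSeries.coeff μ (kernel q t x)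
            * wardFactor t i x
          - q * ((q * x i) ^ n * Mp.eval (q * x i)
            * MvPowerSeries.coeff μ (kernel q t (Function.update x i (q * x i)))
            * wardFactor t⁻¹ i x)) := by
  have hn' : -1 ≤ n := by omega
  have hx' : Function.Injective fun i => q * x i := fun i j h => hx (mul_left_cancel₀ hq0 h)
  have ht1' : t⁻¹ ≠ 1 := fun h => ht1 (by rw [← inv_inv t, h, inv_one])
  have hk : ∀ k : ℕ+, (k : ℂ) ≠ 0 := fun k => Nat.cast_ne_zero.2 k.ne_zero
  -- At `z = q x_i` the exponential of multiplications is `exp (-∑ (1 - t^k) x_i^k p_k / k)`, which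
  -- is the ratio of the kernels at `q x_i` and at `x_i`.
  have hT : ∀ i, ∑ a ∈ Finset.range (wt μ + 1),
      MvPowerSeries.coeff μ (hp (fun k => (1 - t ^ (-(k : ℤ))) * (t / q) ^ (k : ℤ)) a
        * kernel q t x) * (q * x i) ^ a
      = MvPowerSeries.coeff μ (kernel q t (Function.update x i (q * x i))) := by
    intro i
    have e1 := sum_coeff_hp_mul_expKer
      (fun k => (1 - t ^ (-(k : ℤ))) * (t / q) ^ (k : ℤ) * (q * x i) ^ (k : ℤ)) (kerCoeff q t x) μ
    rw [kernel_eq, kernel_eq]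
    refine Eq.trans (Finset.sum_congr rfl fun a _ => ?_) (e1.trans ?_)
    · rw [hp_scale (q * x i) (fun k : ℕ+ => (1 - t ^ (-(k : ℤ))) * (t / q) ^ (k : ℤ)),
        smul_mul_assoc, map_smul, smul_eq_mul, mul_comm, zpow_natCast]
    · congr 2
      funext k
      have h1 := one_sub_pow_ne_zero hq k
      have h2 := hk k
      have h3 := pow_ne_zero k ht0
      have h4 := pow_ne_zero k hq0
      have hu : ∑ j ∈ Finset.univ.erase i, Function.update x i (q * x i) j ^ (k : ℕ)
          = ∑ j ∈ Finset.univ.erase i, x j ^ (k : ℕ) :=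
        Finset.sum_congr rfl fun j hj => by
          rw [Function.update_of_ne (Finset.ne_of_mem_erase hj)]
      rw [kerCoeff, kerCoeff, ← Finset.add_sum_erase _ _ (Finset.mem_univ i),
        ← Finset.add_sum_erase _ (fun j => Function.update x i (q * x i) j ^ (k : ℕ))
          (Finset.mem_univ i), Function.update_self, hu]
      simp only [zpow_neg, zpow_natCast, div_pow, mul_pow]
      field_simp
      ring
  rw [coeff_virasoroMode_kernel hq hq0 ht0,
    sum_coeff_mul_shiftCoeff ht0 ht1 hx hx0 Mm hdm hn',
    sum_coeff_mul_shiftCoeff (inv_ne_zero ht0) ht1' hx' (fun i => mul_ne_zero hq0 (hx0 i)) Mp hdp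
      hn']
  simp only [hT, wardFactor_mul hq0, Nat.cast_zero, hp_zero, one_mul, zero_add,
    Finset.sum_range_one, pow_zero, mul_one, mul_inv, inv_inv]
  -- The extra terms at `n = -1`: the dilated points contribute `∑ (q x_i)⁻¹`, whose `q⁻¹` is
  -- compensated by the prefactor `q`, so the terms agree when `M⁺(0) = M⁻(0)`.
  have hcancel : (if n = -1 then Mm.eval 0 * MvPowerSeries.coeff μ (kernel q t x)
        * ∑ i, (x i)⁻¹ else 0)
      = q * (if n = -1 then Mp.eval 0 * MvPowerSeries.coeff μ (kernel q t x)
        * ∑ i, q⁻¹ * (x i)⁻¹ else 0) := by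
    rcases hn with hn | ⟨hn, h0⟩
    · rw [if_neg (by omega), if_neg (by omega), mul_zero]
    · rw [if_pos hn, if_pos hn, h0, ← Finset.mul_sum]
      field_simp
  rw [hcancel, Finset.sum_sub_distrib]
  have e1 : ∑ i, wardFactor t i x * x i ^ n * Mm.eval (x i) * MvPowerSeries.coeff μ (kernel q t x)
      = ∑ i, x i ^ n * Mm.eval (x i) * MvPowerSeries.coeff μ (kernel q t x) * wardFactor t i x :=
    Finset.sum_congr rfl fun i _ => by ring
  have e2 : ∑ i, q * ((q * x i) ^ n * Mp.eval (q * x i)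
        * MvPowerSeries.coeff μ (kernel q t (Function.update x i (q * x i)))
        * wardFactor t⁻¹ i x) = q * ∑ i, wardFactor t⁻¹ i x * (q * x i) ^ n * Mp.eval (q * x i)
        * MvPowerSeries.coeff μ (kernel q t (Function.update x i (q * x i))) := by
    rw [Finset.mul_sum]
    exact Finset.sum_congr rfl fun i _ => by ring
  rw [← e1, e2]
  generalize (∑ i, wardFactor t i x * x i ^ n * Mm.eval (x i)
    * MvPowerSeries.coeff μ (kernel q t x)) = A
  generalize (∑ i, wardFactor t⁻¹ i x * (q * x i) ^ n * Mp.eval (q * x i)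
    * MvPowerSeries.coeff μ (kernel q t (Function.update x i (q * x i)))) = B
  field_simp
  ring

end

end

section

/-! ### The homology form of Cauchy's theorem -/

open Set Metric Filter

/-- The integral of `f` along a curve parametrized by `[0, 1]`. -/
def pathIntegral (γ : ℝ → ℂ) (f : ℂ → ℂ) : ℂ := ∫ u in (0 : ℝ)..1, deriv γ u * f (γ u)

/-- Differentiation under the integral for a bounded holomorphic family: Cauchy's estimate on
circles of radius `r / 2` dominates the derivatives on the smaller ball, so no bound on them has to
be assumed. -/
theorem hasDerivAt_integral_of_bounded {F : ℂ → ℝ → ℂ} {z₀ : ℂ} {r B : ℝ} (hr : 0 < r)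
    (hd : ∀ u ∈ Icc (0 : ℝ) 1, DifferentiableOn ℂ (fun z => F z u) (ball z₀ r))
    (hB : ∀ z ∈ ball z₀ r, ∀ u ∈ Icc (0 : ℝ) 1, ‖F z u‖ ≤ B)
    (hc : ∀ z ∈ ball z₀ r, ContinuousOn (F z) (Icc 0 1)) :
    HasDerivAt (fun z => ∫ u in (0 : ℝ)..1, F z u)
      (∫ u in (0 : ℝ)..1, deriv (fun z => F z u) z₀) z₀ := by
  have hI : Set.uIoc (0 : ℝ) 1 ⊆ Icc 0 1 := by
    rw [Set.uIoc_of_le zero_le_one]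
    exact Ioc_subset_Icc_self
  have hmeas : ∀ z ∈ ball z₀ r, MeasureTheory.AEStronglyMeasurable (F z)
      (MeasureTheory.volume.restrict (Set.uIoc (0 : ℝ) 1)) := fun z hz =>
    ((hc z hz).mono hI).aestronglyMeasurable measurableSet_uIoc
  have hz₀ : z₀ ∈ ball z₀ r := mem_ball_self hr
  have hda : ∀ u ∈ Icc (0 : ℝ) 1, ∀ z ∈ ball z₀ r,
      HasDerivAt (fun z => F z u) (deriv (fun z => F z u) z) z := fun u hu z hz =>
    ((hd u hu).differentiableAt (isOpen_ball.mem_nhds hz)).hasDerivAt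
  refine (intervalIntegral.hasDerivAt_integral_of_dominated_loc_of_deriv_le
    (F' := fun z u => deriv (fun z => F z u) z) (bound := fun _ => B / (r / 2))
    (ball_mem_nhds z₀ (half_pos hr)) ?_ ?_ ?_ ?_ ?_ ?_).2
  · filter_upwards [ball_mem_nhds z₀ hr] with z hz using hmeas z hz
  · refine ContinuousOn.intervalIntegrable ?_
    rw [Set.uIcc_of_le zero_le_one]
    exact hc z₀ hz₀
  -- The derivative at `z₀` is measurable in `u` as a pointwise limit of difference quotients along
  -- a sequence tending to `z₀`.
  · set ζ : ℕ → ℂ := fun n => z₀ + ((r / 2 / (n + 1) : ℝ) : ℂ) with hζ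
    have hpos : ∀ n : ℕ, 0 < r / 2 / ((n : ℝ) + 1) := fun n => by positivity
    have hζb : ∀ n, ζ n ∈ ball z₀ r := by
      intro n
      rw [mem_ball, dist_eq_norm, hζ]
      simp only [add_sub_cancel_left, Complex.norm_real, Real.norm_eq_abs, abs_of_pos (hpos n)]
      have : r / 2 / ((n : ℝ) + 1) ≤ r / 2 :=
        div_le_self (half_pos hr).le (by linarith [n.cast_nonneg (α := ℝ)])
      linarith
    have hζt : Tendsto ζ atTop (𝓝[≠] z₀) := by
      refine tendsto_nhdsWithin_iff.2 ⟨?_, Eventually.of_forall fun n => ?_⟩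
      · have h1 : Tendsto (fun n : ℕ => r / 2 / ((n : ℝ) + 1)) atTop (𝓝 0) :=
          tendsto_const_nhds.div_atTop
            (tendsto_atTop_add_const_right _ _ tendsto_natCast_atTop_atTop)
        have h2 := (Complex.continuous_ofReal.tendsto 0).comp h1
        simpa [hζ, Function.comp_def] using h2.const_add z₀
      · simp only [hζ, mem_compl_iff, mem_singleton_iff, add_eq_left, Complex.ofReal_eq_zero]
        exact (hpos n).ne'
    refine aestronglyMeasurable_of_tendsto_ae atTop
      (f := fun n u => (ζ n - z₀)⁻¹ * (F (ζ n) u - F z₀ u)) (fun n => ?_) ?_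
    · exact ((hmeas _ (hζb n)).sub (hmeas _ hz₀)).const_mul _
    · refine (MeasureTheory.ae_restrict_iff' measurableSet_uIoc).2 (Eventually.of_forall ?_)
      intro u hu
      have := (hasDerivAt_iff_tendsto_slope.1 (hda u (hI hu) z₀ hz₀)).comp hζt
      exact this
  · refine Eventually.of_forall fun u hu z hz => ?_
    have hsub : closedBall z (r / 2) ⊆ ball z₀ r := by
      intro w hw
      rw [mem_ball] at hz ⊢
      rw [mem_closedBall] at hw
      linarith [dist_triangle w z z₀]
    refine Complex.norm_deriv_le_of_forall_mem_sphere_norm_le (half_pos hr) ?_ fun w hw =>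
      hB w (hsub (sphere_subset_closedBall hw)) u (hI hu)
    refine DifferentiableOn.diffContOnCl ?_
    rw [closure_ball _ (half_pos hr).ne']
    exact (hd u (hI hu)).mono hsub
  · exact _root_.intervalIntegrable_const
  · refine Eventually.of_forall fun u hu z hz => ?_
    exact hda u (hI hu) z (ball_subset_ball (by linarith) hz)

/-! ### Cauchy integrals along one curve -/

section Path

variable {γ : ℝ → ℂ}

theorem continuous_deriv_path (hγ : ContDiff ℝ 1 γ) : Continuous (deriv γ) := hγ.continuous_deriv le_rfl

theorem exists_norm_deriv_path_le (hγ : ContDiff ℝ 1 γ) : ∃ D : ℝ, 0 ≤ D ∧ ∀ u ∈ Icc (0 : ℝ) 1, ‖deriv γ u‖ ≤ D := by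
  obtain ⟨D, hD⟩ := isCompact_Icc.exists_bound_of_continuousOn
    (continuous_deriv_path hγ).continuousOn (s := Icc (0 : ℝ) 1)
  exact ⟨D, (norm_nonneg _).trans (hD 0 (by simp)), hD⟩

theorem intervalIntegrable_path (hγ : ContDiff ℝ 1 γ) {f : ℂ → ℂ} (hf : ContinuousOn f (γ '' Icc 0 1)) :
    IntervalIntegrable (fun u => deriv γ u * f (γ u)) MeasureTheory.volume 0 1 := by
  refine ContinuousOn.intervalIntegrable ?_
  rw [Set.uIcc_of_le zero_le_one]
  exact (continuous_deriv_path hγ).continuousOn.mul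
    (hf.comp hγ.continuous.continuousOn (mapsTo_image _ _))

theorem pathIntegral_eq_zero_of_hasDerivAt (hγ : ContDiff ℝ 1 γ) (hcl : γ 0 = γ 1) {f F : ℂ → ℂ}
    (hf : ContinuousOn f (γ '' Icc 0 1)) (hF : ∀ w ∈ γ '' Icc 0 1, HasDerivAt F (f w) w) :
    pathIntegral γ f = 0 := by
  have h := intervalIntegral.integral_eq_sub_of_hasDerivAt (a := 0) (b := 1) (f := F ∘ γ)
    (f' := fun u => deriv γ u * f (γ u)) (fun u hu => ?_) (intervalIntegrable_path hγ hf)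
  · rw [pathIntegral, h, Function.comp_apply, Function.comp_apply, hcl, sub_self]
  · rw [Set.uIcc_of_le zero_le_one] at hu
    have h1 : HasDerivAt γ (deriv γ u) u :=
      (hγ.differentiable one_ne_zero u).hasDerivAt
    have := (hF _ (mem_image_of_mem _ hu)).scomp u h1
    simpa [smul_eq_mul] using this

theorem isCompact_path (hγ : ContDiff ℝ 1 γ) : IsCompact (γ '' Icc 0 1) := isCompact_Icc.image hγ.continuous

/-- Cauchy transforms are holomorphic off the curve. -/
theorem hasDerivAt_pathIntegral_inv (hγ : ContDiff ℝ 1 γ) {φ : ℂ → ℂ} (hφ : ContinuousOn φ (γ '' Icc 0 1)) {z₀ : ℂ}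
    (hz₀ : z₀ ∉ γ '' Icc 0 1) :
    HasDerivAt (fun z => pathIntegral γ fun w => φ w * (w - z)⁻¹)
      (pathIntegral γ fun w => φ w * ((w - z₀) ^ 2)⁻¹) z₀ := by
  obtain ⟨r, hr, hrs⟩ := nhds_basis_ball.mem_iff.1
    ((isCompact_path hγ).isClosed.isOpen_compl.mem_nhds hz₀)
  obtain ⟨D, hD0, hD⟩ := exists_norm_deriv_path_le hγ
  obtain ⟨B, hB⟩ := (isCompact_path hγ).exists_bound_of_continuousOn hφ
  have hne : ∀ z ∈ ball z₀ r, ∀ w ∈ γ '' Icc 0 1, w - z ≠ 0 := fun z hz w hw h =>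
    hrs hz (sub_eq_zero.1 h ▸ hw)
  have hdist : ∀ w ∈ γ '' Icc 0 1, ∀ z ∈ ball z₀ (r / 2), r / 2 ≤ ‖w - z‖ := by
    intro w hw z hz
    by_contra! h
    refine hrs ?_ hw
    rw [mem_ball] at hz ⊢
    rw [← dist_eq_norm] at h
    linarith [dist_triangle w z z₀]
  have hd : ∀ u ∈ Icc (0 : ℝ) 1, ∀ z ∈ ball z₀ r,
      HasDerivAt (fun z => deriv γ u * (φ (γ u) * (γ u - z)⁻¹))
        (deriv γ u * (φ (γ u) * ((γ u - z) ^ 2)⁻¹)) z := by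
    intro u hu z hz
    have h1 : HasDerivAt (fun z => γ u - z) (-1) z := by
      simpa using (hasDerivAt_id z).const_sub (γ u)
    have h2 := ((h1.fun_inv (hne z hz _ (mem_image_of_mem _ hu))).const_mul (φ (γ u))).const_mul
      (deriv γ u)
    rwa [neg_neg, one_div] at h2
  have hsub : ball z₀ (r / 2) ⊆ ball z₀ r := ball_subset_ball (by linarith)
  have key := hasDerivAt_integral_of_bounded (z₀ := z₀) (r := r / 2) (B := D * (B * (r / 2)⁻¹))
    (F := fun z u => deriv γ u * (φ (γ u) * (γ u - z)⁻¹)) (half_pos hr)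
    (fun u hu z hz => (hd u hu z (hsub hz)).differentiableAt.differentiableWithinAt) ?_ ?_
  · have he : ∫ u in (0 : ℝ)..1, deriv (fun z => deriv γ u * (φ (γ u) * (γ u - z)⁻¹)) z₀
        = pathIntegral γ fun w => φ w * ((w - z₀) ^ 2)⁻¹ := by
      refine intervalIntegral.integral_congr fun u hu => ?_
      rw [Set.uIcc_of_le zero_le_one] at hu
      exact (hd u hu z₀ (mem_ball_self hr)).deriv
    rw [he] at key
    exact key
  · intro z hz u hu
    rw [norm_mul, norm_mul, norm_inv]
    have hw : γ u ∈ γ '' Icc 0 1 := mem_image_of_mem _ hu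
    have h1 := hB _ hw
    have h2 := hdist _ hw z hz
    have h3 := half_pos hr
    have h4 : 0 ≤ B := (norm_nonneg _).trans h1
    exact mul_le_mul (hD u hu) (mul_le_mul h1 (inv_anti₀ h3 h2) (by positivity) h4)
      (by positivity) hD0
  · intro z hz
    refine (continuous_deriv_path hγ).continuousOn.mul
      ((hφ.comp hγ.continuous.continuousOn (mapsTo_image _ _)).mul ?_)
    exact (hγ.continuous.continuousOn.sub continuousOn_const).inv₀ fun u hu =>
      hne z (hsub hz) _ (mem_image_of_mem _ hu)

theorem dslope_comm (f : ℂ → ℂ) (a b : ℂ) : dslope f a b = dslope f b a := by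
  rcases eq_or_ne a b with rfl | h
  · rfl
  · rw [dslope_of_ne _ h.symm, dslope_of_ne _ h, slope_comm]

/-- The divided difference is symmetric, hence holomorphic in `z` for fixed `w`. It is bounded near
`z₀` uniformly in `w` on the curve: by the mean value inequality for `w` in the disc of radius `R`,
and by `2M / r` for `w` outside it, where `w` and `z` are at distance at least `r = R / 2`. -/
theorem differentiableAt_pathIntegral_dslope (hγ : ContDiff ℝ 1 γ) {U : Set ℂ} (hU : IsOpen U) {f : ℂ → ℂ}
    (hf : DifferentiableOn ℂ f U) (hsub : γ '' Icc 0 1 ⊆ U) {z₀ : ℂ} (hz₀ : z₀ ∈ U) :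
    DifferentiableAt ℂ (fun z => pathIntegral γ (dslope f z)) z₀ := by
  obtain ⟨R, hR, hRU⟩ := nhds_basis_closedBall.mem_iff.1 (hU.mem_nhds hz₀)
  set r := R / 2 with hr
  have hr0 : 0 < r := half_pos hR
  obtain ⟨D, hD0, hD⟩ := exists_norm_deriv_path_le hγ
  obtain ⟨M, hM⟩ := ((isCompact_closedBall z₀ R).union (isCompact_path hγ)).exists_bound_of_continuousOn
    (hf.continuousOn.mono (union_subset hRU hsub))
  have hf' : ContinuousOn (deriv f) U := (hf.deriv hU).continuousOn
  obtain ⟨L, hL⟩ := (isCompact_closedBall z₀ R).exists_bound_of_continuousOn (hf'.mono hRU)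
  have hM0 : 0 ≤ M := (norm_nonneg _).trans (hM z₀ (Or.inl (mem_closedBall_self hR.le)))
  have hball : ball z₀ r ⊆ closedBall z₀ R := fun z hz => by
    rw [mem_ball] at hz
    rw [mem_closedBall]
    linarith
  have hbound : ∀ z ∈ ball z₀ r, ∀ w ∈ γ '' Icc 0 1, ‖dslope f z w‖ ≤ max L (2 * M / r) := by
    intro z hz w hw
    by_cases hwR : w ∈ closedBall z₀ R
    · refine le_max_of_le_left ?_
      rcases eq_or_ne w z with rfl | hne
      · rw [dslope_same]
        exact hL _ hwR
      · rw [dslope_of_ne _ hne, slope_def_field, norm_div,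
          div_le_iff₀ (norm_pos_iff.2 (sub_ne_zero.2 hne))]
        exact (convex_closedBall z₀ R).norm_image_sub_le_of_norm_deriv_le
          (fun y hy => hf.differentiableAt (hU.mem_nhds (hRU hy))) hL (hball hz) hwR
    · refine le_max_of_le_right ?_
      rw [mem_closedBall, not_le] at hwR
      rw [mem_ball] at hz
      have h1 : r ≤ ‖w - z‖ := by
        rw [← dist_eq_norm]
        linarith [dist_triangle w z z₀]
      have hne : w ≠ z := by
        rintro rfl
        rw [sub_self, norm_zero] at h1
        linarith
      rw [dslope_of_ne _ hne, slope_def_field, norm_div]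
      have h2 : ‖f w - f z‖ ≤ 2 * M := by
        have := norm_sub_le (f w) (f z)
        have := hM w (Or.inr hw)
        have := hM z (Or.inl (hball hz))
        linarith
      exact div_le_div₀ (by positivity) h2 hr0 h1
  refine (hasDerivAt_integral_of_bounded (z₀ := z₀) (r := r) (B := D * max L (2 * M / r))
    (F := fun z u => deriv γ u * dslope f z (γ u)) hr0 ?_ ?_ ?_).differentiableAt
  · intro u hu
    refine DifferentiableOn.const_mul ?_ _
    have hw : γ u ∈ U := hsub (mem_image_of_mem _ hu)
    simp only [dslope_comm f _ (γ u)]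
    exact ((Complex.differentiableOn_dslope (hU.mem_nhds hw)).2 hf).mono (hball.trans hRU)
  · intro z hz u hu
    rw [norm_mul]
    exact mul_le_mul (hD u hu) (hbound z hz _ (mem_image_of_mem _ hu)) (norm_nonneg _) hD0
  · intro z hz
    refine (continuous_deriv_path hγ).continuousOn.mul ?_
    have hz : z ∈ U := hRU (hball hz)
    have : ContinuousOn (dslope f z) U :=
      ((Complex.differentiableOn_dslope (hU.mem_nhds hz)).2 hf).continuousOn
    exact this.comp hγ.continuous.continuousOn fun u hu => hsub (mem_image_of_mem _ hu)

theorem tendsto_pathIntegral_inv (hγ : ContDiff ℝ 1 γ) {φ : ℂ → ℂ} (hφ : ContinuousOn φ (γ '' Icc 0 1)) :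
    Tendsto (fun z => pathIntegral γ fun w => φ w * (w - z)⁻¹) (cocompact ℂ) (𝓝 0) := by
  obtain ⟨D, hD0, hD⟩ := exists_norm_deriv_path_le hγ
  obtain ⟨B, hB⟩ := (isCompact_path hγ).exists_bound_of_continuousOn hφ
  obtain ⟨R, hR⟩ := (isCompact_path hγ).isBounded.exists_norm_le
  have hB0 : 0 ≤ B := (norm_nonneg _).trans
    (hB _ (mem_image_of_mem _ (left_mem_Icc.2 zero_le_one)))
  have h1 : Tendsto (fun z : ℂ => ‖z‖ - R) (cocompact ℂ) atTop :=
    tendsto_atTop_add_const_right _ _ (tendsto_norm_cocompact_atTop (E := ℂ))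
  have h2 : Tendsto (fun z : ℂ => D * (B * (‖z‖ - R)⁻¹)) (cocompact ℂ) (𝓝 0) := by
    simpa using ((tendsto_inv_atTop_zero.comp h1).const_mul B).const_mul D
  refine squeeze_zero_norm' ?_ h2
  filter_upwards [h1.eventually_gt_atTop 0] with z hz
  have := intervalIntegral.norm_integral_le_of_norm_le_const (a := (0 : ℝ)) (b := 1)
    (C := D * (B * (‖z‖ - R)⁻¹)) (f := fun u => deriv γ u * (φ (γ u) * (γ u - z)⁻¹)) ?_
  · simpa [pathIntegral] using this
  · intro u hu
    have hu' : u ∈ Icc (0 : ℝ) 1 := by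
      rw [Set.uIoc_of_le zero_le_one] at hu
      exact Ioc_subset_Icc_self hu
    have hw : γ u ∈ γ '' Icc 0 1 := mem_image_of_mem _ hu'
    rw [norm_mul, norm_mul, norm_inv]
    have h3 : ‖z‖ - R ≤ ‖γ u - z‖ := by
      have := hR _ hw
      have := norm_sub_norm_le z (γ u)
      rw [norm_sub_rev] at this
      linarith
    exact mul_le_mul (hD u hu') (mul_le_mul (hB _ hw) (inv_anti₀ hz h3) (by positivity) hB0)
      (by positivity) hD0

/-- Curves do not wind about points far away. -/
theorem eventually_pathIntegral_inv_eq_zero (hγ : ContDiff ℝ 1 γ) (hcl : γ 0 = γ 1) :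
    ∀ᶠ z in cocompact ℂ, pathIntegral γ (fun w => (w - z)⁻¹) = 0 := by
  obtain ⟨R, hR⟩ := (isCompact_path hγ).isBounded.exists_norm_le
  filter_upwards [(tendsto_norm_cocompact_atTop (E := ℂ)).eventually_gt_atTop (R + 1)] with z hz
  have hne : ∀ w ∈ ball (0 : ℂ) (R + 1), w - z ≠ 0 := by
    intro w hw h
    rw [mem_ball_zero_iff, sub_eq_zero.1 h] at hw
    linarith
  have hd : DifferentiableOn ℂ (fun w => (w - z)⁻¹) (ball (0 : ℂ) (R + 1)) :=
    (differentiableOn_id.sub (differentiableOn_const z)).inv hne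
  have hsub : γ '' Icc 0 1 ⊆ ball (0 : ℂ) (R + 1) := fun w hw => by
    rw [mem_ball_zero_iff]
    linarith [hR w hw]
  obtain ⟨F, hF⟩ := hd.isExactOn_ball
  exact pathIntegral_eq_zero_of_hasDerivAt hγ hcl (hd.continuousOn.mono hsub) fun w hw =>
    hF w (hsub hw)

end Path

/-! ### Chains of closed curves: Dixon's argument -/

section Chain

variable {κ : Type*} [Fintype κ] {γ : κ → ℝ → ℂ}

/-- **Cauchy's theorem**, homology form (Dixon's proof): a chain of closed curves in an open set
that does not wind about any point outside the set annihilates holomorphic functions. -/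
theorem sum_pathIntegral_eq_zero (hγ : ∀ a, ContDiff ℝ 1 (γ a)) (hcl : ∀ a, γ a 0 = γ a 1)
    (c : κ → ℂ) {U : Set ℂ} (hU : IsOpen U) (hsub : ∀ a, γ a '' Icc 0 1 ⊆ U)
    (hw : ∀ p ∉ U, ∑ a, c a * pathIntegral (γ a) (fun w => (w - p)⁻¹) = 0) {f : ℂ → ℂ}
    (hf : DifferentiableOn ℂ f U) : ∑ a, c a * pathIntegral (γ a) f = 0 := by
  classical
  rcases isEmpty_or_nonempty κ with hκ | ⟨⟨a₀⟩⟩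
  · simp
  set T : Set ℂ := ⋃ a, γ a '' Icc 0 1 with hT
  have hTc : IsCompact T := isCompact_iUnion fun a => isCompact_path (hγ a)
  have hTn : ∀ z ∉ T, ∀ a, z ∉ γ a '' Icc 0 1 := fun z hz a h => hz (mem_iUnion_of_mem a h)
  set W : ℂ → ℂ := fun z => ∑ a, c a * pathIntegral (γ a) (fun w => (w - z)⁻¹) with hWdef
  have hWd : ∀ z ∉ T, HasDerivAt W 0 z := by
    intro z hz
    have h1 : ∀ a, HasDerivAt (fun z => pathIntegral (γ a) fun w => (w - z)⁻¹) 0 z := by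
      intro a
      have := hasDerivAt_pathIntegral_inv (hγ a) (φ := fun _ => 1) continuousOn_const (hTn z hz a)
      simp only [one_mul] at this
      rwa [pathIntegral_eq_zero_of_hasDerivAt (hγ a) (hcl a) (F := fun w => -(w - z)⁻¹)] at this
      · refine ContinuousOn.inv₀ (by fun_prop) fun w hw => ?_
        exact pow_ne_zero 2 (sub_ne_zero.2 fun h => hTn z hz a (h ▸ hw))
      · intro w hw
        have h2 := (((hasDerivAt_id w).sub_const z).fun_inv
          (sub_ne_zero.2 fun h => hTn z hz a (h ▸ hw))).fun_neg
        rw [neg_div, neg_neg, one_div] at h2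
        exact h2
    simpa using HasDerivAt.fun_sum fun a (_ : a ∈ Finset.univ) => (h1 a).const_mul (c a)
  -- Local constancy of the winding number: its vanishing at a point outside `U` extends to a
  -- neighbourhood, where the two definitions of `H` below can be glued.
  have hWloc : ∀ z ∉ T, ∀ᶠ z' in 𝓝 z, W z' = W z := by
    intro z hz
    obtain ⟨r, hr, hrs⟩ := nhds_basis_ball.mem_iff.1 (hTc.isClosed.isOpen_compl.mem_nhds hz)
    filter_upwards [ball_mem_nhds z hr] with z' hz'
    exact (convex_ball z r).is_const_of_fderivWithin_eq_zero (𝕜 := ℂ) (f := W)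
      (fun y hy => (hWd y (hrs hy)).differentiableAt.differentiableWithinAt)
      (fun y hy => by
        rw [fderivWithin_of_isOpen isOpen_ball hy]
        ext
        simp [(hWd y (hrs hy)).deriv]) hz' (mem_ball_self hr)
  -- `H` is entire: on `U` it integrates the divided difference, off `U` it is the Cauchy transform
  -- of `g`, and both agree off the curves wherever the winding number vanishes. It tends to `0` at
  -- infinity, so Liouville's theorem gives `H = 0`.
  have main : ∀ g : ℂ → ℂ, DifferentiableOn ℂ g U → ∀ z ∈ U,
      ∑ a, c a * pathIntegral (γ a) (dslope g z) = 0 := by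
    intro g hg
    have hgT : ∀ a, ContinuousOn g (γ a '' Icc 0 1) := fun a => hg.continuousOn.mono (hsub a)
    set G : ℂ → ℂ := fun z => ∑ a, c a * pathIntegral (γ a) (fun w => g w * (w - z)⁻¹) with hG
    set H : ℂ → ℂ := fun z => if z ∈ U then ∑ a, c a * pathIntegral (γ a) (dslope g z) else G z
      with hH
    have hHU : ∀ z ∈ U, H z = ∑ a, c a * pathIntegral (γ a) (dslope g z) := fun z hz => if_pos hz
    have hHG : ∀ z ∉ T, W z = 0 → H z = G z := by
      intro z hz hWz
      by_cases hzU : z ∈ U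
      · have h1 : ∀ a, pathIntegral (γ a) (dslope g z)
            = pathIntegral (γ a) (fun w => g w * (w - z)⁻¹)
              - g z * pathIntegral (γ a) (fun w => (w - z)⁻¹) := by
          intro a
          have hinv : ContinuousOn (fun w => (w - z)⁻¹) (γ a '' Icc 0 1) :=
            ContinuousOn.inv₀ (by fun_prop) fun w hw => sub_ne_zero.2 fun h => hTn z hz a (h ▸ hw)
          rw [pathIntegral, pathIntegral, pathIntegral, ← intervalIntegral.integral_const_mul,
            ← intervalIntegral.integral_sub (intervalIntegrable_path (hγ a) ((hgT a).fun_mul hinv))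
              ((intervalIntegrable_path (hγ a) hinv).const_mul _)]
          refine intervalIntegral.integral_congr fun u hu => ?_
          rw [Set.uIcc_of_le zero_le_one] at hu
          have hne : γ a u ≠ z := fun h => hTn z hz a (h ▸ mem_image_of_mem _ hu)
          rw [dslope_of_ne _ hne, slope_def_field]
          ring
        rw [hHU z hzU, Finset.sum_congr rfl fun a _ => by rw [h1 a, mul_sub],
          Finset.sum_sub_distrib]
        have h2 : ∑ a, c a * (g z * pathIntegral (γ a) fun w => (w - z)⁻¹) = g z * W z := by
          rw [hWdef, Finset.mul_sum]
          exact Finset.sum_congr rfl fun a _ => by ring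
        rw [h2, hWz, mul_zero, sub_zero]
      · exact if_neg hzU
    have hHd : Differentiable ℂ H := by
      intro z
      by_cases hzU : z ∈ U
      · have h1 : DifferentiableAt ℂ (fun z => ∑ a, c a * pathIntegral (γ a) (dslope g z)) z :=
          DifferentiableAt.fun_sum fun a _ =>
            (differentiableAt_pathIntegral_dslope (hγ a) hU hg (hsub a) hzU).const_mul _
        refine h1.congr_of_eventuallyEq ?_
        filter_upwards [hU.mem_nhds hzU] with z' hz' using hHU z' hz'
      · have hzT : z ∉ T := fun h => hzU (iUnion_subset hsub h)
        have h1 : DifferentiableAt ℂ G z := DifferentiableAt.fun_sum fun a _ =>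
          (hasDerivAt_pathIntegral_inv (hγ a) (hgT a) (hTn z hzT a)).differentiableAt.const_mul _
        refine h1.congr_of_eventuallyEq ?_
        filter_upwards [hWloc z hzT, hTc.isClosed.isOpen_compl.mem_nhds hzT] with z' hz' hzT'
        exact hHG z' hzT' (hz'.trans (hw z hzU))
    have hHt : Tendsto H (cocompact ℂ) (𝓝 0) := by
      have h1 : Tendsto G (cocompact ℂ) (𝓝 0) := by
        simpa using tendsto_finsetSum Finset.univ fun a _ =>
          (tendsto_pathIntegral_inv (hγ a) (hgT a)).const_mul (c a)
      refine h1.congr' ?_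
      have h2 : ∀ᶠ z in cocompact ℂ, ∀ a, pathIntegral (γ a) (fun w => (w - z)⁻¹) = 0 :=
        eventually_all.2 fun a => eventually_pathIntegral_inv_eq_zero (hγ a) (hcl a)
      filter_upwards [h2, hTc.compl_mem_cocompact] with z hz hzT
      refine (hHG z hzT ?_).symm
      simp [hWdef, hz]
    intro z hz
    rw [← hHU z hz]
    exact hHd.apply_eq_of_tendsto_cocompact z hHt
  obtain ⟨z₀, hz₀⟩ : U.Nonempty := ⟨γ a₀ 0, hsub a₀ (mem_image_of_mem _ (by simp))⟩
  -- The divided difference of `(w - z₀) f(w)` at `z₀` is `f` itself.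
  have h := main (fun w => (w - z₀) * f w)
    ((differentiableOn_id.sub (differentiableOn_const z₀)).mul hf) z₀ hz₀
  have h1 : dslope (fun w => (w - z₀) * f w) z₀ = f := by
    funext w
    rcases eq_or_ne w z₀ with rfl | hne
    · have h2 := ((hasDerivAt_id w).sub_const w).fun_mul
        (hf.differentiableAt (hU.mem_nhds hz₀)).hasDerivAt
      rw [dslope_same]
      refine h2.deriv.trans ?_
      simp
    · rw [dslope_of_ne _ hne, slope_def_field]
      have := sub_ne_zero.2 hne
      field_simp
      simp
  rwa [h1] at h

end Chain

/-- The integral of a function over a cycle. -/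
def Cycle.integral (c : Cycle) (f : ℂ → ℂ) : ℂ := ∑ a, pathIntegral (c.path a) f

theorem Cycle.wind_eq (c : Cycle) (p : ℂ) :
    c.wind p = (2 * Real.pi * Complex.I)⁻¹ * c.integral fun w => (w - p)⁻¹ := rfl

theorem Cycle.trace_eq (c : Cycle) : c.trace = ⋃ a, c.path a '' Icc 0 1 := by
  ext x
  simp [Cycle.trace]

/-- Cycles that wind equally often about the points outside an open set give the same integrals
of functions that are holomorphic on the set. -/
theorem Cycle.integral_eq_of_wind_eq {c d : Cycle} {U : Set ℂ} (hU : IsOpen U) (hc : c.trace ⊆ U)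
    (hd : d.trace ⊆ U) (hw : ∀ p ∉ U, c.wind p = d.wind p) {f : ℂ → ℂ}
    (hf : DifferentiableOn ℂ f U) : c.integral f = d.integral f := by
  have key := sum_pathIntegral_eq_zero (γ := Sum.elim c.path d.path)
    (by rintro (a | a); exacts [c.contDiff a, d.contDiff a])
    (by rintro (a | a); exacts [c.closed a, d.closed a])
    (Sum.elim (fun _ => 1) fun _ => -1) hU
    (by
      rw [Cycle.trace_eq] at hc hd
      rintro (a | a)
      exacts [(subset_iUnion _ a).trans hc, (subset_iUnion _ a).trans hd])
    (fun p hp => by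
      have h := hw p hp
      rw [Cycle.wind_eq, Cycle.wind_eq] at h
      have h1 := mul_left_cancel₀ (inv_ne_zero Complex.two_pi_I_ne_zero) h
      simp only [Cycle.integral] at h1
      simp [h1]) hf
  simp only [Fintype.sum_sum_type, Sum.elim_inl, Sum.elim_inr, one_mul, neg_mul,
    Finset.sum_neg_distrib] at key
  exact add_neg_eq_zero.1 key

/-- The dilation of a cycle. -/
def Cycle.dilate (r : ℂ) (c : Cycle) : Cycle where
  card := c.card
  path a u := r * c.path a u
  contDiff a := contDiff_const.mul (c.contDiff a)
  closed a := by rw [c.closed a]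

theorem Cycle.integral_dilate (r : ℂ) (c : Cycle) (f : ℂ → ℂ) :
    (c.dilate r).integral f = r * c.integral fun w => f (r * w) := by
  simp only [Cycle.integral, pathIntegral, Finset.mul_sum]
  refine Finset.sum_congr rfl fun a _ => ?_
  rw [← intervalIntegral.integral_const_mul]
  refine intervalIntegral.integral_congr fun u _ => ?_
  have : deriv ((c.dilate r).path a) u = r * deriv (c.path a) u :=
    deriv_const_mul _ ((c.contDiff a).differentiable one_ne_zero u)
  simp only [this]
  rw [mul_assoc]
  rfl

theorem Cycle.wind_dilate {r : ℂ} (hr : r ≠ 0) (c : Cycle) (p : ℂ) :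
    (c.dilate r).wind p = c.wind (p / r) := by
  rw [Cycle.wind_eq, Cycle.wind_eq, Cycle.integral_dilate]
  congr 1
  simp only [Cycle.integral, pathIntegral, Finset.mul_sum]
  refine Finset.sum_congr rfl fun a _ => ?_
  rw [← intervalIntegral.integral_const_mul]
  refine intervalIntegral.integral_congr fun u _ => ?_
  change r * (deriv (c.path a) u * (r * c.path a u - p)⁻¹) = _
  rw [show r * c.path a u - p = r * (c.path a u - p / r) by field_simp, mul_inv]
  field_simp

theorem Cycle.trace_dilate (r : ℂ) (c : Cycle) : (c.dilate r).trace = (r * ·) '' c.trace := by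
  ext x
  constructor
  · rintro ⟨a, u, hu, rfl⟩
    exact ⟨c.path a u, ⟨a, u, hu, rfl⟩, rfl⟩
  · rintro ⟨_, ⟨a, u, hu, rfl⟩, rfl⟩
    exact ⟨a, u, hu, rfl⟩

end

section

/-! ### The `q`-Pochhammer symbol and the Vandermonde factor -/

section QPoch

variable {q : ℂ}

theorem differentiable_qPoch (hq : ‖q‖ < 1) : Differentiable ℂ fun z => qPoch z q := by
  intro z
  have hu : Summable fun n : ℕ => ‖q‖ ^ n * (‖z‖ + 1) :=
    (summable_geometric_of_lt_one (norm_nonneg _) hq).mul_right _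
  have h := Summable.hasProdLocallyUniformlyOn_nat_one_add (f := fun (n : ℕ) (z : ℂ) => -(q ^ n * z))
    (K := Metric.ball (0 : ℂ) (‖z‖ + 1)) Metric.isOpen_ball hu
    (Filter.Eventually.of_forall fun n x hx => by
      rw [norm_neg, norm_mul, norm_pow]
      rw [mem_ball_zero_iff] at hx
      exact mul_le_mul_of_nonneg_left hx.le (by positivity)) (fun n => by fun_prop)
  have hd := h.differentiableOn (.of_forall fun _ => by
    simpa [Finset.prod_fn] using DifferentiableOn.finsetProd (fun _ _ => by fun_prop))
    Metric.isOpen_ball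
  simp only [← sub_eq_add_neg] at hd
  exact hd.differentiableAt (Metric.isOpen_ball.mem_nhds (by simp))

theorem summable_norm_qPoch (hq : ‖q‖ < 1) (z : ℂ) : Summable fun n : ℕ => ‖-(q ^ n * z)‖ := by
  simpa only [norm_neg, norm_mul, norm_pow] using
    (summable_geometric_of_lt_one (norm_nonneg _) hq).mul_right ‖z‖

theorem qPoch_eq_mul (hq : ‖q‖ < 1) (z : ℂ) : qPoch z q = (1 - z) * qPoch (q * z) q := by
  have h : ∀ z : ℂ, Multipliable fun n : ℕ => 1 - q ^ n * z := fun z => by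
    simpa only [← sub_eq_add_neg] using multipliable_one_add_of_summable (summable_norm_qPoch hq z)
  rw [qPoch, qPoch, tprod_eq_zero_mul' (f := fun n : ℕ => 1 - q ^ n * z)]
  · simp only [pow_zero, one_mul, pow_succ, mul_assoc]
  · simpa only [pow_succ, mul_assoc] using h (q * z)

theorem qPoch_ne_zero (hq : ‖q‖ < 1) {z : ℂ} (hz : ∀ n : ℕ, q ^ n * z ≠ 1) : qPoch z q ≠ 0 := by
  have := tprod_one_add_ne_zero_of_summable (f := fun n : ℕ => -(q ^ n * z))
    (fun n => by
      rw [← sub_eq_add_neg]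
      exact sub_ne_zero.2 (hz n).symm) (summable_norm_qPoch hq z)
  simpa only [qPoch, ← sub_eq_add_neg] using this

theorem qPoch_one (hq : ‖q‖ < 1) : qPoch 1 q = 0 := by
  rw [qPoch_eq_mul hq, sub_self, zero_mul]

variable {t : ℂ}

/-- The contribution of a pair of variables to `Δ_{q,t}`. -/
def pairFactor (q t y a : ℂ) : ℂ :=
  qPoch (y / a) q / qPoch (t * (y / a)) q * (qPoch (a / y) q / qPoch (t * (a / y)) q)

/-- The function `pairFactor q t y a * ((τ⁻¹ y - a) / (y - a))` with the pole at `y = a`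
removed. -/
def regFactor (q t τ y a : ℂ) : ℂ :=
  -(τ⁻¹ * y - a) / a * (qPoch (q * (y / a)) q / qPoch (t * (y / a)) q)
    * (qPoch (a / y) q / qPoch (t * (a / y)) q)

/-- The zero of `(y/a; q)_∞` at `y = a` cancels the pole. The other numerator vanishes there too, so
the right side is still `0` at `y = a`, in agreement with division by zero on the left. -/
theorem pairFactor_mul (hq : ‖q‖ < 1) (t τ : ℂ) {y a : ℂ} (hy : y ≠ 0) (ha : a ≠ 0) :
    pairFactor q t y a * ((τ⁻¹ * y - a) / (y - a)) = regFactor q t τ y a := by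
  rcases eq_or_ne y a with rfl | hne
  · rw [regFactor, div_self hy, qPoch_one hq]
    simp
  · rw [pairFactor, regFactor, qPoch_eq_mul hq (y / a)]
    have h1 : y - a ≠ 0 := sub_ne_zero.2 hne
    have h2 : (1 - y / a) * ((τ⁻¹ * y - a) / (y - a)) = -(τ⁻¹ * y - a) / a := by
      field_simp
      ring
    rw [← h2]
    ring

/-- The poles of the pair factor are avoided. -/
def PairRegular (q t y a : ℂ) : Prop :=
  y ≠ 0 ∧ a ≠ 0 ∧ (∀ n : ℕ, t * q ^ n * y ≠ a) ∧ ∀ n : ℕ, t * q ^ n * a ≠ y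

theorem PairRegular.qPoch_ne_zero (hq : ‖q‖ < 1) {y a : ℂ} (h : PairRegular q t y a) :
    qPoch (t * (y / a)) q ≠ 0 ∧ qPoch (t * (a / y)) q ≠ 0 := by
  obtain ⟨hy, ha, h1, h2⟩ := h
  constructor
  · refine QTMatrixModel.qPoch_ne_zero hq fun n hn => h1 n ?_
    field_simp at hn
    linear_combination hn
  · refine QTMatrixModel.qPoch_ne_zero hq fun n hn => h2 n ?_
    field_simp at hn
    linear_combination hn

/-- The condition `q^n t ≠ 1` keeps the pair factor free of poles at coinciding variables. -/
theorem pairRegular_self (hqt : ∀ n : ℕ, q ^ n * t ≠ 1) {y : ℂ} (hy : y ≠ 0) :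
    PairRegular q t y y := by
  have : ∀ n : ℕ, t * q ^ n * y ≠ y := fun n h => hqt n (by
    have := mul_right_cancel₀ hy (h.trans (one_mul y).symm)
    rwa [mul_comm] at this)
  exact ⟨hy, hy, this, this⟩

theorem analyticAt_regFactor (hq : ‖q‖ < 1) (τ : ℂ) {y a : ℂ} (h : PairRegular q t y a) :
    AnalyticAt ℂ (fun y => regFactor q t τ y a) y := by
  have hP : ∀ z, AnalyticAt ℂ (fun z => qPoch z q) z := fun z =>
    (differentiable_qPoch hq).analyticAt z
  obtain ⟨h1, h2⟩ := h.qPoch_ne_zero hq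
  obtain ⟨hy, ha, -⟩ := h
  have e1 : AnalyticAt ℂ (fun y : ℂ => y / a) y := analyticAt_id.div analyticAt_const ha
  have e2 : AnalyticAt ℂ (fun y : ℂ => a / y) y := analyticAt_const.div analyticAt_id hy
  have c1 : AnalyticAt ℂ (fun y : ℂ => qPoch (q * (y / a)) q) y :=
    (hP _).fun_comp (analyticAt_const.mul e1)
  have c2 : AnalyticAt ℂ (fun y : ℂ => qPoch (t * (y / a)) q) y :=
    (hP _).fun_comp (analyticAt_const.mul e1)
  have c3 : AnalyticAt ℂ (fun y : ℂ => qPoch (a / y) q) y := (hP _).fun_comp e2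
  have c4 : AnalyticAt ℂ (fun y : ℂ => qPoch (t * (a / y)) q) y :=
    (hP _).fun_comp (analyticAt_const.mul e2)
  have c5 : AnalyticAt ℂ (fun y : ℂ => -(τ⁻¹ * y - a) / a) y :=
    (((analyticAt_const.mul analyticAt_id).sub analyticAt_const).neg).div analyticAt_const ha
  exact (c5.mul (c1.div c2 h1)).mul (c3.div c4 h2)

/-- The effect of a dilation on the pair factor. -/
theorem pairFactor_dilate (hq : ‖q‖ < 1) (hq0 : q ≠ 0) (ht : t ≠ 0) {y a : ℂ} (hy : y ≠ 0)
    (ha : a ≠ 0) (h1 : y ≠ a) (h2 : t * y ≠ a) (h3 : q * y ≠ a) (h4 : q * y ≠ t * a) :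
    pairFactor q t (q * y) a * ((t⁻¹ * (q * y) - a) / (q * y - a))
      = t⁻¹ * (pairFactor q t y a * ((t * y - a) / (y - a))) := by
  -- Each of the four Pochhammer symbols changes by one linear factor; the hypotheses `h1` to `h4`
  -- say that these factors are nonzero.
  have e1 := qPoch_eq_mul hq (y / a)
  have e2 := qPoch_eq_mul hq (t * (y / a))
  have e3 := qPoch_eq_mul hq (a / (q * y))
  have e4 := qPoch_eq_mul hq (t * (a / (q * y)))
  rw [show q * (y / a) = q * y / a by ring] at e1
  rw [show q * (t * (y / a)) = t * (q * y / a) by ring] at e2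
  rw [show q * (a / (q * y)) = a / y by field_simp] at e3
  rw [show q * (t * (a / (q * y))) = t * (a / y) by field_simp] at e4
  rw [pairFactor, pairFactor, e1, e2, e3, e4]
  have g1 : y - a ≠ 0 := sub_ne_zero.2 h1
  have g2 : t * y - a ≠ 0 := sub_ne_zero.2 h2
  have g3 : q * y - a ≠ 0 := sub_ne_zero.2 h3
  have g4 : q * y - t * a ≠ 0 := sub_ne_zero.2 h4
  have k1 : 1 - y / a = -(y - a) / a := by field_simp; ring
  have k2 : 1 - t * (y / a) = -(t * y - a) / a := by field_simp; ring
  have k3 : 1 - a / (q * y) = (q * y - a) / (q * y) := by field_simp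
  have k4 : 1 - t * (a / (q * y)) = (q * y - t * a) / (q * y) := by field_simp
  have k5 : t⁻¹ * (q * y) - a = t⁻¹ * (q * y - t * a) := by field_simp
  rw [k1, k2, k3, k4, k5]
  generalize qPoch (q * y / a) q = A
  generalize qPoch (t * (q * y / a)) q = B
  generalize qPoch (a / y) q = D
  generalize qPoch (t * (a / y)) q = E
  have m1 : -(y - a) / a * A / (-(t * y - a) / a * B) = (y - a) / (t * y - a) * (A / B) := by
    rw [mul_div_mul_comm, div_div_div_cancel_right₀ ha, neg_div_neg_eq]
  have m2 : (q * y - a) / (q * y) * D / ((q * y - t * a) / (q * y) * E)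
      = (q * y - a) / (q * y - t * a) * (D / E) := by
    rw [mul_div_mul_comm, div_div_div_cancel_right₀ (mul_ne_zero hq0 hy)]
  rw [m1, m2]
  generalize A / B = R
  generalize D / E = S
  generalize y - a = u at *
  generalize t * y - a = v at *
  generalize q * y - a = w at *
  generalize q * y - t * a = r at *
  field_simp

end QPoch

section Vandermonde

variable {q t : ℂ} {N : ℕ}

/-- The factors of `Δ_{q,t}` that do not contain `x_i`. -/
def restFactor (q t : ℂ) (i : Fin N) (x : Fin N → ℂ) : ℂ :=
  ∏ k ∈ Finset.univ.erase i, ∏ j ∈ (Finset.univ.erase k).erase i,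
    qPoch (x k / x j) q / qPoch (t * (x k / x j)) q

theorem vandermonde_eq (i : Fin N) (x : Fin N → ℂ) : vandermonde q t x
    = (∏ j ∈ Finset.univ.erase i, pairFactor q t (x i) (x j)) * restFactor q t i x := by
  rw [vandermonde, ← Finset.mul_prod_erase _ _ (Finset.mem_univ i), restFactor]
  have h : ∀ k ∈ Finset.univ.erase i, ∏ j ∈ Finset.univ.erase k,
      qPoch (x k / x j) q / qPoch (t * (x k / x j)) q
      = qPoch (x k / x i) q / qPoch (t * (x k / x i)) q
        * ∏ j ∈ (Finset.univ.erase k).erase i,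
          qPoch (x k / x j) q / qPoch (t * (x k / x j)) q := by
    intro k hk
    rw [Finset.mul_prod_erase _ (fun j => qPoch (x k / x j) q / qPoch (t * (x k / x j)) q)]
    exact Finset.mem_erase.2 ⟨(Finset.ne_of_mem_erase hk).symm, Finset.mem_univ i⟩
  rw [Finset.prod_congr rfl h, Finset.prod_mul_distrib, ← mul_assoc, ← Finset.prod_mul_distrib]
  rfl

theorem restFactor_update (i : Fin N) (x : Fin N → ℂ) (y : ℂ) :
    restFactor q t i (Function.update x i y) = restFactor q t i x := by
  refine Finset.prod_congr rfl fun k hk => Finset.prod_congr rfl fun j hj => ?_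
  rw [Function.update_of_ne (Finset.ne_of_mem_erase hk),
    Function.update_of_ne (Finset.ne_of_mem_erase hj)]

theorem vandermonde_eq_zero (hq : ‖q‖ < 1) {x : Fin N → ℂ} {i j : Fin N} (hij : i ≠ j)
    (h : x i = x j) (h0 : x i ≠ 0) : vandermonde q t x = 0 := by
  rw [vandermonde]
  refine Finset.prod_eq_zero (Finset.mem_univ i)
    (Finset.prod_eq_zero (Finset.mem_erase.2 ⟨hij.symm, Finset.mem_univ j⟩) ?_)
  rw [← h, div_self h0, qPoch_one hq, zero_div]

theorem vandermonde_mul_wardFactor (hq : ‖q‖ < 1) (τ : ℂ) (i : Fin N) {x : Fin N → ℂ}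
    (hx : ∀ j, x j ≠ 0) : wardFactor τ i x * vandermonde q t x
    = (∏ j ∈ Finset.univ.erase i, regFactor q t τ (x i) (x j)) * restFactor q t i x := by
  rw [vandermonde_eq i, wardFactor, ← mul_assoc, ← Finset.prod_mul_distrib]
  congr 1
  refine Finset.prod_congr rfl fun j _ => ?_
  rw [mul_comm, pairFactor_mul hq t τ (hx i) (hx j)]

end Vandermonde

end

section

/-! ### The Ward identity in one variable -/

open Filter

theorem not_isSing_of_analyticAt {f g : ℂ → ℂ} {p : ℂ} (hg : AnalyticAt ℂ g p)
    (h : f =ᶠ[𝓝[≠] p] g) : ¬ IsSing f p := fun hs => hs ⟨g, hg, h⟩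

/-- A function extends holomorphically over its removable singularities. -/
theorem exists_extension (f : ℂ → ℂ) : IsOpen {p | ¬ IsSing f p} ∧ ∃ F : ℂ → ℂ,
    DifferentiableOn ℂ F {p | ¬ IsSing f p} ∧
    ∀ (p : ℂ) (g : ℂ → ℂ), AnalyticAt ℂ g p → f =ᶠ[𝓝[≠] p] g → F p = g p := by
  have hlim : ∀ (p : ℂ) (g : ℂ → ℂ), AnalyticAt ℂ g p → f =ᶠ[𝓝[≠] p] g →
      limUnder (𝓝[≠] p) f = g p := fun p g hg h =>
    ((hg.continuousAt.tendsto.mono_left nhdsWithin_le_nhds).congr' h.symm).limUnder_eq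
  -- An analytic germ that agrees with `f` near `p` also serves all points close to `p`. This gives
  -- openness, and identifies the punctured limit with the germ on a full neighbourhood.
  have hnear : ∀ (p : ℂ) (g : ℂ → ℂ), AnalyticAt ℂ g p → f =ᶠ[𝓝[≠] p] g →
      ∀ᶠ p' in 𝓝 p, AnalyticAt ℂ g p' ∧ f =ᶠ[𝓝[≠] p'] g := by
    intro p g hg h
    have h1 : ∀ᶠ p' in 𝓝 p, ∀ᶠ y in 𝓝[≠] p', y ≠ p → f y = g y := by
      have h2 := eventually_eventually_nhds.2 (eventually_nhdsWithin_iff.1 h)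
      filter_upwards [h2] with p' hp'
      exact hp'.filter_mono nhdsWithin_le_nhds
    filter_upwards [h1, hg.eventually_analyticAt] with p' hp' hgp'
    refine ⟨hgp', ?_⟩
    rcases eq_or_ne p' p with rfl | hne
    · exact h
    · filter_upwards [hp', (isOpen_ne.mem_nhds hne : {y | y ≠ p} ∈ 𝓝 p') |> mem_nhdsWithin_of_mem_nhds]
        with y hy hyp using hy hyp
  refine ⟨isOpen_iff_mem_nhds.2 fun p hp => ?_, fun p => limUnder (𝓝[≠] p) f, fun p hp => ?_, hlim⟩
  · obtain ⟨g, hg, h⟩ := not_not.1 hp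
    filter_upwards [hnear p g hg h] with p' hp' using not_isSing_of_analyticAt hp'.1 hp'.2
  · obtain ⟨g, hg, h⟩ := not_not.1 hp
    refine DifferentiableAt.differentiableWithinAt ?_
    refine hg.differentiableAt.congr_of_eventuallyEq ?_
    filter_upwards [hnear p g hg h] with p' hp' using hlim p' g hp'.1 hp'.2

section Ward

variable {q t lq lt : ℂ} {lg w : ℂ → ℂ} {N : ℕ}

/-- The integrand of a Ward identity as a function of the variable `x_i`. -/
def wardTerm (q t lq lt : ℂ) (lg w : ℂ → ℂ) (τ : ℂ) (R : ℂ → ℂ) (i : Fin N) (x : Fin N → ℂ)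
    (y : ℂ) : ℂ :=
  R y * wardFactor τ i (Function.update x i y)
    * integrand q t lq lt lg w (Function.update x i y)

/-- The pole-free conditions on a point of the contour of `x_i`. -/
def Regular (q t lq lt : ℂ) (lg w : ℂ → ℂ) (i : Fin N) (x : Fin N → ℂ) (y : ℂ) : Prop :=
  y ≠ 0 ∧ AnalyticAt ℂ (oneBody N lq lt lg w) y ∧ ∀ j, j ≠ i → PairRegular q t y (x j)

theorem wardFactor_update (τ : ℂ) (i : Fin N) (x : Fin N → ℂ) (y : ℂ) :
    wardFactor τ i (Function.update x i y)
      = ∏ j ∈ Finset.univ.erase i, (τ⁻¹ * y - x j) / (y - x j) := by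
  refine Finset.prod_congr rfl fun j hj => ?_
  rw [Function.update_self, Function.update_of_ne (Finset.ne_of_mem_erase hj)]

theorem prod_oneBody_update (i : Fin N) (x : Fin N → ℂ) (y : ℂ) :
    ∏ j, oneBody N lq lt lg w (Function.update x i y j)
      = oneBody N lq lt lg w y * ∏ j ∈ Finset.univ.erase i, oneBody N lq lt lg w (x j) := by
  rw [← Finset.mul_prod_erase _ _ (Finset.mem_univ i), Function.update_self]
  congr 1
  refine Finset.prod_congr rfl fun j hj => ?_
  rw [Function.update_of_ne (Finset.ne_of_mem_erase hj)]

theorem integrand_update (i : Fin N) (x : Fin N → ℂ) (y : ℂ) :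
    integrand q t lq lt lg w (Function.update x i y)
      = (∏ j ∈ Finset.univ.erase i, pairFactor q t y (x j)) * restFactor q t i x
        * (oneBody N lq lt lg w y * ∏ j ∈ Finset.univ.erase i, oneBody N lq lt lg w (x j)) := by
  rw [integrand, prod_oneBody_update, vandermonde_eq i, restFactor_update]
  congr 2
  refine Finset.prod_congr rfl fun j hj => ?_
  rw [Function.update_self, Function.update_of_ne (Finset.ne_of_mem_erase hj)]

theorem wardTerm_eq (hq : ‖q‖ < 1) (τ : ℂ) (R : ℂ → ℂ) (i : Fin N) {x : Fin N → ℂ}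
    (hx : ∀ j, j ≠ i → x j ≠ 0) {y : ℂ} (hy : y ≠ 0) :
    wardTerm q t lq lt lg w τ R i x y
      = R y * ((∏ j ∈ Finset.univ.erase i, regFactor q t τ y (x j)) * restFactor q t i x
        * (oneBody N lq lt lg w y * ∏ j ∈ Finset.univ.erase i, oneBody N lq lt lg w (x j))) := by
  rw [wardTerm, integrand_update, wardFactor_update, mul_assoc]
  have h : (∏ j ∈ Finset.univ.erase i, (τ⁻¹ * y - x j) / (y - x j))
      * ∏ j ∈ Finset.univ.erase i, pairFactor q t y (x j)
      = ∏ j ∈ Finset.univ.erase i, regFactor q t τ y (x j) := by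
    rw [← Finset.prod_mul_distrib]
    refine Finset.prod_congr rfl fun j hj => ?_
    rw [mul_comm, pairFactor_mul hq t τ hy (hx j (Finset.ne_of_mem_erase hj))]
  rw [← h]
  ring

theorem analyticAt_wardTerm (hq : ‖q‖ < 1) (τ : ℂ) {R : ℂ → ℂ} {i : Fin N} {x : Fin N → ℂ}
    (hx : ∀ j, j ≠ i → x j ≠ 0) {y : ℂ} (hy : Regular q t lq lt lg w i x y)
    (hR : AnalyticAt ℂ R y) : AnalyticAt ℂ (wardTerm q t lq lt lg w τ R i x) y := by
  have h1 : AnalyticAt ℂ (fun y => R y * ((∏ j ∈ Finset.univ.erase i, regFactor q t τ y (x j))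
      * restFactor q t i x
      * (oneBody N lq lt lg w y * ∏ j ∈ Finset.univ.erase i, oneBody N lq lt lg w (x j)))) y := by
    refine hR.mul (((Finset.analyticAt_fun_prod _ fun j hj => ?_).mul analyticAt_const).mul
      (hy.2.1.mul analyticAt_const))
    exact analyticAt_regFactor hq τ (hy.2.2 j (Finset.ne_of_mem_erase hj))
  refine h1.congr ?_
  filter_upwards [isOpen_ne.mem_nhds hy.1] with y' hy'
  exact (wardTerm_eq hq τ R i hx hy').symm

/-- The singularities of the integrand of a Ward identity are singularities of the model. -/
theorem not_isSing_wardTerm (hq : ‖q‖ < 1) (τ : ℂ) {R : ℂ → ℂ} {i : Fin N} {x : Fin N → ℂ}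
    (hx : ∀ j, j ≠ i → Regular q t lq lt lg w i x (x j)) {p : ℂ} (hR : AnalyticAt ℂ R p)
    (hp : ¬ IsSing (fun y => integrand q t lq lt lg w (Function.update x i y)) p) :
    ¬ IsSing (wardTerm q t lq lt lg w τ R i x) p := by
  -- Away from the `x_j` the Ward factor is analytic and can create no singularity. At `p = x_j` its
  -- pole is cancelled by the pair factor, and `x_j` is a regular point for the rest.
  by_cases hpx : ∃ j, j ≠ i ∧ p = x j
  · obtain ⟨j, hji, rfl⟩ := hpx
    exact not_isSing_of_analyticAt (analyticAt_wardTerm hq τ (fun j hj => (hx j hj).1) (hx j hji) hR)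
      (EventuallyEq.refl _ _)
  · push Not at hpx
    obtain ⟨g, hg, h⟩ := not_not.1 hp
    have h1 : AnalyticAt ℂ (fun y => R y
        * (∏ j ∈ Finset.univ.erase i, (τ⁻¹ * y - x j) / (y - x j)) * g y) p := by
      refine (hR.mul (Finset.analyticAt_fun_prod _ fun j hj => ?_)).mul hg
      exact ((analyticAt_const.mul analyticAt_id).sub analyticAt_const).div
        (analyticAt_id.sub analyticAt_const) (sub_ne_zero.2 (hpx j (Finset.ne_of_mem_erase hj)))
    refine not_isSing_of_analyticAt h1 ?_
    filter_upwards [h] with y hy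
    rw [wardTerm, wardFactor_update, hy]

theorem tendsto_mul_nhdsNE (hq0 : q ≠ 0) (p : ℂ) :
    Tendsto (q * ·) (𝓝[≠] p) (𝓝[≠] (q * p)) := by
  refine tendsto_nhdsWithin_iff.2 ⟨?_, ?_⟩
  · exact ((continuous_const_mul q).tendsto p).mono_left nhdsWithin_le_nhds
  · filter_upwards [self_mem_nhdsWithin] with y hy h
    exact hy (mul_left_cancel₀ hq0 h)

theorem eventually_eval_ne_zero {M : Polynomial ℂ} (hM : M ≠ 0) (p : ℂ) :
    ∀ᶠ y in 𝓝[≠] p, M.eval y ≠ 0 := by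
  have h : (↑M.roots.toFinset \ {p} : Set ℂ).Finite := (Finset.finite_toSet _).subset Set.sdiff_subset
  have h1 : (↑M.roots.toFinset \ {p} : Set ℂ)ᶜ ∈ 𝓝 p :=
    h.isClosed.isOpen_compl.mem_nhds fun h => h.2 rfl
  filter_upwards [mem_nhdsWithin_of_mem_nhds h1, self_mem_nhdsWithin] with y hy hyp h0
  exact hy ⟨by simpa [hM] using h0, hyp⟩

theorem eventually_weight {Mp Mm : Polynomial ℂ} (hMp : Mp ≠ 0) (hMm : Mm ≠ 0)
    (hq0 : q ≠ 0) (hw : ∀ z : ℂ, z ≠ 0 →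
      ∀ᶠ y in 𝓝[≠] z, w y / w (q⁻¹ * y) = Mp.eval y / Mm.eval y) {p : ℂ} (hp : p ≠ 0) :
    ∀ᶠ y in 𝓝[≠] p, Mm.eval (q * y) * w (q * y) = Mp.eval (q * y) * w y := by
  refine (tendsto_mul_nhdsNE hq0 p).eventually
    (p := fun z => Mm.eval z * w z = Mp.eval z * w (q⁻¹ * z)) ?_ |>.mono fun y hy => ?_
  · filter_upwards [hw (q * p) (mul_ne_zero hq0 hp), eventually_eval_ne_zero hMp (q * p),
      eventually_eval_ne_zero hMm (q * p)] with z h1 h2 h3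
    -- A zero of the denominator would make the quotient `0` by convention, whereas `M⁺/M⁻` is
    -- nonzero here.
    have h4 : w (q⁻¹ * z) ≠ 0 := by
      intro h0
      rw [h0, div_zero] at h1
      exact div_ne_zero h2 h3 h1.symm
    rw [div_eq_div_iff h4 h3] at h1
    linear_combination h1
  · rwa [inv_mul_cancel_left₀ hq0] at hy

/-- The dilation of a Ward integrand. -/
theorem eventually_wardTerm_dilate (hlq : Complex.exp lq = q) (hlt : Complex.exp lt = t)
    (hq : ‖q‖ < 1) (hlg : IsLogBranch q lq lg) {Mp Mm : Polynomial ℂ} (hMp : Mp ≠ 0) (hMm : Mm ≠ 0)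
    (hw : ∀ z : ℂ, z ≠ 0 → ∀ᶠ y in 𝓝[≠] z, w y / w (q⁻¹ * y) = Mp.eval y / Mm.eval y)
    (R : ℂ → ℂ) (i : Fin N) {x : Fin N → ℂ} (hx : ∀ j, j ≠ i → x j ≠ 0) {p : ℂ} (hp : p ≠ 0) :
    ∀ᶠ y in 𝓝[≠] p, wardTerm q t lq lt lg w t (fun y => R y * Mm.eval y) i x (q * y)
      = wardTerm q t lq lt lg w t⁻¹ (fun y => R (q * y) * Mp.eval (q * y)) i x y := by
  have hq0 : q ≠ 0 := hlq ▸ Complex.exp_ne_zero _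
  have ht0 : t ≠ 0 := hlt ▸ Complex.exp_ne_zero _
  have hlq0 : lq ≠ 0 := by
    rintro rfl
    rw [← hlq, Complex.exp_zero, norm_one] at hq
    exact lt_irrefl _ hq
  have havoid : ∀ c : ℂ, c ≠ 0 → ∀ b : ℂ, ∀ᶠ y in 𝓝[≠] p, c * y ≠ b := by
    intro c hc b
    rcases eq_or_ne p (c⁻¹ * b) with h | h
    · filter_upwards [self_mem_nhdsWithin] with y hy hyb
      refine hy ?_
      rw [Set.mem_singleton_iff, h, ← hyb, inv_mul_cancel_left₀ hc]
    · filter_upwards [mem_nhdsWithin_of_mem_nhds (isOpen_ne.mem_nhds h)] with y hy hyb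
      exact hy (by rw [← hyb, inv_mul_cancel_left₀ hc])
  have hall : ∀ᶠ y in 𝓝[≠] p, ∀ j : Fin N, 1 * y ≠ x j ∧ t * y ≠ x j ∧ q * y ≠ x j
      ∧ q * y ≠ t * x j := eventually_all.2 fun j =>
    ((havoid 1 one_ne_zero _).and ((havoid t ht0 _).and ((havoid q hq0 _).and (havoid q hq0 _))))
  filter_upwards [hall, eventually_weight hMp hMm hq0 hw hp,
    mem_nhdsWithin_of_mem_nhds (isOpen_ne.mem_nhds hp)] with y hy hwy hy0
  rw [wardTerm, wardTerm, integrand_update, integrand_update, wardFactor_update, wardFactor_update]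
  have h1 : (∏ j ∈ Finset.univ.erase i, (t⁻¹ * (q * y) - x j) / (q * y - x j))
        * ∏ j ∈ Finset.univ.erase i, pairFactor q t (q * y) (x j)
      = t⁻¹ ^ (N - 1) * ((∏ j ∈ Finset.univ.erase i, (t⁻¹⁻¹ * y - x j) / (y - x j))
        * ∏ j ∈ Finset.univ.erase i, pairFactor q t y (x j)) := by
    have hcard : (Finset.univ.erase i).card = N - 1 := by
      rw [Finset.card_erase_of_mem (Finset.mem_univ i), Finset.card_univ, Fintype.card_fin]
    rw [← Finset.prod_mul_distrib, ← Finset.prod_mul_distrib, ← hcard, ← Finset.prod_const,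
      ← Finset.prod_mul_distrib]
    refine Finset.prod_congr rfl fun j hj => ?_
    obtain ⟨a1, a2, a3, a4⟩ := hy j
    rw [one_mul] at a1
    have := pairFactor_dilate hq hq0 ht0 hy0 (hx j (Finset.ne_of_mem_erase hj)) a1 a2 a3 a4
    rw [inv_inv]
    linear_combination this
  -- The exponent `(log t / log q)(N - 1)` is chosen so that dilation by `q` yields `t^{N-1}`,
  -- cancelling the `t⁻¹` from each of the `N - 1` pair factors.
  have h2 : Mm.eval (q * y) * oneBody N lq lt lg w (q * y)
      = t ^ (N - 1) * (Mp.eval (q * y) * oneBody N lq lt lg w y) := by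
    have hN : ((N : ℂ) - 1) = ((N - 1 : ℕ) : ℂ) := by
      rw [Nat.cast_sub i.pos, Nat.cast_one]
    have he : lt / lq * ((N : ℂ) - 1) * lg (q * y)
        = ((N - 1 : ℕ) : ℂ) * lt + lt / lq * ((N : ℂ) - 1) * lg y := by
      rw [hlg.lg_mul y hy0, ← hN]
      field_simp
      ring
    rw [oneBody, oneBody, he, Complex.exp_add, Complex.exp_nat_mul, hlt]
    linear_combination t ^ (N - 1) * Complex.exp (lt / lq * ((N : ℂ) - 1) * lg y) * hwy
  have h3 : t ^ (N - 1) * t⁻¹ ^ (N - 1) = 1 := by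
    rw [← mul_pow, mul_inv_cancel₀ ht0, one_pow]
  generalize (∏ j ∈ Finset.univ.erase i, (t⁻¹ * (q * y) - x j) / (q * y - x j)) = A at *
  generalize (∏ j ∈ Finset.univ.erase i, pairFactor q t (q * y) (x j)) = B at *
  generalize (∏ j ∈ Finset.univ.erase i, (t⁻¹⁻¹ * y - x j) / (y - x j)) = A' at *
  generalize (∏ j ∈ Finset.univ.erase i, pairFactor q t y (x j)) = B' at *
  generalize oneBody N lq lt lg w (q * y) = o at *
  generalize oneBody N lq lt lg w y = o' at *
  generalize restFactor q t i x = r at *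
  generalize (∏ j ∈ Finset.univ.erase i, oneBody N lq lt lg w (x j)) = s at *
  linear_combination (R (q * y) * r * s * Mm.eval (q * y) * o) * h1
    + R (q * y) * r * s * t⁻¹ ^ (N - 1) * A' * B' * h2
    + R (q * y) * r * s * A' * B' * Mp.eval (q * y) * o' * h3

/-- The Ward identity in the variable `x_i`: the contour is deformed into its dilation. -/
theorem integral_wardTerm (hlq : Complex.exp lq = q) (hlt : Complex.exp lt = t)
    (hq : ‖q‖ < 1) (hlg : IsLogBranch q lq lg) {Mp Mm : Polynomial ℂ} (hMp : Mp ≠ 0) (hMm : Mm ≠ 0)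
    (hw : ∀ z : ℂ, z ≠ 0 → ∀ᶠ y in 𝓝[≠] z, w y / w (q⁻¹ * y) = Mp.eval y / Mm.eval y)
    {R : ℂ → ℂ} (hR : ∀ y, y ≠ 0 → AnalyticAt ℂ R y) {i : Fin N} {x : Fin N → ℂ}
    (hx : ∀ j, j ≠ i → Regular q t lq lt lg w i x (x j)) {c d : Cycle}
    (hc : ∀ y ∈ c.trace, Regular q t lq lt lg w i x y)
    (hd : ∀ y ∈ d.trace, Regular q t lq lt lg w i x y) (h0 : d.wind 0 = c.wind 0)
    (hwind : ∀ p, IsSing (fun y => integrand q t lq lt lg w (Function.update x i y)) p →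
      IsSing (fun y => integrand q t lq lt lg w (Function.update x i y)) (p / q) →
      d.wind p = c.wind (p / q)) :
    d.integral (wardTerm q t lq lt lg w t (fun y => R y * Mm.eval y) i x)
      = q * c.integral
        (wardTerm q t lq lt lg w t⁻¹ (fun y => R (q * y) * Mp.eval (q * y)) i x) := by
  have hq0 : q ≠ 0 := hlq ▸ Complex.exp_ne_zero _
  have hx0 : ∀ j, j ≠ i → x j ≠ 0 := fun j hj => (hx j hj).1
  set F := wardTerm q t lq lt lg w t (fun y => R y * Mm.eval y) i x with hF
  set G := wardTerm q t lq lt lg w t⁻¹ (fun y => R (q * y) * Mp.eval (q * y)) i x with hG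
  have hRF : ∀ y, y ≠ 0 → AnalyticAt ℂ (fun y => R y * Mm.eval y) y := fun y hy =>
    (hR y hy).mul (Mm.differentiable.analyticAt y)
  have hRG : ∀ y, y ≠ 0 → AnalyticAt ℂ (fun y => R (q * y) * Mp.eval (q * y)) y := fun y hy =>
    have e : AnalyticAt ℂ (fun y => q * y) y := analyticAt_const.mul analyticAt_id
    (AnalyticAt.fun_comp (hR (q * y) (mul_ne_zero hq0 hy)) e).mul
      (AnalyticAt.fun_comp (Mp.differentiable.analyticAt (q * y)) e)
  have hdil : ∀ p, p ≠ 0 → (fun y => F (q * y)) =ᶠ[𝓝[≠] p] G := fun p hp =>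
    eventually_wardTerm_dilate hlq hlt hq hlg hMp hMm hw R i hx0 hp
  -- An analytic continuation of `G` at `p` transports to one of `F` at `q p`, by the dilation
  -- relation.
  have htrans : ∀ (p : ℂ) (g : ℂ → ℂ), p ≠ 0 → AnalyticAt ℂ g p → G =ᶠ[𝓝[≠] p] g →
      AnalyticAt ℂ (fun z => g (q⁻¹ * z)) (q * p) ∧ F =ᶠ[𝓝[≠] (q * p)] fun z => g (q⁻¹ * z) := by
    intro p g hp hg hgG
    constructor
    · refine AnalyticAt.fun_comp (f := fun z => q⁻¹ * z) ?_ (analyticAt_const.mul analyticAt_id)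
      rwa [inv_mul_cancel_left₀ hq0]
    · have h1 := tendsto_mul_nhdsNE (inv_ne_zero hq0) (q * p)
      rw [inv_mul_cancel_left₀ hq0] at h1
      filter_upwards [h1.eventually ((hdil p hp).trans hgG)] with z hz
      rwa [mul_inv_cancel_left₀ hq0] at hz
  obtain ⟨hopen, E, hE, hEeq⟩ := exists_extension F
  -- A singularity of `F` at `p` comes from one of the model at `p`, and through `G` also from one
  -- at `p / q`; both premises of the q-shift condition hold.
  have hsing : ∀ p, p ≠ 0 → IsSing F p → d.wind p = c.wind (p / q) := by
    intro p hp hs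
    refine hwind p ?_ ?_
    · by_contra hcon
      exact not_isSing_wardTerm hq t hx (hRF p hp) hcon hs
    · by_contra hcon
      have hpq : p / q ≠ 0 := div_ne_zero hp hq0
      obtain ⟨g, hg, hgG⟩ := not_not.1 (not_isSing_wardTerm hq t⁻¹ hx (hRG _ hpq) hcon)
      obtain ⟨h1, h2⟩ := htrans _ g hpq hg hgG
      rw [mul_div_cancel₀ _ hq0] at h1 h2
      exact not_isSing_of_analyticAt h1 h2 hs
  have hdF : ∀ y ∈ d.trace, y ≠ 0 ∧ ¬ IsSing F y ∧ E y = F y := fun y hy =>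
    have h1 := analyticAt_wardTerm hq t hx0 (hd y hy) (hRF y (hd y hy).1)
    ⟨(hd y hy).1, not_isSing_of_analyticAt h1 (EventuallyEq.refl _ _),
      hEeq y F h1 (EventuallyEq.refl _ _)⟩
  have hcF : ∀ y ∈ c.trace, q * y ≠ 0 ∧ ¬ IsSing F (q * y) ∧ E (q * y) = G y := by
    intro y hy
    have h1 := analyticAt_wardTerm hq t⁻¹ hx0 (hc y hy) (hRG y (hc y hy).1)
    obtain ⟨h2, h3⟩ := htrans y G (hc y hy).1 h1 (EventuallyEq.refl _ _)
    refine ⟨mul_ne_zero hq0 (hc y hy).1, not_isSing_of_analyticAt h2 h3, ?_⟩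
    rw [hEeq _ _ h2 h3, inv_mul_cancel_left₀ hq0]
  -- The extension `E` of `F` is holomorphic on `U`; the origin is removed because nothing is known
  -- about singularities there, and the winding numbers about it agree by hypothesis.
  have key := Cycle.integral_eq_of_wind_eq (c := d) (d := c.dilate q)
    (U := {p | ¬ IsSing F p} ∩ {0}ᶜ) (hopen.inter isOpen_compl_singleton)
    (fun y hy => ⟨(hdF y hy).2.1, (hdF y hy).1⟩)
    (by
      rw [Cycle.trace_dilate]
      rintro _ ⟨y, hy, rfl⟩
      exact ⟨(hcF y hy).2.1, (hcF y hy).1⟩)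
    (fun p hp => by
      rw [Cycle.wind_dilate hq0]
      rcases eq_or_ne p 0 with rfl | hp0
      · rw [zero_div, h0]
      · refine hsing p hp0 ?_
        by_contra hcon
        exact hp ⟨hcon, hp0⟩)
    (hE.mono Set.inter_subset_left)
  rw [Cycle.integral_dilate] at key
  have hcongr : ∀ (c : Cycle) (f g : ℂ → ℂ), (∀ y ∈ c.trace, f y = g y) →
      c.integral f = c.integral g := by
    intro c f g h
    refine Finset.sum_congr rfl fun a _ => intervalIntegral.integral_congr fun u hu => ?_
    rw [Set.uIcc_of_le zero_le_one] at hu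
    exact congrArg _ (h _ ⟨a, u, hu, rfl⟩)
  rw [hcongr d E F fun y hy => (hdF y hy).2.2, hcongr c _ G fun y hy => (hcF y hy).2.2] at key
  exact key

end Ward

end

section

/-! ### Integrals over products of cycles -/

open MeasureTheory Set

section Product

variable {N : ℕ} {c : Fin N → Cycle}

/-- The product of the traces of the cycles `c i`. -/
def productTrace (c : Fin N → Cycle) : Set (Fin N → ℂ) := Set.pi univ fun i => (c i).trace

theorem path_mem_productTrace (c : Fin N → Cycle) (a : (i : Fin N) → Fin (c i).card)
    {u : Fin N → ℝ} (hu : u ∈ Icc (0 : Fin N → ℝ) 1) :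
    (fun i => (c i).path (a i) (u i)) ∈ productTrace c :=
  fun i _ => ⟨a i, u i, ⟨hu.1 i, hu.2 i⟩, rfl⟩

theorem continuousOn_integrandPullback {F : (Fin N → ℂ) → ℂ} (hF : ContinuousOn F (productTrace c))
    (a : (i : Fin N) → Fin (c i).card) :
    ContinuousOn (fun u : Fin N → ℝ => (∏ i, deriv ((c i).path (a i)) (u i))
      * F fun i => (c i).path (a i) (u i)) (Icc 0 1) := by
  refine ContinuousOn.mul (Continuous.continuousOn ?_) (hF.comp (Continuous.continuousOn ?_)
    fun u hu => path_mem_productTrace c a hu)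
  · exact continuous_finsetProd _ fun i _ =>
      (continuous_deriv_path ((c i).contDiff (a i))).comp (continuous_apply i)
  · exact continuous_pi fun i => ((c i).contDiff (a i)).continuous.comp (continuous_apply i)

theorem integrableOn_integrandPullback {F : (Fin N → ℂ) → ℂ}
    (hF : ContinuousOn F (productTrace c)) (a : (i : Fin N) → Fin (c i).card) :
    IntegrableOn (fun u : Fin N → ℝ => (∏ i, deriv ((c i).path (a i)) (u i))
      * F fun i => (c i).path (a i) (u i)) (Icc 0 1) :=
  (continuousOn_integrandPullback hF a).integrableOn_compact isCompact_Icc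

theorem productIntegral_congr {F G : (Fin N → ℂ) → ℂ} (h : EqOn F G (productTrace c)) :
    productIntegral c F = productIntegral c G := by
  refine Finset.sum_congr rfl fun a _ => setIntegral_congr_fun measurableSet_Icc fun u hu => ?_
  exact congrArg _ (h (path_mem_productTrace c a hu))

theorem productIntegral_sum {κ : Type*} (s : Finset κ) {F : κ → (Fin N → ℂ) → ℂ}
    (hF : ∀ k ∈ s, ContinuousOn (F k) (productTrace c)) :
    productIntegral c (fun x => ∑ k ∈ s, F k x) = ∑ k ∈ s, productIntegral c (F k) := by
  simp only [productIntegral, Finset.mul_sum]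
  rw [Finset.sum_comm]
  refine Finset.sum_congr rfl fun a _ => ?_
  exact integral_finsetSum _ fun k hk => integrableOn_integrandPullback (hF k hk) a

theorem productIntegral_const_mul (r : ℂ) (F : (Fin N → ℂ) → ℂ) :
    productIntegral c (fun x => r * F x) = r * productIntegral c F := by
  simp only [productIntegral, Finset.mul_sum, mul_left_comm _ r]
  exact Finset.sum_congr rfl fun a _ => integral_const_mul _ _

end Product

/-- The integral over a product of cycles, computed with the variable `x_i` first. -/
def slicedIntegral {m : ℕ} (i : Fin (m + 1)) (d : Cycle) (e : Fin m → Cycle)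
    (F : (Fin (m + 1) → ℂ) → ℂ) : ℂ :=
  ∑ b : ((j : Fin m) → Fin (e j).card), ∫ v in Icc (0 : Fin m → ℝ) 1,
    (∏ j, deriv ((e j).path (b j)) (v j))
      * d.integral fun y => F (i.insertNth y fun j => (e j).path (b j) (v j))

theorem slicedIntegral_congr {m : ℕ} (i : Fin (m + 1)) {d d' : Cycle} (e : Fin m → Cycle)
    {F G : (Fin (m + 1) → ℂ) → ℂ} (h : ∀ z ∈ productTrace e,
      d.integral (fun y => F (i.insertNth y z)) = d'.integral fun y => G (i.insertNth y z)) :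
    slicedIntegral i d e F = slicedIntegral i d' e G := by
  refine Finset.sum_congr rfl fun a _ => setIntegral_congr_fun measurableSet_Icc fun u hu => ?_
  exact congrArg _ (h _ (path_mem_productTrace e a hu))

/-- Fubini's theorem for the integral over a product of cycles. -/
theorem productIntegral_eq_sliced {m : ℕ} (c : Fin (m + 1) → Cycle) (i : Fin (m + 1))
    {F : (Fin (m + 1) → ℂ) → ℂ} (hF : ContinuousOn F (productTrace c)) :
    productIntegral c F = slicedIntegral i (c i) (fun j => c (i.succAbove j)) F := by
  set e : ℝ × (Fin m → ℝ) ≃ᵐ (Fin (m + 1) → ℝ) :=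
    (MeasurableEquiv.piFinSuccAbove (fun _ => ℝ) i).symm with he
  have hem : MeasurePreserving e :=
    (volume_preserving_piFinSuccAbove (fun _ : Fin (m + 1) => ℝ) i).symm _
  have hepi : (e ⁻¹' Icc 0 1) = Icc (0 : ℝ) 1 ×ˢ Icc (0 : Fin m → ℝ) 1 :=
    ((Fin.insertNthOrderIso (fun _ => ℝ) i).preimage_Icc _ _).trans (Icc_prod_eq _ _)
  have hval : ∀ (k : Fin (c i).card) (b : (j : Fin m) → Fin (c (i.succAbove j)).card)
      (z : ℝ × (Fin m → ℝ)),
      (∏ l, deriv ((c l).path (Fin.insertNthEquiv (fun l => Fin (c l).card) i (k, b) l)) (e z l))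
        * (F fun l => (c l).path (Fin.insertNthEquiv (fun l => Fin (c l).card) i (k, b) l) (e z l))
      = (∏ j, deriv ((c (i.succAbove j)).path (b j)) (z.2 j))
        * (deriv ((c i).path k) z.1 * F (i.insertNth ((c i).path k z.1)
          fun j => (c (i.succAbove j)).path (b j) (z.2 j))) := by
    intro k b z
    have h1 : (fun l => (c l).path (Fin.insertNthEquiv (fun l => Fin (c l).card) i (k, b) l) (e z l))
        = i.insertNth ((c i).path k z.1) fun j => (c (i.succAbove j)).path (b j) (z.2 j) := by
      rw [Fin.eq_insertNth_iff]
      constructor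
      · simp [he, Fin.insertNthEquiv]
      · ext j
        simp [he, Fin.insertNthEquiv, Fin.removeNth]
    rw [h1, i.prod_univ_succAbove]
    simp only [he, Fin.insertNthEquiv, MeasurableEquiv.piFinSuccAbove_symm_apply, Equiv.coe_fn_mk,
      Fin.insertNth_apply_same, Fin.insertNth_apply_succAbove]
    ring
  have hint : ∀ (k : Fin (c i).card) (b : (j : Fin m) → Fin (c (i.succAbove j)).card),
      Integrable (fun z : ℝ × (Fin m → ℝ) => (∏ j, deriv ((c (i.succAbove j)).path (b j)) (z.2 j))
        * (deriv ((c i).path k) z.1 * F (i.insertNth ((c i).path k z.1)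
          fun j => (c (i.succAbove j)).path (b j) (z.2 j))))
        ((volume.restrict (Icc (0 : ℝ) 1)).prod (volume.restrict (Icc (0 : Fin m → ℝ) 1))) := by
    intro k b
    have h := integrableOn_integrandPullback hF (Fin.insertNthEquiv (fun l => Fin (c l).card) i (k, b))
    rw [← hem.integrableOn_comp_preimage e.measurableEmbedding, hepi, IntegrableOn,
      Measure.volume_eq_prod, ← Measure.prod_restrict] at h
    refine h.congr (Filter.Eventually.of_forall fun z => ?_)
    exact hval k b z
  have hpiece : ∀ (k : Fin (c i).card) (b : (j : Fin m) → Fin (c (i.succAbove j)).card),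
      (∫ u in Icc (0 : Fin (m + 1) → ℝ) 1,
        (∏ l, deriv ((c l).path (Fin.insertNthEquiv (fun l => Fin (c l).card) i (k, b) l)) (u l))
        * (F fun l => (c l).path (Fin.insertNthEquiv (fun l => Fin (c l).card) i (k, b) l) (u l)))
      = ∫ v in Icc (0 : Fin m → ℝ) 1, ∫ y in Icc (0 : ℝ) 1,
        (∏ j, deriv ((c (i.succAbove j)).path (b j)) (v j))
        * (deriv ((c i).path k) y * F (i.insertNth ((c i).path k y)
          fun j => (c (i.succAbove j)).path (b j) (v j))) := by
    intro k b
    rw [← hem.map_eq, setIntegral_map_equiv, hepi, Measure.volume_eq_prod, ← Measure.prod_restrict]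
    simp only [hval]
    exact integral_prod_symm _ (hint k b)
  rw [productIntegral, ← (Fin.insertNthEquiv (fun l => Fin (c l).card) i).sum_comp,
    Fintype.sum_prod_type, Finset.sum_comm]
  refine Finset.sum_congr rfl fun b _ => ?_
  rw [Finset.sum_congr rfl fun k _ => hpiece k b, ← integral_finsetSum _ fun k _ =>
    (hint k b).integral_prod_right]
  refine setIntegral_congr_fun measurableSet_Icc fun v _ => ?_
  simp only [Cycle.integral, pathIntegral, Finset.mul_sum]
  refine Finset.sum_congr rfl fun k _ => ?_
  rw [intervalIntegral.integral_of_le zero_le_one, ← integral_Icc_eq_integral_Ioc,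
    integral_const_mul]

end

section

/-! ### The Ward identities of the matrix model -/

open Set

section Kernel

variable (q t : ℂ) (N : ℕ)

/-- The coefficients of the kernel as polynomials in the variables `x_i`. -/
def kernelPoly (μ : ℕ+ →₀ ℕ) : MvPolynomial (Fin N) ℂ :=
  μ.prod fun k e => (MvPolynomial.C ((1 - t ^ (k : ℕ)) / (1 - q ^ (k : ℕ)) / (k : ℂ))
    * ∑ i, MvPolynomial.X i ^ (k : ℕ)) ^ e * MvPolynomial.C ((Nat.factorial e : ℂ)⁻¹)

variable {N}

theorem eval_kernelPoly (μ : ℕ+ →₀ ℕ) (x : Fin N → ℂ) :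
    MvPolynomial.eval x (kernelPoly q t N μ) = MvPowerSeries.coeff μ (kernel q t x) := by
  rw [kernelPoly, Finsupp.prod, map_prod]
  refine Finset.prod_congr rfl fun k _ => ?_
  simp only [map_mul, map_pow, map_sum, MvPolynomial.eval_C, MvPolynomial.eval_X]
  rw [← div_eq_mul_inv]

theorem continuous_coeff_kernel (μ : ℕ+ →₀ ℕ) :
    Continuous fun x : Fin N → ℂ => MvPowerSeries.coeff μ (kernel q t x) := by
  simp only [← eval_kernelPoly]
  exact MvPolynomial.continuous_eval _

end Kernel

theorem differentiable_eval_update {N : ℕ} (f : MvPolynomial (Fin N) ℂ) (i : Fin N)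
    (x : Fin N → ℂ) : Differentiable ℂ fun y => MvPolynomial.eval (Function.update x i y) f := by
  induction f using MvPolynomial.induction_on with
  | C a => simp only [MvPolynomial.eval_C]; exact differentiable_const a
  | add f g hf hg => simp only [map_add]; exact hf.add hg
  | mul_X f j hf =>
    simp only [map_mul, MvPolynomial.eval_X]
    refine hf.mul ?_
    rcases eq_or_ne j i with rfl | hj
    · simp only [Function.update_self]
      exact differentiable_id
    · simp only [Function.update_of_ne hj]
      exact differentiable_const _

theorem eval_aeval_X {N : ℕ} (M : Polynomial ℂ) (i : Fin N) (x : Fin N → ℂ) :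
    MvPolynomial.eval x (Polynomial.aeval (MvPolynomial.X i) M) = M.eval (x i) := by
  have h := Polynomial.aeval_algHom_apply (MvPolynomial.aeval (R := ℂ) x) (MvPolynomial.X i) M
  rw [MvPolynomial.aeval_X] at h
  rw [← MvPolynomial.coe_aeval_eq_eval]
  exact h.symm.trans (by rw [Polynomial.coe_aeval_eq_eval])

section Contour

variable {q t lq lt : ℂ} {lg w : ℂ → ℂ} {m₀ : ℤ} {N : ℕ} {ι : Type} {C : Contour N ι}

/-- The product of the traces of a contour. -/
def Contour.productTrace (C : Contour N ι) : Set (Fin N → ℂ) := Set.pi univ C.trace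

theorem Contour.productTrace_component (C : Contour N ι) (a : Fin N → ι) :
    QTMatrixModel.productTrace (fun i => C i (a i)) ⊆ C.productTrace :=
  Set.pi_mono fun i _ => subset_iUnion (fun b => (C i b).trace) (a i)

theorem IsAdmissible.pairRegular (hC : IsAdmissible q t lq lt lg w m₀ C) {i j : Fin N}
    (hij : i ≠ j) {y a : ℂ} (hy : y ∈ C.trace i) (ha : a ∈ C.trace j) : PairRegular q t y a :=
  ⟨hC.ne_zero i y hy, hC.ne_zero j a ha, hC.avoids i j hij y hy a ha,
    hC.avoids j i hij.symm a ha y hy⟩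

theorem IsAdmissible.regular (hC : IsAdmissible q t lq lt lg w m₀ C) {i : Fin N} {x : Fin N → ℂ}
    (hx : ∀ j, j ≠ i → x j ∈ C.trace j) {y : ℂ} (hy : y ∈ C.trace i) :
    Regular q t lq lt lg w i x y :=
  ⟨hC.ne_zero i y hy, hC.analytic i y hy, fun j hj => hC.pairRegular hj.symm hy (hx j hj)⟩

/-- The points where the Ward factor has poles in `x_i` are thereby regular. The pair of `x_j` with
itself is not covered by `avoids` and uses `q^n t ≠ 1`. -/
theorem IsAdmissible.regular_of_ne (hC : IsAdmissible q t lq lt lg w m₀ C)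
    (hqt : ∀ n : ℕ, q ^ n * t ≠ 1) {i : Fin N} {x : Fin N → ℂ}
    (hx : ∀ j, j ≠ i → x j ∈ C.trace j) {j : Fin N} (hj : j ≠ i) :
    Regular q t lq lt lg w i x (x j) := by
  refine ⟨hC.ne_zero j _ (hx j hj), hC.analytic j _ (hx j hj), fun k hk => ?_⟩
  rcases eq_or_ne j k with rfl | hjk
  · exact pairRegular_self hqt (hC.ne_zero j _ (hx j hj))
  · exact hC.pairRegular hjk (hx j hj) (hx k hk)

theorem IsAdmissible.continuousOn_oneBody (hC : IsAdmissible q t lq lt lg w m₀ C) :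
    ContinuousOn (fun x : Fin N → ℂ => ∏ i, oneBody N lq lt lg w (x i)) C.productTrace := by
  refine continuousOn_finsetProd _ fun i _ x hx => ContinuousAt.continuousWithinAt ?_
  exact (hC.analytic i (x i) (hx i (mem_univ i))).continuousAt.comp
    (f := fun x : Fin N → ℂ => x i) (continuous_apply i).continuousAt

theorem IsAdmissible.continuousOn_qPoch_div (hq : ‖q‖ < 1)
    (hC : IsAdmissible q t lq lt lg w m₀ C) {i j : Fin N} (hij : i ≠ j) (r : ℂ) :
    ContinuousOn (fun x : Fin N → ℂ => qPoch (r * (x i / x j)) q / qPoch (t * (x i / x j)) q)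
      C.productTrace := by
  intro x hx
  have h := hC.pairRegular hij (hx i (mem_univ i)) (hx j (mem_univ j))
  have h1 : ContinuousAt (fun x : Fin N → ℂ => x i / x j) x :=
    (continuous_apply i).continuousAt.div (continuous_apply j).continuousAt h.2.1
  have h2 : ∀ r : ℂ, ContinuousAt (fun x : Fin N → ℂ => qPoch (r * (x i / x j)) q) x := fun r =>
    ((differentiable_qPoch hq).continuous.continuousAt
      (x := r * (x i / x j))).comp (f := fun x : Fin N → ℂ => r * (x i / x j))
      (continuousAt_const.mul h1)
  exact ((h2 r).div (h2 t) (h.qPoch_ne_zero hq).1).continuousWithinAt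

theorem IsAdmissible.continuousOn_integrand (hq : ‖q‖ < 1)
    (hC : IsAdmissible q t lq lt lg w m₀ C) :
    ContinuousOn (integrand q t lq lt lg w) C.productTrace := by
  refine ContinuousOn.mul ?_ hC.continuousOn_oneBody
  refine continuousOn_finsetProd _ fun i _ => continuousOn_finsetProd _ fun j hj => ?_
  simpa only [one_mul] using hC.continuousOn_qPoch_div hq (Finset.ne_of_mem_erase hj).symm 1

/-- The contours of different variables may meet, so continuity at `x_i = x_j` is needed; it is
supplied by the regularized factors. -/
theorem IsAdmissible.continuousOn_wardFactor_mul (hq : ‖q‖ < 1)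
    (hC : IsAdmissible q t lq lt lg w m₀ C) (τ : ℂ) (i : Fin N) :
    ContinuousOn (fun x => wardFactor τ i x * integrand q t lq lt lg w x) C.productTrace := by
  have h0 : ∀ x ∈ C.productTrace, ∀ j, x j ≠ 0 := fun x hx j => hC.ne_zero j _ (hx j (mem_univ j))
  have h1 : ContinuousOn (fun x : Fin N → ℂ => ∏ j ∈ Finset.univ.erase i,
      regFactor q t τ (x i) (x j)) C.productTrace := by
    refine continuousOn_finsetProd _ fun j hj => ?_
    have hij := (Finset.ne_of_mem_erase hj).symm
    refine ContinuousOn.mul (ContinuousOn.mul ?_ (hC.continuousOn_qPoch_div hq hij q)) ?_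
    · refine ContinuousOn.div (Continuous.continuousOn ?_) (continuous_apply j).continuousOn
        fun x hx => h0 x hx j
      exact ((continuous_const.mul (continuous_apply i)).sub (continuous_apply j)).neg
    · simpa only [one_mul] using hC.continuousOn_qPoch_div hq hij.symm 1
  have h2 : ContinuousOn (restFactor q t i) C.productTrace := by
    refine continuousOn_finsetProd _ fun k _ => continuousOn_finsetProd _ fun j hj => ?_
    have hj' := Finset.ne_of_mem_erase (Finset.mem_of_mem_erase hj)
    simpa only [one_mul] using hC.continuousOn_qPoch_div hq hj'.symm 1
  refine ((h1.mul h2).mul hC.continuousOn_oneBody).congr fun x hx => ?_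
  simp only [integrand, ← mul_assoc]
  rw [vandermonde_mul_wardFactor hq τ i (h0 x hx)]
  rfl

/-- The integrand of the Ward identity of the variable `x_i`. -/
def wardLeft (q t lq lt : ℂ) (lg w : ℂ → ℂ) (M : Polynomial ℂ) (n : ℤ) (μ : ℕ+ →₀ ℕ) (i : Fin N)
    (x : Fin N → ℂ) : ℂ :=
  x i ^ n * M.eval (x i) * MvPowerSeries.coeff μ (kernel q t x) * wardFactor t i x
    * integrand q t lq lt lg w x

/-- The integrand of the Ward identity of the variable `x_i`, dilated. -/
def wardRight (q t lq lt : ℂ) (lg w : ℂ → ℂ) (M : Polynomial ℂ) (n : ℤ) (μ : ℕ+ →₀ ℕ) (i : Fin N)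
    (x : Fin N → ℂ) : ℂ :=
  q * ((q * x i) ^ n * M.eval (q * x i)
    * MvPowerSeries.coeff μ (kernel q t (Function.update x i (q * x i))) * wardFactor t⁻¹ i x
    * integrand q t lq lt lg w x)

theorem IsAdmissible.continuousOn_wardLeft (hq : ‖q‖ < 1) (hC : IsAdmissible q t lq lt lg w m₀ C)
    (M : Polynomial ℂ) (n : ℤ) (μ : ℕ+ →₀ ℕ) (i : Fin N) :
    ContinuousOn (wardLeft q t lq lt lg w M n μ i) C.productTrace := by
  have h0 : ∀ x ∈ C.productTrace, x i ≠ 0 := fun x hx => hC.ne_zero i _ (hx i (mem_univ i))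
  have h1 : ContinuousOn (fun x : Fin N → ℂ => x i ^ n * M.eval (x i)
      * MvPowerSeries.coeff μ (kernel q t x)) C.productTrace :=
    ((((continuous_apply i).continuousOn.zpow₀ n fun x hx =>
      Or.inl (h0 x hx)).mul
      (M.continuous.comp (continuous_apply i)).continuousOn)).mul
      (continuous_coeff_kernel q t μ).continuousOn
  refine (h1.mul (hC.continuousOn_wardFactor_mul hq t i)).congr fun x _ => ?_
  simp only [wardLeft, Pi.mul_apply, mul_assoc]

theorem IsAdmissible.continuousOn_wardRight (hq : ‖q‖ < 1) (hq0 : q ≠ 0)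
    (hC : IsAdmissible q t lq lt lg w m₀ C)
    (M : Polynomial ℂ) (n : ℤ) (μ : ℕ+ →₀ ℕ) (i : Fin N) :
    ContinuousOn (wardRight q t lq lt lg w M n μ i) C.productTrace := by
  have hqx : Continuous fun x : Fin N → ℂ => q * x i := continuous_const.mul (continuous_apply i)
  have h0 : ∀ x ∈ C.productTrace, q * x i ≠ 0 := fun x hx =>
    mul_ne_zero hq0 (hC.ne_zero i _ (hx i (mem_univ i)))
  have h1 : ContinuousOn (fun x : Fin N → ℂ => (q * x i) ^ n * M.eval (q * x i)
      * MvPowerSeries.coeff μ (kernel q t (Function.update x i (q * x i)))) C.productTrace :=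
    ((hqx.continuousOn.zpow₀ n fun x hx =>
      Or.inl (h0 x hx)).mul
      (M.continuous.comp hqx).continuousOn).mul
      ((continuous_coeff_kernel q t μ).comp (continuous_id.update i hqx)).continuousOn
  refine ((continuousOn_const (c := q)).mul
    (h1.mul (hC.continuousOn_wardFactor_mul hq t⁻¹ i))).congr fun x _ => ?_
  simp only [wardRight, Pi.mul_apply, mul_assoc]

/-- The Ward identity for the components of a contour. -/
theorem IsAdmissible.part_wardLeft (hlq : Complex.exp lq = q) (hlt : Complex.exp lt = t)
    (hq : ‖q‖ < 1) (hqt : ∀ n : ℕ, q ^ n * t ≠ 1) (hlg : IsLogBranch q lq lg)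
    {Mp Mm : Polynomial ℂ} (hMp : Mp ≠ 0) (hMm : Mm ≠ 0)
    (hw : ∀ z : ℂ, z ≠ 0 → ∀ᶠ y in 𝓝[≠] z, w y / w (q⁻¹ * y) = Mp.eval y / Mm.eval y)
    (hC : IsAdmissible q t lq lt lg w m₀ C) (n : ℤ) (μ : ℕ+ →₀ ℕ) (i : Fin N)
    {b : ι} {a : Fin N → ι} (h0 : (C i b).wind 0 = (C i (a i)).wind 0)
    (hwind : ∀ x : Fin N → ℂ, (∀ j, j ≠ i → x j ∈ C.trace j) → ∀ p : ℂ,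
      IsSing (fun y => integrand q t lq lt lg w (Function.update x i y)) p →
      IsSing (fun y => integrand q t lq lt lg w (Function.update x i y)) (p / q) →
      (C i b).wind p = (C i (a i)).wind (p / q)) :
    C.part (wardLeft q t lq lt lg w Mm n μ i) (Function.update a i b)
      = C.part (wardRight q t lq lt lg w Mp n μ i) a := by
  have hq0 : q ≠ 0 := hlq ▸ Complex.exp_ne_zero _
  cases N with
  | zero => exact i.elim0
  | succ m =>
    rw [Contour.part, Contour.part,
      productIntegral_eq_sliced _ i ((hC.continuousOn_wardLeft hq Mm n μ i).mono
        (C.productTrace_component _)),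
      productIntegral_eq_sliced _ i ((hC.continuousOn_wardRight hq hq0 Mp n μ i).mono
        (C.productTrace_component _)), Function.update_self]
    have he : (fun j => C (i.succAbove j) (Function.update a i b (i.succAbove j)))
        = fun j => C (i.succAbove j) (a (i.succAbove j)) := by
      funext j
      rw [Function.update_of_ne (Fin.succAbove_ne i j)]
    rw [he]
    refine slicedIntegral_congr i _ fun z hz => ?_
    set x : Fin (m + 1) → ℂ := i.insertNth 0 z with hx
    have hxy : ∀ y, i.insertNth y z = Function.update x i y := fun y => by
      rw [hx, Fin.update_insertNth]
    have hxC : ∀ j, j ≠ i → x j ∈ C.trace j := by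
      intro j hj
      obtain ⟨k, rfl⟩ := Fin.exists_succAbove_eq hj
      rw [hx, Fin.insertNth_apply_succAbove]
      exact mem_iUnion.2 ⟨_, hz k (mem_univ k)⟩
    have key := integral_wardTerm hlq hlt hq hlg hMp hMm hw
      (R := fun y => y ^ n * MvPowerSeries.coeff μ (kernel q t (Function.update x i y)))
      (fun y hy => ?_) (fun j hj => hC.regular_of_ne hqt hxC hj) (c := C i (a i)) (d := C i b)
      (fun y hy => hC.regular hxC (mem_iUnion.2 ⟨_, hy⟩))
      (fun y hy => hC.regular hxC (mem_iUnion.2 ⟨_, hy⟩)) h0 (hwind x hxC)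
    · simp only [hxy]
      refine Eq.trans ?_ (key.trans ?_)
      · refine congrArg _ (funext fun y => ?_)
        simp only [wardLeft, wardTerm, Function.update_self]
        ring
      · simp only [Cycle.integral, pathIntegral, Finset.mul_sum,
          ← intervalIntegral.integral_const_mul]
        refine Finset.sum_congr rfl fun k _ => intervalIntegral.integral_congr fun u _ => ?_
        simp only [wardRight, wardTerm, Function.update_self, Function.update_idem]
        ring
    · refine AnalyticAt.mul ?_ ?_
      · exact analyticAt_id.zpow hy
      · simp only [← eval_kernelPoly]
        exact (differentiable_eval_update _ i x).analyticAt y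

/-- For `n ≥ m₀` the power `x_i^n` is `x_i^{m₀}` times a polynomial, so convergence reduces to
`summable_ward`. -/
theorem IsAdmissible.summable_wardLeft (hC : IsAdmissible q t lq lt lg w m₀ C) (M : Polynomial ℂ)
    {n : ℤ} (hn : m₀ ≤ n) (μ : ℕ+ →₀ ℕ) (i : Fin N) :
    Summable (C.part (wardLeft q t lq lt lg w M n μ i)) := by
  convert hC.summable_ward i (MvPolynomial.X i ^ (n - m₀).toNat
    * Polynomial.aeval (MvPolynomial.X i) M * kernelPoly q t N μ) using 1
  funext a
  refine productIntegral_congr fun x hx => ?_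
  have hx0 : x i ≠ 0 := hC.ne_zero i _ (C.productTrace_component a hx i (mem_univ i))
  have h : x i ^ n = x i ^ m₀ * x i ^ (n - m₀).toNat := by
    rw [← zpow_natCast, ← zpow_add₀ hx0]
    congr 1
    omega
  simp only [wardLeft, map_mul, map_pow, MvPolynomial.eval_X, eval_kernelPoly, eval_aeval_X, h]
  ring

/-- The Ward identity for the contour. -/
theorem IsAdmissible.summable_wardRight (hlq : Complex.exp lq = q) (hlt : Complex.exp lt = t)
    (hq : ‖q‖ < 1) (hqt : ∀ n : ℕ, q ^ n * t ≠ 1) (hlg : IsLogBranch q lq lg)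
    {Mp Mm : Polynomial ℂ} (hMp : Mp ≠ 0) (hMm : Mm ≠ 0)
    (hw : ∀ z : ℂ, z ≠ 0 → ∀ᶠ y in 𝓝[≠] z, w y / w (q⁻¹ * y) = Mp.eval y / Mm.eval y)
    (hC : IsAdmissible q t lq lt lg w m₀ C) {n : ℤ} (hn : m₀ ≤ n) (μ : ℕ+ →₀ ℕ) (i : Fin N) :
    Summable (C.part (wardRight q t lq lt lg w Mp n μ i)) ∧
    ∑' a, C.part (wardRight q t lq lt lg w Mp n μ i) a
      = ∑' a, C.part (wardLeft q t lq lt lg w Mm n μ i) a := by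
  obtain ⟨σ, hσ⟩ := hC.dilation i
  -- The permutation σ acting on the `i`-th index only. The sums over components are reindexed by
  -- it, so summability passes from the left side to the dilated side.
  set e : (Fin N → ι) ≃ (Fin N → ι) :=
    Equiv.piCongrRight fun j => if j = i then σ else Equiv.refl ι with he
  have hea : ∀ a, e a = Function.update a i (σ (a i)) := by
    intro a
    funext j
    rw [he, Equiv.piCongrRight_apply, Pi.map_apply]
    rcases eq_or_ne j i with rfl | hj
    · rw [if_pos rfl, Function.update_self]
    · rw [if_neg hj, Function.update_of_ne hj, Equiv.refl_apply]
  have hpart : C.part (wardRight q t lq lt lg w Mp n μ i)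
      = C.part (wardLeft q t lq lt lg w Mm n μ i) ∘ e := by
    funext a
    rw [Function.comp_apply, hea]
    exact (hC.part_wardLeft hlq hlt hq hqt hlg hMp hMm hw n μ i (hσ (a i)).1 (hσ (a i)).2).symm
  rw [hpart]
  exact ⟨e.summable_iff.2 (hC.summable_wardLeft Mm hn μ i), e.tsum_eq _⟩

/-- The expectation values of the kernel are annihilated by the modes of the current. -/
theorem IsAdmissible.integral_virasoroMode (hlq : Complex.exp lq = q) (hlt : Complex.exp lt = t)
    (hq : ‖q‖ < 1) (ht : t ≠ 1) (hqt : ∀ n : ℕ, q ^ n * t ≠ 1) (hlg : IsLogBranch q lq lg)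
    {Mp Mm : Polynomial ℂ} (hMp : Mp ≠ 0) (hMm : Mm ≠ 0) {dp dm : ℕ}
    (hdp : Mp.natDegree ≤ dp) (hdm : Mm.natDegree ≤ dm)
    (hw : ∀ z : ℂ, z ≠ 0 → ∀ᶠ y in 𝓝[≠] z, w y / w (q⁻¹ * y) = Mp.eval y / Mm.eval y)
    (hC : IsAdmissible q t lq lt lg w m₀ C) {n : ℤ} (hn : m₀ ≤ n)
    (hn0 : 0 ≤ n ∨ (n = -1 ∧ Mp.eval 0 = Mm.eval 0)) (μ : ℕ+ →₀ ℕ) :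
    C.integral (fun x => MvPowerSeries.coeff μ
      (virasoroMode q t (t ^ N) Mp Mm dp dm n (kernel q t x)) * integrand q t lq lt lg w x) = 0 := by
  have hq0 : q ≠ 0 := hlq ▸ Complex.exp_ne_zero _
  have ht0 : t ≠ 0 := hlt ▸ Complex.exp_ne_zero _
  have hpart : ∀ a, C.part (fun x => MvPowerSeries.coeff μ
      (virasoroMode q t (t ^ N) Mp Mm dp dm n (kernel q t x)) * integrand q t lq lt lg w x) a
      = (1 - t⁻¹) * ∑ i, (C.part (wardLeft q t lq lt lg w Mm n μ i) a
        + -1 * C.part (wardRight q t lq lt lg w Mp n μ i) a) := by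
    intro a
    have hcl := fun i => (hC.continuousOn_wardLeft hq Mm n μ i).mono (C.productTrace_component a)
    have hcr := fun i =>
      (hC.continuousOn_wardRight hq hq0 Mp n μ i).mono (C.productTrace_component a)
    simp only [Contour.part]
    rw [Finset.sum_add_distrib, ← Finset.mul_sum, ← productIntegral_sum _ fun i _ => hcl i,
      ← productIntegral_sum _ fun i _ => hcr i, ← productIntegral_const_mul]
    -- Additivity for two functions, read off from finite sums indexed by `Bool`.
    have hadd := productIntegral_sum (c := fun i => C i (a i)) (Finset.univ : Finset Bool)
      (F := fun k x => if k then ∑ i, wardLeft q t lq lt lg w Mm n μ i x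
        else -1 * ∑ i, wardRight q t lq lt lg w Mp n μ i x) (by
        intro k _
        cases k
        · exact (continuousOn_const.mul (continuousOn_finsetSum _ fun i _ => hcr i))
        · exact (continuousOn_finsetSum _ fun i _ => hcl i))
    simp only [Fintype.sum_bool, if_true, Bool.false_eq_true, if_false] at hadd
    rw [← hadd, ← productIntegral_const_mul]
    refine productIntegral_congr fun x hx => ?_
    have hx0 : ∀ j, x j ≠ 0 := fun j =>
      hC.ne_zero j _ (C.productTrace_component a hx j (mem_univ j))
    by_cases hinj : Function.Injective x
    · simp only [coeff_virasoroMode_kernel_eq hq hq0 ht0 ht hdp hdm hn0 hinj hx0 μ]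
      rw [Finset.mul_sum _ _ (-1 : ℂ), ← Finset.sum_add_distrib, mul_assoc, Finset.sum_mul]
      refine congrArg _ (Finset.sum_congr rfl fun i _ => ?_)
      simp only [wardLeft, wardRight]
      ring
    -- The partial fractions require distinct variables. At coinciding ones the integrand vanishes,
    -- as do both Ward integrands with the values Lean assigns.
    · simp only [Function.Injective, not_forall] at hinj
      obtain ⟨i, j, hij, hne⟩ := hinj
      have h0 : integrand q t lq lt lg w x = 0 := by
        rw [integrand, vandermonde_eq_zero hq hne hij (hx0 i), zero_mul]
      simp only [wardLeft, wardRight, h0, mul_zero, Finset.sum_const_zero, add_zero]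
  rw [Contour.integral]
  simp only [hpart]
  have hR := fun i => hC.summable_wardRight hlq hlt hq hqt hlg hMp hMm hw hn μ i
  have hL := fun i => hC.summable_wardLeft Mm hn μ i
  rw [tsum_mul_left, Summable.tsum_finsetSum fun i _ => (hL i).add ((hR i).1.mul_left _)]
  refine mul_eq_zero_of_right _ (Finset.sum_eq_zero fun i _ => ?_)
  rw [(hL i).tsum_add ((hR i).1.mul_left _), tsum_mul_left, (hR i).2]
  ring

end Contour

end

section

/-! ### Coefficientwise finite operators -/

/-- The linear functionals that depend on finitely many coefficients. -/
def finiteFunctionals : Submodule ℂ (Lam →ₗ[ℂ] ℂ) :=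
  Submodule.span ℂ (Set.range fun μ : ℕ+ →₀ ℕ => (MvPowerSeries.coeff μ : Lam →ₗ[ℂ] ℂ))

theorem coeff_mem_finiteFunctionals (μ : ℕ+ →₀ ℕ) :
    (MvPowerSeries.coeff μ : Lam →ₗ[ℂ] ℂ) ∈ finiteFunctionals :=
  Submodule.subset_span ⟨μ, rfl⟩

/-- An operator is finitary if each coefficient of `T f` depends on finitely many coefficients
of `f`. -/
def IsFinitary (T : Op) : Prop :=
  ∀ μ : ℕ+ →₀ ℕ, (MvPowerSeries.coeff μ : Lam →ₗ[ℂ] ℂ) ∘ₗ T ∈ finiteFunctionals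

namespace IsFinitary

variable {S T : Op}

theorem zero : IsFinitary 0 := fun _ => by
  rw [LinearMap.comp_zero]
  exact Submodule.zero_mem _

theorem one : IsFinitary 1 := fun μ => coeff_mem_finiteFunctionals μ

theorem add (hS : IsFinitary S) (hT : IsFinitary T) : IsFinitary (S + T) := fun μ => by
  rw [LinearMap.comp_add]
  exact Submodule.add_mem _ (hS μ) (hT μ)

theorem smul (r : ℂ) (hT : IsFinitary T) : IsFinitary (r • T) := fun μ => by
  rw [LinearMap.comp_smul]
  exact Submodule.smul_mem _ r (hT μ)

theorem sub (hS : IsFinitary S) (hT : IsFinitary T) : IsFinitary (S - T) := fun μ => by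
  rw [LinearMap.comp_sub]
  exact Submodule.sub_mem _ (hS μ) (hT μ)

theorem sum {κ : Type*} (s : Finset κ) {T : κ → Op} (hT : ∀ k ∈ s, IsFinitary (T k)) :
    IsFinitary (∑ k ∈ s, T k) := by
  classical
  induction s using Finset.induction_on with
  | empty => exact zero
  | insert k s hk ih =>
    rw [Finset.sum_insert hk]
    exact (hT k (Finset.mem_insert_self k s)).add
      (ih fun l hl => hT l (Finset.mem_insert_of_mem hl))

/-- This makes finitary operators closed under composition, and hence all modes of the current
finitary. -/
theorem comp_mem (hT : IsFinitary T) {φ : Lam →ₗ[ℂ] ℂ} (hφ : φ ∈ finiteFunctionals) :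
    φ ∘ₗ T ∈ finiteFunctionals := by
  induction hφ using Submodule.span_induction with
  | mem φ h =>
    obtain ⟨μ, rfl⟩ := h
    exact hT μ
  | zero =>
    rw [LinearMap.zero_comp]
    exact Submodule.zero_mem _
  | add φ ψ _ _ h1 h2 =>
    rw [LinearMap.add_comp]
    exact Submodule.add_mem _ h1 h2
  | smul r φ _ h =>
    rw [LinearMap.smul_comp]
    exact Submodule.smul_mem _ r h

theorem mul (hS : IsFinitary S) (hT : IsFinitary T) : IsFinitary (S * T) := fun μ =>
  hT.comp_mem (hS μ)

theorem gradedSum {T : ℕ → Op} (hT : ∀ a, IsFinitary (T a)) : IsFinitary (gradedSum T) := by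
  intro μ
  have h : (MvPowerSeries.coeff μ : Lam →ₗ[ℂ] ℂ) ∘ₗ QTMatrixModel.gradedSum T
      = ∑ a ∈ Finset.range (wt μ + 1), (MvPowerSeries.coeff μ : Lam →ₗ[ℂ] ℂ) ∘ₗ T a := by
    refine LinearMap.ext fun f => ?_
    rw [LinearMap.comp_apply, coeff_gradedSum, LinearMap.sum_apply]
    rfl
  rw [h]
  exact Submodule.sum_mem _ fun a _ => hT a μ

theorem hMode {a : ℕ+ → Op} (ha : ∀ k, IsFinitary (a k)) (n : ℤ) : IsFinitary (hMode a n) := by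
  have key : ∀ j m : ℕ, IsFinitary (PowerSeries.coeff m (genSeries a ^ j)) := by
    intro j
    induction j with
    | zero =>
      intro m
      rw [pow_zero, PowerSeries.coeff_one]
      split_ifs
      · exact one
      · exact zero
    | succ j ih =>
      intro m
      rw [pow_succ, PowerSeries.coeff_mul]
      refine sum _ fun x _ => (ih x.1).mul ?_
      rw [genSeries, PowerSeries.coeff_mk]
      split_ifs
      · exact (ha _).smul _
      · exact zero
  rw [QTMatrixModel.hMode]
  split_ifs
  · exact zero
  · exact sum _ fun j _ => (key j _).smul _

theorem pMul (k : ℕ+) : IsFinitary (pMul k) := by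
  classical
  intro μ
  by_cases h : Finsupp.single k 1 ≤ μ
  · have h1 : (MvPowerSeries.coeff μ : Lam →ₗ[ℂ] ℂ) ∘ₗ QTMatrixModel.pMul k
        = MvPowerSeries.coeff (μ - Finsupp.single k 1) := by
      refine LinearMap.ext fun f => ?_
      simp only [LinearMap.comp_apply, QTMatrixModel.pMul, LinearMap.mulLeft_apply,
        MvPowerSeries.X_def, MvPowerSeries.coeff_monomial_mul]
      rw [if_pos h, one_mul]
    rw [h1]
    exact coeff_mem_finiteFunctionals _
  · have h1 : (MvPowerSeries.coeff μ : Lam →ₗ[ℂ] ℂ) ∘ₗ QTMatrixModel.pMul k = 0 := by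
      refine LinearMap.ext fun f => ?_
      simp only [LinearMap.comp_apply, QTMatrixModel.pMul, LinearMap.mulLeft_apply,
        MvPowerSeries.X_def, MvPowerSeries.coeff_monomial_mul]
      rw [if_neg h, LinearMap.zero_apply]
    rw [h1]
    exact Submodule.zero_mem _

theorem pDer (k : ℕ+) : IsFinitary (pDer k) := by
  intro μ
  have h1 : (MvPowerSeries.coeff μ : Lam →ₗ[ℂ] ℂ) ∘ₗ QTMatrixModel.pDer k
      = ((μ k : ℂ) + 1) • (MvPowerSeries.coeff (μ + Finsupp.single k 1) : Lam →ₗ[ℂ] ℂ) := by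
    refine LinearMap.ext fun f => ?_
    rw [LinearMap.comp_apply, coeff_pDer, LinearMap.smul_apply, smul_eq_mul, mul_comm]
  rw [h1]
  exact Submodule.smul_mem _ _ (coeff_mem_finiteFunctionals _)

theorem virasoroMode (q t Q : ℂ) (Mp Mm : Polynomial ℂ) (dp dm : ℕ) (n : ℤ) :
    IsFinitary (virasoroMode q t Q Mp Mm dp dm n) := by
  have hm : ∀ α : ℕ+ → ℂ, ∀ s, IsFinitary (QTMatrixModel.hMode
      (fun k => α k • QTMatrixModel.pMul k) s) := fun α => hMode fun k => (pMul k).smul _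
  have hd : ∀ β : ℕ+ → ℂ, ∀ s, IsFinitary (QTMatrixModel.hMode
      (fun k => β k • ((k : ℂ) • QTMatrixModel.pDer k)) s) := fun β =>
    hMode fun k => ((pDer k).smul _).smul _
  refine (sum _ fun l _ => ((one.smul _).sub ((hd _ _).smul _)).smul _).add
    ((sum _ fun l _ => ((hm _ _).sub ((gradedSum fun a => (hm _ _).mul (hd _ _)).smul _)).smul _).smul
      _)

end IsFinitary

section Contour

variable {q t lq lt : ℂ} {lg w : ℂ → ℂ} {m₀ : ℤ} {N : ℕ} {ι : Type} {C : Contour N ι}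

theorem IsAdmissible.integral_eval_add (hq : ‖q‖ < 1) (hC : IsAdmissible q t lq lt lg w m₀ C)
    (f g : MvPolynomial (Fin N) ℂ) :
    C.integral (fun x => MvPolynomial.eval x (f + g) * integrand q t lq lt lg w x)
      = C.integral (fun x => MvPolynomial.eval x f * integrand q t lq lt lg w x)
        + C.integral fun x => MvPolynomial.eval x g * integrand q t lq lt lg w x := by
  rw [Contour.integral, Contour.integral, Contour.integral,
    ← (hC.summable f).tsum_add (hC.summable g)]
  refine tsum_congr fun a => ?_
  have hc : ∀ f : MvPolynomial (Fin N) ℂ, ContinuousOn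
      (fun x => MvPolynomial.eval x f * integrand q t lq lt lg w x)
      (productTrace fun i => C i (a i)) := fun f =>
    ((MvPolynomial.continuous_eval f).continuousOn.mul (hC.continuousOn_integrand hq)).mono
      (C.productTrace_component a)
  have h := productIntegral_sum (c := fun i => C i (a i)) (Finset.univ : Finset Bool)
    (F := fun k x => MvPolynomial.eval x (if k then f else g) * integrand q t lq lt lg w x)
    fun k _ => hc _
  simp only [Fintype.sum_bool, if_true, Bool.false_eq_true, if_false] at h
  rw [Contour.part, Contour.part, Contour.part, ← h]
  simp only [map_add, add_mul]

/-- A functional of finitely many coefficients of the generating function is the normalized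
expectation value of its value on the kernel. -/
theorem IsAdmissible.apply_genFun (hq : ‖q‖ < 1) (hC : IsAdmissible q t lq lt lg w m₀ C)
    {φ : Lam →ₗ[ℂ] ℂ} (hφ : φ ∈ finiteFunctionals) :
    φ (genFun q t lq lt lg w C)
      = C.integral (fun x => φ (kernel q t x) * integrand q t lq lt lg w x)
        / C.integral (integrand q t lq lt lg w) := by
  -- The induction carries along that `φ` of the kernel is a polynomial in `x`: the integrals of
  -- such functions converge, which additivity of the infinite sums requires.
  suffices h : ∃ f : MvPolynomial (Fin N) ℂ, (∀ x, φ (kernel q t x) = MvPolynomial.eval x f) ∧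
      φ (genFun q t lq lt lg w C)
        = C.integral (fun x => MvPolynomial.eval x f * integrand q t lq lt lg w x)
          / C.integral (integrand q t lq lt lg w) by
    obtain ⟨f, h1, h2⟩ := h
    simp only [h1, h2]
  induction hφ using Submodule.span_induction with
  | mem φ h =>
    obtain ⟨μ, rfl⟩ := h
    refine ⟨kernelPoly q t N μ, fun x => (eval_kernelPoly q t μ x).symm, ?_⟩
    simp only [eval_kernelPoly]
    rfl
  | zero =>
    refine ⟨0, fun x => by rw [map_zero, LinearMap.zero_apply], ?_⟩
    simp only [map_zero, zero_mul, LinearMap.zero_apply, Contour.integral, Contour.part,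
      productIntegral, mul_zero, MeasureTheory.integral_zero, Finset.sum_const_zero, tsum_zero,
      zero_div]
  | add φ ψ _ _ h1 h2 =>
    obtain ⟨f, hf, hf'⟩ := h1
    obtain ⟨g, hg, hg'⟩ := h2
    refine ⟨f + g, fun x => by rw [LinearMap.add_apply, hf, hg, map_add], ?_⟩
    rw [LinearMap.add_apply, hf', hg', hC.integral_eval_add hq, add_div]
  | smul r φ _ h =>
    obtain ⟨f, hf, hf'⟩ := h
    refine ⟨MvPolynomial.C r * f, fun x => by
      rw [LinearMap.smul_apply, hf, map_mul, MvPolynomial.eval_C, smul_eq_mul], ?_⟩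
    simp only [LinearMap.smul_apply, hf', map_mul, MvPolynomial.eval_C, mul_assoc, smul_eq_mul,
      Contour.integral, Contour.part, productIntegral_const_mul, tsum_mul_left, mul_div_assoc]

/-- All modes `Û_n` with `n ≥ m₀` annihilate the generating function, and the resummed constraint of
index `m` is built from the modes `Û_{j-m}` with `j ≥ 1`. -/
theorem IsAdmissible.constraintOp_genFun (hlq : Complex.exp lq = q) (hlt : Complex.exp lt = t)
    (hq : ‖q‖ < 1) (ht : ∀ k : ℕ, 1 ≤ k → t ^ k ≠ 1) (hqt : ∀ n : ℕ, q ^ n * t ≠ 1)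
    (hlg : IsLogBranch q lq lg) {Mp Mm : Polynomial ℂ} (hMp : Mp ≠ 0) (hMm : Mm ≠ 0) {dp dm : ℕ}
    (hdp : Mp.natDegree ≤ dp) (hdm : Mm.natDegree ≤ dm)
    (hw : ∀ z : ℂ, z ≠ 0 → ∀ᶠ y in 𝓝[≠] z, w y / w (q⁻¹ * y) = Mp.eval y / Mm.eval y)
    (hC : IsAdmissible q t lq lt lg w m₀ C)
    (hm₀ : m₀ = 0 ∨ (m₀ = -1 ∧ Mp.eval 0 = Mm.eval 0)) {m : ℤ} (hm : m ≤ 1 - m₀) :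
    constraintOp q t (t ^ N) Mp Mm dp dm m (genFun q t lq lt lg w C) = 0 := by
  have hq0 : q ≠ 0 := hlq ▸ Complex.exp_ne_zero _
  have ht0 : t ≠ 0 := hlt ▸ Complex.exp_ne_zero _
  have ht1 : t ≠ 1 := fun h => ht 1 le_rfl (by rw [pow_one, h])
  have hV : ∀ n : ℤ, m₀ ≤ n →
      virasoroMode q t (t ^ N) Mp Mm dp dm n (genFun q t lq lt lg w C) = 0 := by
    intro n hn
    refine MvPowerSeries.ext fun μ => ?_
    have h1 := hC.apply_genFun hq (IsFinitary.virasoroMode q t (t ^ N) Mp Mm dp dm n μ)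
    simp only [LinearMap.comp_apply] at h1
    -- The numerator is zero, so the quotient vanishes whether or not the normalizing integral does.
    rw [h1, hC.integral_virasoroMode hlq hlt hq ht1 hqt hlg hMp hMm hdp hdm hw hn ?_ μ, zero_div,
      map_zero]
    rcases hm₀ with h | ⟨h, h'⟩
    · exact Or.inl (h ▸ hn)
    · rcases le_or_gt 0 n with h0 | h0
      · exact Or.inl h0
      · exact Or.inr ⟨by omega, h'⟩
  rw [← resummedMode_eq_constraintOp (t ^ N) hq0 ht0 ht Mp Mm dp dm m]
  refine MvPowerSeries.ext fun μ => ?_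
  rw [resummedMode, coeff_gradedSum, map_zero]
  refine Finset.sum_eq_zero fun j _ => ?_
  -- For `j = 0` the bracket is `h_0 - 1 = 0`. This gains one index: the condition is `1 - m ≥ m₀`
  -- rather than `-m ≥ m₀`.
  rcases Nat.eq_zero_or_pos j with rfl | hj
  · have h0 : ∀ a : ℕ+ → Op, hMode a ((0 : ℕ) : ℤ) = 1 := fun a => by
      simp [hMode]
    rw [h0, kd, if_pos Nat.cast_zero, one_smul, sub_self, zero_mul, LinearMap.zero_apply, map_zero]
  · rw [Module.End.mul_apply, hV _ (by omega), map_zero, map_zero]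

end Contour

end


end QTMatrixModel

end

theorem mainTheorem3
    -- the parameters `q, t`, with chosen values `lq, lt` of `log q` and `log t`
    (q t lq lt : ℂ) (hlq : Complex.exp lq = q) (hlt : Complex.exp lt = t) (hq : ‖q‖ < 1)
    (ht : ∀ k : ℕ, 1 ≤ k → t ^ k ≠ 1) (hqt : ∀ n : ℕ, q ^ n * t ≠ 1)
    -- the branch of the logarithm, the weight function and the two polynomials
    (lg : ℂ → ℂ) (hlg : QTMatrixModel.IsLogBranch q lq lg) (w : ℂ → ℂ)
    (Mp Mm : Polynomial ℂ) (hMp : Mp ≠ 0) (hMm : Mm ≠ 0) (dp dm : ℕ)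
    (hdp : Mp.natDegree ≤ dp) (hdm : Mm.natDegree ≤ dm)
    (hw : ∀ z : ℂ, z ≠ 0 →
      ∀ᶠ y in nhdsWithin z {z}ᶜ, w y / w (q⁻¹ * y) = Mp.eval y / Mm.eval y)
    -- the index of the lowest constraint
    (m₀ : ℤ) (hm₀ : m₀ = 0 ∨ (m₀ = -1 ∧ Mp.eval 0 = Mm.eval 0 ∧ Mm.eval 0 ≠ 0))
    -- the rank and the contour
    (N : ℕ) (ι : Type) (C : QTMatrixModel.Contour N ι)
    (hC : QTMatrixModel.IsAdmissible q t lq lt lg w m₀ C) :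
    -- the resummed constraints are expressed through the toroidal modes and the `h_n`,
    (∀ m : ℤ, QTMatrixModel.resummedMode q t (t ^ N) Mp Mm dp dm m
        = QTMatrixModel.constraintOp q t (t ^ N) Mp Mm dp dm m) ∧
    -- annihilate the generating function,
    (∀ m : ℤ, m ≤ 1 - m₀ →
      QTMatrixModel.constraintOp q t (t ^ N) Mp Mm dp dm m
        (QTMatrixModel.genFun q t lq lt lg w C) = 0) ∧
    -- and the constraint with `m = dm` is the recursion equation.
    (dp ≤ dm →
      QTMatrixModel.constraintOp q t (t ^ N) Mp Mm dp dm dm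
        = QTMatrixModel.recursionOp q t (t ^ N) Mp Mm dp dm) ∧
    (dp ≤ dm → (dm : ℤ) ≤ 1 - m₀ →
      QTMatrixModel.recursionOp q t (t ^ N) Mp Mm dp dm
        (QTMatrixModel.genFun q t lq lt lg w C) = 0) := by
  have hq0 : q ≠ 0 := hlq ▸ Complex.exp_ne_zero _
  have ht0 : t ≠ 0 := hlt ▸ Complex.exp_ne_zero _
  have hZ : ∀ m : ℤ, m ≤ 1 - m₀ →
      QTMatrixModel.constraintOp q t (t ^ N) Mp Mm dp dm m
        (QTMatrixModel.genFun q t lq lt lg w C) = 0 := fun m hm =>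
    hC.constraintOp_genFun hlq hlt hq ht hqt hlg hMp hMm hdp hdm hw
      (hm₀.imp_right fun h => ⟨h.1, h.2.1⟩) hm
  refine ⟨QTMatrixModel.resummedMode_eq_constraintOp _ hq0 ht0 ht Mp Mm dp dm, hZ,
    QTMatrixModel.constraintOp_eq_recursionOp q t _ Mp Mm, fun h hdm => ?_⟩
  rw [← QTMatrixModel.constraintOp_eq_recursionOp q t _ Mp Mm h]
  exact hZ _ hdm
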